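/- **Setting.** Let $R\ge 1$, $M_1,\dots,M_R\ge 1$, $M=\prod_{l}M_l$, and consider the uniform $R$-dimensional grid with an $M_l$-element uniform linear array in mode $l$, with steering vector $a(\mu)=a^{(1)}(\mu^{(1)})\otimes\cdots\otimes a^{(R)}(\mu^{(R)})$, $a^{(l)}(\mu^{(l)})=[1,e^{j\mu^{(l)}},\dots,e^{j(M_l-1)\mu^{(l)}}]^T$. A single strictly non-circular source sends $N$ symbols $s=e^{j\varphi}s_0$, $s_0\in\mathbb R^N$, and $X=a(\mu)s^T+W\in\mathbb C^{M\times N}$ is observed. The noise $W$ is zero-mean, circularly symmetric and white: its entries have finite second-order moments, covariance matrix $\sigma^2 I_{MN}$ and pseudo-covariance matrix $0$, $\sigma>0$. The effective SNR is $\hat\rho=N\hat P_s/\sigma^2$ with $\hat P_s=\|s\|_2^2/N$. Fix a mode $r$ with $M_r\ge 2$ and $\mu^{(r)}\in(-\pi,\pi)$. Write $\Pi$ for exchange matrices, $X^*$ for the entrywise conjugate, $J_1=I\otimes[I_{M_r-1},0]\otimes I$ and $J_2=I\otimes[0,I_{M_r-1}]\otimes I$ for the mode-$r$ selection matrices (maximum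 overlap), $J_1^{(nc)}=\mathrm{blkdiag}\{J_1,\Pi J_2\Pi\}$, $J_2^{(nc)}=\mathrm{blkdiag}\{J_2,\Pi J_1\Pi\}$, and $Q_{2n}=\frac1{\sqrt2}\begin{bmatrix}I_n&jI_n\\ \Pi_n&-j\Pi_n\end{bmatrix}$. *$R$-D NC Standard ESPRIT:* $\hat\mu^{(r)}=\arg\big((J_1^{(nc)}\hat u)^+J_2^{(nc)}\hat u\big)\in(-\pi,\pi]$, with $\hat u$ a dominant left singular vector of $\begin{bmatrix}X\\ \Pi X^*\end{bmatrix}$. *$R$-D NC Unitary ESPRIT:* $\hat\mu^{(r)}=2\arctan\big((K_1\hat e)^+K_2\hat e\big)$, with $\hat e$ a real dominant left singular vector of $\begin{bmatrix}\mathrm{Re}X\\ \mathrm{Im}X\end{bmatrix}$, $K_1=2\,\mathrm{Re}(Q^HJ_2^{(nc)}Q)$ and $K_2=2\,\mathrm{Im}(Q^HJ_2^{(nc)}Q)$, where the $Q$'s are the matrices $Q_{2n}$ of the fitting orders. *The non-NC counterparts:* $R$-D Standard ESPRIT is $\arg\big((J_1\hat u)^+J_2\hat u\big)$ with $\hat u$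 a dominant left singular vector of $X$. $R$-D Unitary ESPRIT is $2\arctan\big((K_1\hat e)^+K_2\hat e\big)$ with $K_1=2\,\mathrm{Re}(\tilde Q^HJ_2Q)$, $K_2=2\,\mathrm{Im}(\tilde Q^HJ_2Q)$ and $\hat e$ a real dominant left singular vector of $Q^H[X,\ \Pi X^*\Pi]\,Q_{2N}$, where $Q,\tilde Q$ are any unitary matrices of the fitting orders with $\Pi Q^*=Q$, $\Pi\tilde Q^*=\tilde Q$. **Theorem.** For $R$-D NC Standard ESPRIT and $R$-D NC Unitary ESPRIT the mean square error in mode $r$ is, to first order, $$\frac1{\hat\rho}\cdot\frac{M_r}{M(M_r-1)^2},$$ and the same holds for $R$-D Standard ESPRIT and $R$-D Unitary ESPRIT, so that a single source gains nothing from non-circularity. Precisely, for each of the four methods: 1. For $s_0\ne0$ the error has an expansion $\hat\mu^{(r)}-\mu^{(r)}=L(W)+O(\|W\|^2)$ as $W\to0$ with a real-linear $L$, and $\mathbb E\{L(W)^2\}=\frac1{\hat\rho}\cdot\frac{M_r}{M(M_r-1)^2}$ exactly, for all noise as above. 2. If $W=\sigma W_0$ with $W_0$ of fixed law (zero mean,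 unit white covariance, zero pseudo-covariance), then $\mathbb E\{(\hat\mu^{(r)}-\mu^{(r)})^2\}=\frac1{\hat\rho}\cdot\frac{M_r}{M(M_r-1)^2}+o(1/\hat\rho)$ as $\hat\rho\to\infty$, uniformly in $s_0,\varphi,\sigma$. 3. If moreover the law of $W$ is invariant under multiplication by $e^{j\theta}$ for every $\theta$, and the fourth absolute moments of the entries of $W$ are at most $K\sigma^4$, then $$\mathbb E\{(\hat\mu^{(r)}-\mu^{(r)})^2\}=\frac1{\hat\rho}\cdot\frac{M_r}{M(M_r-1)^2}+O\!\left(\frac1{\hat\rho^2}\right)\qquad(\hat\rho\to\infty),$$ with a constant that depends only on the $M_l$, $N$, $\mu$, $r$, $K$ and the method. -/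

import Mathlib

open Real Matrix MeasureTheory ProbabilityTheory

noncomputable section

namespace Esprit

/-! ### Linear algebra -/

/-- The exchange matrix `Π` of a finite index set whose order reversal is `rev`. -/
def exchange {ι : Type*} [DecidableEq ι] (rev : ι → ι) : Matrix ι ι ℂ :=
  Matrix.of fun i j => if j = rev i then 1 else 0

/-- `u` is a unit left singular vector of `X` that belongs to the largest singular value of `X`:
the left singular vectors are the eigenvectors of `X Xᴴ`, whose eigenvalues are the squares of
the singular values. It spans the signal subspace estimate for a single source. -/
def IsDominantLeftSingularVector {𝕜 : Type*} [RCLike 𝕜] {m n : Type*} [Fintype m] [Fintype n]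
    (X : Matrix m n 𝕜) (u : m → 𝕜) : Prop :=
  star u ⬝ᵥ u = 1 ∧ ∃ σ : ℝ, 0 ≤ σ ∧ (X * Xᴴ) *ᵥ u = ((σ ^ 2 : ℝ) : 𝕜) • u ∧
    ∀ (τ : ℝ) (w : m → 𝕜), w ≠ 0 → (X * Xᴴ) *ᵥ w = ((τ ^ 2 : ℝ) : 𝕜) • w → τ ≤ σ

/-- The least squares solution `x⁺ y` of `x γ ≈ y` for columns `x` and `y`; the Moore-Penrose
inverse of a column is `x⁺ = xᴴ / ‖x‖²` (and `0⁺ = 0`). -/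
def leastSquares {𝕜 : Type*} [RCLike 𝕜] {m : Type*} [Fintype m] (x y : m → 𝕜) : 𝕜 :=
  (star x ⬝ᵥ y) / (star x ⬝ᵥ x)

/-- The unitary left `Π`-real matrix `Q` of even order `2n`,
`(1/√2) [[I, jI], [Π, -jΠ]]`. -/
def evenLeftPiReal {ι : Type*} [DecidableEq ι] (rev : ι → ι) : Matrix (ι ⊕ ι) (ι ⊕ ι) ℂ :=
  ((1 / √2 : ℝ) : ℂ) • Matrix.fromBlocks 1 (Complex.I • (1 : Matrix ι ι ℂ))
    (exchange rev) (-(Complex.I • exchange rev))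

/-- `Q` is unitary and left `Π`-real: `Π Q^* = Q` (entrywise conjugate). -/
def IsUnitaryLeftPiReal {ι : Type*} [Fintype ι] [DecidableEq ι] (rev : ι → ι)
    (Q : Matrix ι ι ℂ) : Prop :=
  Qᴴ * Q = 1 ∧ exchange rev * Q.map star = Q

/-! ### The uniform `R`-D grid -/

/-- Sensors of the `M₁ × ⋯ × M_R` grid. Columns indexed by multi-indices stand for the stacked
columns of length `M = M₁ ⋯ M_R`; a Kronecker product of one factor per mode has as its entries
the products of the entries of the factors. -/
abbrev Sensor {R : ℕ} (M : Fin R → ℕ) : Type := (l : Fin R) → Fin (M l)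

/-- Sensors of either subarray in mode `r`: `M_r - 1` positions in mode `r`, all positions in the
other modes. -/
abbrev SubSensor {R : ℕ} (M : Fin R → ℕ) (r : Fin R) : Type :=
  ((l : {l : Fin R // l ≠ r}) → Fin (M l)) × Fin (M r - 1)

/-- Reversal of the stacking order of the sensors; it reverses every mode. -/
def revSensor {R : ℕ} (M : Fin R → ℕ) (m : Sensor M) : Sensor M := fun l => (m l).rev

/-- Reversal of the stacking order of the sensors of a subarray. -/
def revSubSensor {R : ℕ} (M : Fin R → ℕ) (r : Fin R) (p : SubSensor M r) : SubSensor M r :=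
  (fun l => (p.1 l).rev, p.2.rev)

/-- The selection matrix `[I, 0]` of a ULA with maximum overlap. -/
def ulaSel₁ (n : ℕ) : Matrix (Fin (n - 1)) (Fin n) ℂ :=
  Matrix.of fun i j => if (j : ℕ) = i then 1 else 0

/-- The selection matrix `[0, I]` of a ULA with maximum overlap. -/
def ulaSel₂ (n : ℕ) : Matrix (Fin (n - 1)) (Fin n) ℂ :=
  Matrix.of fun i j => if (j : ℕ) = i + 1 then 1 else 0

/-- The `R`-D selection matrix `I ⊗ J ⊗ I` with `J` in mode `r`. -/
def rdSel {R : ℕ} {M : Fin R → ℕ} (r : Fin R) (J : Matrix (Fin (M r - 1)) (Fin (M r)) ℂ) :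
    Matrix (SubSensor M r) (Sensor M) ℂ :=
  Matrix.of fun p m => if ∀ l : {l : Fin R // l ≠ r}, m l = p.1 l then J p.2 (m r) else 0

/-- The first `R`-D selection matrix in mode `r`. -/
def sel₁ {R : ℕ} (M : Fin R → ℕ) (r : Fin R) : Matrix (SubSensor M r) (Sensor M) ℂ :=
  rdSel r (ulaSel₁ (M r))

/-- The second `R`-D selection matrix in mode `r`. -/
def sel₂ {R : ℕ} (M : Fin R → ℕ) (r : Fin R) : Matrix (SubSensor M r) (Sensor M) ℂ :=
  rdSel r (ulaSel₂ (M r))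

/-- The first augmented selection matrix `blkdiag{J₁, Π J₂ Π}`. -/
def ncSel₁ {R : ℕ} (M : Fin R → ℕ) (r : Fin R) :
    Matrix (SubSensor M r ⊕ SubSensor M r) (Sensor M ⊕ Sensor M) ℂ :=
  Matrix.fromBlocks (sel₁ M r) 0 0
    (exchange (revSubSensor M r) * sel₂ M r * exchange (revSensor M))

/-- The second augmented selection matrix `blkdiag{J₂, Π J₁ Π}`. -/
def ncSel₂ {R : ℕ} (M : Fin R → ℕ) (r : Fin R) :
    Matrix (SubSensor M r ⊕ SubSensor M r) (Sensor M ⊕ Sensor M) ℂ :=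
  Matrix.fromBlocks (sel₂ M r) 0 0
    (exchange (revSubSensor M r) * sel₁ M r * exchange (revSensor M))

/-! ### The data model -/

/-- The array steering vector `a(μ) = a⁽¹⁾(μ⁽¹⁾) ⊗ ⋯ ⊗ a⁽ᴿ⁾(μ⁽ᴿ⁾)` with
`a⁽ˡ⁾ = [1, exp(jμ⁽ˡ⁾), …, exp(j(M_l - 1)μ⁽ˡ⁾)]ᵀ`. -/
def steering {R : ℕ} (M : Fin R → ℕ) (μ : Fin R → ℝ) (m : Sensor M) : ℂ :=
  ∏ l, Complex.exp (Complex.I * ((m l : ℕ) : ℂ) * (μ l : ℂ))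

/-- The symbols `s = exp(jφ) s₀`, `s₀` real, of a strictly non-circular source. -/
def symbols {N : ℕ} (φ : ℝ) (s₀ : Fin N → ℝ) (t : Fin N) : ℂ :=
  Complex.exp (Complex.I * (φ : ℂ)) * (s₀ t : ℂ)

/-- The measurement matrix `X = a(μ) sᵀ + E` for the noise matrix `E`. -/
def measurement {R N : ℕ} {M : Fin R → ℕ} (μ : Fin R → ℝ) (s : Fin N → ℂ)
    (E : Matrix (Sensor M) (Fin N) ℂ) : Matrix (Sensor M) (Fin N) ℂ :=
  Matrix.of fun m t => steering M μ m * s t + E m t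

/-- The empirical source power `‖s‖² / N`. -/
def empiricalPower {N : ℕ} (s : Fin N → ℂ) : ℝ := (∑ t, ‖s t‖ ^ 2) / N

/-- The effective SNR `N P̂ / σ²`. -/
def effectiveSNR {N : ℕ} (s : Fin N → ℂ) (σ : ℝ) : ℝ := N * empiricalPower s / σ ^ 2

/-- The Frobenius norm of a noise matrix. -/
def noiseNorm {R N : ℕ} {M : Fin R → ℕ} (E : Matrix (Sensor M) (Fin N) ℂ) : ℝ :=
  √(∑ m, ∑ t, ‖E m t‖ ^ 2)

/-! ### Noise -/

/-- Zero-mean noise with finite second-order moments, covariance matrix `σ² I` and pseudo-covariance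
matrix `0`: white noise that is circularly symmetric to second order. -/
structure IsCircularWhite {Ω ι κ : Type*} [MeasurableSpace Ω] [DecidableEq ι] [DecidableEq κ]
    (P : Measure Ω) (W : Ω → Matrix ι κ ℂ) (σ : ℝ) : Prop where
  memLp : ∀ i t, MemLp (fun ω => W ω i t) 2 P
  mean : ∀ i t, ∫ ω, W ω i t ∂P = 0
  cov : ∀ i t j u, ∫ ω, W ω i t * star (W ω j u) ∂P =
    if i = j ∧ t = u then ((σ ^ 2 : ℝ) : ℂ) else 0
  pseudoCov : ∀ i t j u, ∫ ω, W ω i t * W ω j u ∂P = 0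

/-- Circular symmetry in law: the joint law of all entries is invariant under multiplication by
`exp(jθ)` for every `θ`. -/
def IsCircularInLaw {Ω ι κ : Type*} [MeasurableSpace Ω]
    (P : Measure Ω) (W : Ω → Matrix ι κ ℂ) : Prop :=
  ∀ θ : ℝ, IdentDistrib
    (fun ω (p : ι × κ) => Complex.exp (Complex.I * (θ : ℂ)) * W ω p.1 p.2)
    (fun ω (p : ι × κ) => W ω p.1 p.2) P P

/-! ### The estimators for a single source

In each case the predicate holds for `(X, μ̂)` if `μ̂` is a possible output in mode `r` for the
measurement matrix `X`, whichever dominant singular vector was computed. For a single source the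
estimated shift matrix is a scalar and equal to its eigenvalue. -/

section Estimators

variable {R N : ℕ} {M : Fin R → ℕ}

/-- The augmented measurement matrix `[X; Π X^*]`. -/
def ncData (X : Matrix (Sensor M) (Fin N) ℂ) : Matrix (Sensor M ⊕ Sensor M) (Fin N) ℂ :=
  Matrix.fromRows X (exchange (revSensor M) * X.map star)

/-- The forward-backward averaged measurement matrix `[X, Π X^* Π]`. -/
def fbaData (X : Matrix (Sensor M) (Fin N) ℂ) : Matrix (Sensor M) (Fin N ⊕ Fin N) ℂ :=
  Matrix.fromCols X (exchange (revSensor M) * X.map star * exchange Fin.rev)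

/-- `R`-D NC Standard ESPRIT. -/
def IsNCStandard (r : Fin R) (X : Matrix (Sensor M) (Fin N) ℂ) (μhat : ℝ) : Prop :=
  ∃ u : Sensor M ⊕ Sensor M → ℂ, IsDominantLeftSingularVector (ncData X) u ∧
    μhat = Complex.arg (leastSquares (ncSel₁ M r *ᵥ u) (ncSel₂ M r *ᵥ u))

/-- The transformed augmented selection matrix `Qᴴ J₂ Q`, whose doubled real and imaginary parts are
`K₁` and `K₂`. -/
def ncRealSel (M : Fin R → ℕ) (r : Fin R) :
    Matrix (SubSensor M r ⊕ SubSensor M r) (Sensor M ⊕ Sensor M) ℂ :=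
  (evenLeftPiReal (revSubSensor M r))ᴴ * ncSel₂ M r * evenLeftPiReal (revSensor M)

/-- `R`-D NC Unitary ESPRIT. -/
def IsNCUnitary (r : Fin R) (X : Matrix (Sensor M) (Fin N) ℂ) (μhat : ℝ) : Prop :=
  ∃ e : Sensor M ⊕ Sensor M → ℝ,
    IsDominantLeftSingularVector (Matrix.fromRows (X.map Complex.re) (X.map Complex.im)) e ∧
    μhat = 2 * Real.arctan (leastSquares
      (((2 : ℝ) • (ncRealSel M r).map Complex.re) *ᵥ e)
      (((2 : ℝ) • (ncRealSel M r).map Complex.im) *ᵥ e))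

/-- `R`-D Standard ESPRIT (without the preprocessing for non-circular sources). -/
def IsStandard (r : Fin R) (X : Matrix (Sensor M) (Fin N) ℂ) (μhat : ℝ) : Prop :=
  ∃ u : Sensor M → ℂ, IsDominantLeftSingularVector X u ∧
    μhat = Complex.arg (leastSquares (sel₁ M r *ᵥ u) (sel₂ M r *ᵥ u))

/-- `R`-D Unitary ESPRIT (without the preprocessing for non-circular sources), with any unitary
left `Π`-real matrices of the two orders; the transformed data are real since the forward-backward
averaged matrix is centro-Hermitian. -/
def IsUnitary (r : Fin R) (X : Matrix (Sensor M) (Fin N) ℂ) (μhat : ℝ) : Prop :=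
  ∃ (Q : Matrix (Sensor M) (Sensor M) ℂ) (Q' : Matrix (SubSensor M r) (SubSensor M r) ℂ)
    (e : Sensor M → ℝ),
    IsUnitaryLeftPiReal (revSensor M) Q ∧ IsUnitaryLeftPiReal (revSubSensor M r) Q' ∧
    IsDominantLeftSingularVector
      ((Qᴴ * fbaData X * evenLeftPiReal (Fin.rev : Fin N → Fin N)).map Complex.re) e ∧
    μhat = 2 * Real.arctan (leastSquares
      (((2 : ℝ) • (Q'ᴴ * sel₂ M r * Q).map Complex.re) *ᵥ e)
      (((2 : ℝ) • (Q'ᴴ * sel₂ M r * Q).map Complex.im) *ᵥ e))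

end Estimators

/-- The two NC algorithms and their two counterparts without the NC preprocessing. -/
inductive Method
  | ncStandard
  | ncUnitary
  | standard
  | unitary

/-- `μhat` is an output of the method in mode `r` for the measurement matrix `X`. -/
def IsEstimate {R N : ℕ} {M : Fin R → ℕ} : Method → Fin R → Matrix (Sensor M) (Fin N) ℂ → ℝ → Prop
  | .ncStandard => IsNCStandard
  | .ncUnitary => IsNCUnitary
  | .standard => IsStandard
  | .unitary => IsUnitary

/-- The asymptotic mean square error `(1/ρ) · M_r / (M (M_r - 1)²)` in mode `r`, `M = ∏ M_l`. -/
def asymptoticMSE {R : ℕ} (M : Fin R → ℕ) (r : Fin R) (ρ : ℝ) : ℝ :=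
  1 / ρ * ((M r : ℝ) / ((∏ l, (M l : ℝ)) * ((M r : ℝ) - 1) ^ 2))

end Esprit

end

namespace Esprit

open Asymptotics Filter Topology

/-! Each estimate is `κ` times the argument of a quadratic form `uᴴ T u` at a dominant eigenvector
`u` of the Gram matrix of a noisy rank one matrix `a sᵀ + E`. This matrix is the data matrix, its
forward-backward average or its augmentation. For the standard methods `T = J₁ᴴ J₂` and `κ = 1`. For
the unitary ones, after a unitary change of coordinates, `T = (J₁ᴴ J₁ + J₂ᴴ J₂) / 2 + J₁ᴴ J₂` and `κ
= 2` (`arctan_leastSquares`).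

With `b = E s^* / ‖s‖²`, completing the square writes the Gram matrix, divided by `‖s‖²`, as `(a +
b)(a + b)ᴴ + C` with `C` quadratic in the noise (`gram_vecMulVec_add`). Hence `u` is proportional to
`a + b + C a / ‖a‖²` up to third order (`exists_smul_topEigenvector_near`). The error is therefore a
linear term `L`, plus an even second-order term `q`, plus a cubic remainder, with constants uniform
in the symbols (`hasErrorExpansion_of_model`).

For both forms `L` is the imaginary part of `⟨J₂ a, J₂ b⟩ - ⟨J₁ a, J₁ b⟩` divided by `‖J₁ a‖²`
(`IsPhaseForm`). Reversing the array with conjugation exchanges the subarrays and keeps this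
imaginary part, so neither averaging nor augmentation changes `L`: this is why non-circularity gains
nothing. The difference telescopes to the two ends of mode `r`, that is to `2 M / M_r` sensors with
weights `±1`, and this count yields the constant (`linearError_mean_sq`).

For the mean square error, the estimates are bounded, which controls large noise where the expansion
is void. The squared error differs from `L²` by at most a constant times `x² min(1, x)`, with `x`
the relative noise, and dominated convergence gives `o(1/ρ)` from second moments alone. For noise
circular in law the cross term `2 L q` is odd and averages to zero, and what remains is of order
`x⁴`, hence `O(1/ρ²)`. -/

/-! ### Perturbation of a dominant eigenvector -/

section Perturbation

variable {H : Type*} [NormedAddCommGroup H] [InnerProductSpace ℂ H]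

/-- A top eigenvector of the rank one operator `(a + b)(a + b)ᴴ` perturbed by a small `C` is, after
scaling, `a + b + C a / ‖a‖²` up to terms of third order. -/
theorem exists_smul_topEigenvector_near {a b u : H} {C : H →ₗ[ℂ] H} {lam ε : ℝ}
    (ha : 1 ≤ ‖a‖) (hε : 0 ≤ ε) (hε' : ε ≤ 1 / 8) (hb : ‖b‖ ≤ ε)
    (hC : ∀ x, ‖C x‖ ≤ 2 * ε ^ 2 * ‖x‖) (hu : ‖u‖ = 1)
    (heig : (lam : ℂ) • u = inner ℂ (a + b) u • (a + b) + C u)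
    (hray : ∀ x, (inner ℂ x (inner ℂ (a + b) x • (a + b) + C x)).re ≤ lam * ‖x‖ ^ 2) :
    ∃ c : ℂ, c ≠ 0 ∧
      ‖c • u - (a + b + ((‖a‖ ^ 2 : ℝ) : ℂ)⁻¹ • C a)‖ ≤ 24 * ε ^ 3 := by
  set A := ‖a‖ with hA
  set a' := a + b with ha'
  have hub : ‖a'‖ ≤ A + ε := (norm_add_le _ _).trans (by linarith)
  have hlb : A - ε ≤ ‖a'‖ := by
    have := norm_sub_norm_le a (-b)
    rw [sub_neg_eq_add, norm_neg] at this
    linarith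
  have hpos : 0 < ‖a'‖ := by linarith
  -- The Rayleigh bound is tested at `a'`. The losses from `C` and from `‖a'‖ ≥ A - ε` together stay
  -- below `A ^ 2 / 2` because `ε ≤ 1 / 8` and `A ≥ 1`.
  have hlam : A ^ 2 / 2 ≤ lam := by
    have h1 := hray a'
    rw [inner_add_right, inner_smul_right, Complex.add_re, inner_self_eq_norm_sq_to_K] at h1
    have h2 : |(inner ℂ a' (C a')).re| ≤ ‖a'‖ * (2 * ε ^ 2 * ‖a'‖) :=
      (Complex.abs_re_le_norm _).trans ((norm_inner_le_norm _ _).trans (by gcongr; exact hC _))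
    have h3 : (((‖a'‖ : ℂ)) ^ 2 * ((‖a'‖ : ℂ)) ^ 2).re = ‖a'‖ ^ 2 * ‖a'‖ ^ 2 := by norm_cast
    have h4 : ‖a'‖ ^ 2 * (‖a'‖ ^ 2 - 2 * ε ^ 2) ≤ ‖a'‖ ^ 2 * lam := by
      have := (abs_le.1 h2).1
      change (((‖a'‖ : ℂ)) ^ 2 * ((‖a'‖ : ℂ)) ^ 2).re + _ ≤ _ at h1
      rw [h3] at h1
      nlinarith
    have h5 := le_of_mul_le_mul_left h4 (by positivity)
    have h6 : (A - ε) ^ 2 ≤ ‖a'‖ ^ 2 := by gcongr; linarith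
    nlinarith
  have hlam0 : 0 < lam := by nlinarith
  have hlamC : (lam : ℂ) ≠ 0 := by exact_mod_cast hlam0.ne'
  -- If `u` were orthogonal to `a'`, then `lam • u = C u`, so `lam ≤ 2 * ε ^ 2 ≤ 1 / 32`, against
  -- `lam ≥ 1 / 2`.
  have hin : inner ℂ a' u ≠ 0 := by
    intro h0
    rw [h0, zero_smul, zero_add] at heig
    have h1 := hC u
    rw [← heig, norm_smul, hu, Complex.norm_real, Real.norm_eq_abs, abs_of_pos hlam0] at h1
    nlinarith
  -- With this scaling the inner product of `a'` with `v` is exactly `lam`, and the eigenvector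
  -- equation becomes the fixed-point equation `v = a' + lam⁻¹ C v`.
  set c : ℂ := lam / inner ℂ a' u with hc
  refine ⟨c, div_ne_zero hlamC hin, ?_⟩
  set v := c • u with hv
  have hav : inner ℂ a' v = lam := by
    rw [hv, inner_smul_right, hc, div_mul_cancel₀ _ hin]
  have hveq : v = a' + (lam : ℂ)⁻¹ • C v := by
    have h1 : (lam : ℂ) • v = (lam : ℂ) • a' + C v := by
      rw [hv, smul_comm, heig, smul_add, map_smul, smul_smul, hc, div_mul_cancel₀ _ hin]
    calc v = (lam : ℂ)⁻¹ • ((lam : ℂ) • v) := by rw [smul_smul, inv_mul_cancel₀ hlamC, one_smul]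
      _ = _ := by rw [h1, smul_add, smul_smul, inv_mul_cancel₀ hlamC, one_smul]
  have hlinv : lam⁻¹ ≤ 2 / A ^ 2 := by
    rw [inv_le_comm₀ hlam0 (by positivity), inv_div]; exact hlam
  have hnC : ∀ x, ‖(lam : ℂ)⁻¹ • C x‖ ≤ 2 / A ^ 2 * (2 * ε ^ 2 * ‖x‖) := by
    intro x
    rw [norm_smul, norm_inv, Complex.norm_real, Real.norm_eq_abs, abs_of_pos hlam0]
    gcongr
    exact hC x
  have hA2 : 2 / A ^ 2 ≤ 2 := by
    rw [div_le_iff₀ (by positivity)]; nlinarith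
  have hvn : ‖v‖ ≤ 2 * A := by
    have h1 : ‖v‖ ≤ ‖a'‖ + ‖(lam : ℂ)⁻¹ • C v‖ := by
      conv_lhs => rw [hveq]
      exact norm_add_le _ _
    have h2 : 2 / A ^ 2 * (2 * ε ^ 2 * ‖v‖) ≤ 2 * (2 * (1 / 8) ^ 2 * ‖v‖) := by gcongr
    have := hnC v
    linarith
  have hva' : ‖v - a'‖ ≤ ε := by
    have h1 : v - a' = (lam : ℂ)⁻¹ • C v := by rw [sub_eq_iff_eq_add']; exact hveq
    rw [h1]
    refine (hnC v).trans ?_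
    calc 2 / A ^ 2 * (2 * ε ^ 2 * ‖v‖) ≤ 2 / A ^ 2 * (2 * ε ^ 2 * (2 * A)) := by gcongr
      _ = 8 * ε ^ 2 / A := by field_simp; ring
      _ ≤ ε := by rw [div_le_iff₀ (by linarith)]; nlinarith
  have hva : ‖v - a‖ ≤ 2 * ε := by
    have : v - a = (v - a') + b := by rw [ha']; abel
    rw [this]
    exact (norm_add_le _ _).trans (by linarith)
  -- As `lam` is the inner product of `a'` with `v`, the closeness of `v` to `a` controls it to
  -- first order.
  have hlA : |lam - A ^ 2| ≤ 4 * A * ε := by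
    have h1 : ((lam - A ^ 2 : ℝ) : ℂ) = inner ℂ b v + inner ℂ a (v - a) := by
      have h2 : inner ℂ a a = ((A ^ 2 : ℝ) : ℂ) := by
        rw [inner_self_eq_norm_sq_to_K]; norm_cast
      rw [Complex.ofReal_sub, ← hav, ← h2, inner_sub_right, ha', inner_add_left]
      ring
    rw [← Real.norm_eq_abs, ← Complex.norm_real, h1]
    refine (norm_add_le _ _).trans ?_
    have h2 : ‖inner ℂ b v‖ ≤ ε * (2 * A) := (norm_inner_le_norm _ _).trans (by gcongr)
    have h3 : ‖inner ℂ a (v - a)‖ ≤ A * (2 * ε) := (norm_inner_le_norm _ _).trans (by gcongr)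
    linarith
  -- Replacing `v` by `a` and `lam` by `A ^ 2` in the fixed-point equation gains one order each; the
  -- two errors are `8 * ε ^ 3` and `16 * ε ^ 3`.
  have hdec : v - (a' + ((A ^ 2 : ℝ) : ℂ)⁻¹ • C a) =
      (lam : ℂ)⁻¹ • C (v - a) + ((lam : ℂ)⁻¹ - ((A ^ 2 : ℝ) : ℂ)⁻¹) • C a := by
    have h1 : v - a' = (lam : ℂ)⁻¹ • C v := by rw [sub_eq_iff_eq_add']; exact hveq
    rw [← sub_sub, h1, map_sub]
    module
  rw [hdec]
  refine (norm_add_le _ _).trans ?_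
  have h1 : ‖(lam : ℂ)⁻¹ • C (v - a)‖ ≤ 8 * ε ^ 3 := by
    refine (hnC _).trans ?_
    calc 2 / A ^ 2 * (2 * ε ^ 2 * ‖v - a‖) ≤ 2 * (2 * ε ^ 2 * (2 * ε)) := by gcongr
      _ = 8 * ε ^ 3 := by ring
  have h2 : ‖((lam : ℂ)⁻¹ - ((A ^ 2 : ℝ) : ℂ)⁻¹) • C a‖ ≤ 16 * ε ^ 3 := by
    rw [norm_smul]
    have hA0 : (0 : ℝ) < A ^ 2 := by positivity
    have h3 : ‖(lam : ℂ)⁻¹ - ((A ^ 2 : ℝ) : ℂ)⁻¹‖ ≤ 8 * ε / A ^ 3 := by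
      rw [← Complex.ofReal_inv, ← Complex.ofReal_inv, ← Complex.ofReal_sub, Complex.norm_real,
        Real.norm_eq_abs, inv_sub_inv hlam0.ne' hA0.ne', abs_div, abs_sub_comm,
        abs_of_pos (mul_pos hlam0 hA0), div_le_div_iff₀ (mul_pos hlam0 hA0) (by positivity)]
      calc |lam - A ^ 2| * A ^ 3 ≤ 4 * A * ε * A ^ 3 := by gcongr
        _ = 8 * ε * (A ^ 2 / 2 * A ^ 2) := by ring
        _ ≤ 8 * ε * (lam * A ^ 2) := by gcongr
    calc _ ≤ 8 * ε / A ^ 3 * (2 * ε ^ 2 * A) := by gcongr; exact hC a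
      _ = 16 * ε ^ 3 / A ^ 2 := by field_simp; ring
      _ ≤ 16 * ε ^ 3 := div_le_self (by positivity) (by nlinarith)
  linarith

end Perturbation

/-! ### Second-order expansion of the argument -/

theorem log_one_add_sub_isBigO :
    (fun z : ℂ => Complex.log (1 + z) - (z - z ^ 2 / 2)) =O[𝓝 0] fun z => z ^ 3 := by
  refine IsBigO.of_bound 1 ?_
  filter_upwards [Metric.ball_mem_nhds (0 : ℂ) (show (0 : ℝ) < 1 / 2 by norm_num)] with z hz
  rw [mem_ball_zero_iff] at hz
  have h := Complex.norm_log_sub_logTaylor_le 2 (z := z) (by linarith)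
  have h2 : Complex.logTaylor (2 + 1) z = z - z ^ 2 / 2 := by
    simp [Complex.logTaylor_succ, Complex.logTaylor_zero]; ring
  rw [h2] at h
  refine h.trans ?_
  rw [norm_pow, mul_div_assoc, mul_comm]
  gcongr
  have : (1 - ‖z‖)⁻¹ ≤ 2 := by rw [inv_le_comm₀ (by linarith) (by norm_num)]; linarith
  norm_num
  linarith

/-- The square `w ^ 2` may be replaced by `w₁ ^ 2`, since the difference `(w - w₁) * (w + w₁)` is a
product of terms of orders two and one. -/
theorem log_one_add_expansion {ι : Type*} {l : Filter ι} {ε : ι → ℝ} (hε : Tendsto ε l (𝓝 0))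
    {w w₁ w₂ : ι → ℂ} (h₁ : w₁ =O[l] ε) (h₂ : w₂ =O[l] fun i => ε i ^ 2)
    (h : (fun i => w i - w₁ i - w₂ i) =O[l] fun i => ε i ^ 3) :
    (fun i => Complex.log (1 + w i) - (w₁ i + (w₂ i - w₁ i ^ 2 / 2))) =O[l]
      fun i => ε i ^ 3 := by
  have hb : ∀ k, (fun i => ε i ^ (k + 1)) =O[l] fun i => ε i ^ k := fun k => by
    have := (isBigO_refl (fun i => ε i ^ k) l).mul (hε.isBigO_one ℝ)
    simpa [pow_succ] using this
  have hw₂ : (fun i => w i - w₁ i) =O[l] fun i => ε i ^ 2 := by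
    have := (h.trans (hb 2)).add h₂
    refine this.congr_left fun i => by ring
  have hw : w =O[l] ε := by
    have h3 : (fun i => ε i ^ 2) =O[l] ε := by simpa using hb 1
    refine ((hw₂.trans h3).add h₁).congr_left fun i => by ring
  have hw0 : Tendsto w l (𝓝 0) := hw.trans_tendsto hε
  have e1 : (fun i => Complex.log (1 + w i) - (w i - w i ^ 2 / 2)) =O[l] fun i => ε i ^ 3 :=
    (log_one_add_sub_isBigO.comp_tendsto hw0).trans (hw.pow 3)
  have e2 : (fun i => (w i - w₁ i) * (w i + w₁ i)) =O[l] fun i => ε i ^ 3 := by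
    have := hw₂.mul (hw.add h₁)
    refine this.congr_right fun i => by ring
  have e3 := (e1.add h).sub (e2.const_mul_left (1 / 2))
  refine e3.congr_left fun i => by ring

/-- `arg` near a point of the slit plane. -/
theorem arg_expansion {ι : Type*} {l : Filter ι} {ε : ι → ℝ} (hε : Tendsto ε l (𝓝 0))
    {ζ w₁ w₂ : ι → ℂ} {ζ₀ : ℂ} (hζ₀ : ζ₀ ∈ Complex.slitPlane)
    (h₁ : w₁ =O[l] ε) (h₂ : w₂ =O[l] fun i => ε i ^ 2)
    (h : (fun i => ζ i / ζ₀ - 1 - w₁ i - w₂ i) =O[l] fun i => ε i ^ 3) :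
    (fun i => (ζ i).arg - ζ₀.arg - ((w₁ i).im + (w₂ i - w₁ i ^ 2 / 2).im)) =O[l]
      fun i => ε i ^ 3 := by
  have hz : ζ₀ ≠ 0 := Complex.slitPlane_ne_zero hζ₀
  have hlog := log_one_add_expansion hε h₁ h₂ h
  have hp : ∀ k, Tendsto (fun i => ε i ^ (k + 1)) l (𝓝 0) := fun k => by
    simpa using hε.pow (k + 1)
  have hw0 : Tendsto (fun i => ζ i / ζ₀ - 1) l (𝓝 0) := by
    have := ((h.trans_tendsto (hp 2)).add (h₂.trans_tendsto (hp 1))).add (h₁.trans_tendsto hε)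
    simp only [add_zero] at this
    refine this.congr fun i => by ring
  have hr : Tendsto (fun i => ζ i / ζ₀) l (𝓝 1) := by
    simpa using hw0.add_const 1
  have harg : Tendsto (fun i => ζ₀.arg + (ζ i / ζ₀).arg) l (𝓝 ζ₀.arg) := by
    have := (Complex.continuousAt_arg Complex.one_mem_slitPlane).tendsto.comp hr
    simpa using this.const_add ζ₀.arg
  -- The argument is additive only without wrap-around; as `ζ₀` lies off the branch cut, there is
  -- room for a small perturbation.
  have hmem : ∀ᶠ i in l, ζ₀.arg + (ζ i / ζ₀).arg ∈ Set.Ioo (-π) π :=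
    harg.eventually (isOpen_Ioo.mem_nhds
      ⟨Complex.neg_pi_lt_arg _, (Complex.mem_slitPlane_iff_arg.1 hζ₀).1.lt_of_le
        (Complex.arg_le_pi _)⟩)
  have hne : ∀ᶠ i in l, ζ i / ζ₀ ≠ 0 := hr.eventually_ne one_ne_zero
  refine IsBigO.trans ?_ (hlog.congr_left (fun i => rfl))
  refine IsBigO.of_bound 1 ?_
  filter_upwards [hmem, hne] with i hi hi0
  have h1 : (ζ i).arg - ζ₀.arg = (Complex.log (1 + (ζ i / ζ₀ - 1))).im := by
    rw [add_sub_cancel, Complex.log_im]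
    conv_lhs => rw [show ζ i = ζ₀ * (ζ i / ζ₀) by field_simp]
    rw [Complex.arg_mul hz hi0 (Set.Ioo_subset_Ioc_self hi)]
    ring
  rw [h1, ← Complex.add_im, ← Complex.sub_im, one_mul, Real.norm_eq_abs]
  exact Complex.abs_im_le_norm _

/-! ### Second-order expansion at a top eigenvector -/

section Expansion

variable {H : Type*} [NormedAddCommGroup H] [InnerProductSpace ℂ H] {ι : Type*} {l : Filter ι}

theorem isBigO_inner_apply (T : H →L[ℂ] H) {x y : ι → H} {f g : ι → ℝ}
    (hx : x =O[l] f) (hy : y =O[l] g) :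
    (fun i => inner ℂ (x i) (T (y i))) =O[l] fun i => f i * g i := by
  have h1 : (fun i => inner ℂ (x i) (T (y i))) =O[l] fun i => ‖x i‖ * ‖y i‖ := by
    refine IsBigO.of_bound ‖T‖ (Eventually.of_forall fun i => ?_)
    rw [norm_mul, norm_norm, norm_norm]
    calc _ ≤ ‖x i‖ * (‖T‖ * ‖y i‖) := (norm_inner_le_norm _ _).trans (by
          gcongr; exact T.le_opNorm _)
      _ = _ := by ring
  exact h1.trans (hx.norm_left.mul hy.norm_left)

theorem isBigO_of_norm_le_of_nonneg {E : Type*} [SeminormedAddCommGroup E] {x : ι → E}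
    {f : ι → ℝ} (hf : ∀ i, 0 ≤ f i) {k : ℝ} (h : ∀ i, ‖x i‖ ≤ k * f i) : x =O[l] f :=
  IsBigO.of_bound k (Eventually.of_forall fun i => by
    rw [Real.norm_eq_abs, abs_of_nonneg (hf i)]; exact h i)

/-- Orders of the first and second variation of a quadratic form. -/
theorem isBigO_variations (T : H →L[ℂ] H) {ε : ι → ℝ} {a b c : ι → H} {ζ₀ : ℂ}
    (Oa : a =O[l] fun _ => (1 : ℝ)) (Ob : b =O[l] ε) (Oc : c =O[l] fun i => ε i ^ 2)
    {w₁ w₂ : ι → ℂ}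
    (hw₁ : ∀ i, w₁ i = (inner ℂ (a i) (T (b i)) + inner ℂ (b i) (T (a i))) / ζ₀)
    (hw₂ : ∀ i, w₂ i = (inner ℂ (a i) (T (c i)) + inner ℂ (c i) (T (a i)) +
      inner ℂ (b i) (T (b i))) / ζ₀) :
    w₁ =O[l] ε ∧ w₂ =O[l] fun i => ε i ^ 2 := by
  constructor
  · have := ((isBigO_inner_apply T Oa Ob).congr_right fun i => one_mul _).add
      ((isBigO_inner_apply T Ob Oa).congr_right fun i => mul_one _)
    refine (this.const_mul_left ζ₀⁻¹).congr_left fun i => ?_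
    rw [hw₁]; ring
  · have := (((isBigO_inner_apply T Oa Oc).congr_right fun i => one_mul _).add
      ((isBigO_inner_apply T Oc Oa).congr_right fun i => mul_one _)).add
      ((isBigO_inner_apply T Ob Ob).congr_right fun i => (sq _).symm)
    refine (this.const_mul_left ζ₀⁻¹).congr_left fun i => ?_
    rw [hw₂]; ring

/-- The arguments of the values of a quadratic form at top eigenvectors of slightly perturbed rank
one operators, to second order. -/
theorem arg_inner_topEigenvector_isBigO {ε : ι → ℝ} (hε0 : ∀ i, 0 ≤ ε i)
    (hε : Tendsto ε l (𝓝 0)) {A : ℝ} (hA : 1 ≤ A) {a b c u : ι → H} {C : ι → H →ₗ[ℂ] H}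
    {lam : ι → ℝ} (ha : ∀ i, ‖a i‖ = A) (hb : ∀ i, ‖b i‖ ≤ ε i)
    (hC : ∀ i x, ‖C i x‖ ≤ 2 * ε i ^ 2 * ‖x‖)
    (hc : ∀ i, c i = ((A ^ 2 : ℝ) : ℂ)⁻¹ • C i (a i)) (hu : ∀ i, ‖u i‖ = 1)
    (heig : ∀ i, (lam i : ℂ) • u i = inner ℂ (a i + b i) (u i) • (a i + b i) + C i (u i))
    (hray : ∀ i x, (inner ℂ x (inner ℂ (a i + b i) x • (a i + b i) + C i x)).re ≤
      lam i * ‖x‖ ^ 2)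
    (T : H →L[ℂ] H) {ζ₀ : ℂ} (hζ₀ : ζ₀ ∈ Complex.slitPlane)
    (hζ : ∀ i, inner ℂ (a i) (T (a i)) = ζ₀) {w₁ w₂ : ι → ℂ}
    (hw₁ : ∀ i, w₁ i = (inner ℂ (a i) (T (b i)) + inner ℂ (b i) (T (a i))) / ζ₀)
    (hw₂ : ∀ i, w₂ i = (inner ℂ (a i) (T (c i)) + inner ℂ (c i) (T (a i)) +
      inner ℂ (b i) (T (b i))) / ζ₀) :
    (fun i => (inner ℂ (u i) (T (u i))).arg - ζ₀.arg -
      ((w₁ i).im + (w₂ i - w₁ i ^ 2 / 2).im)) =O[l] fun i => ε i ^ 3 := by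
  have hz : ζ₀ ≠ 0 := Complex.slitPlane_ne_zero hζ₀
  -- The scalar must be defined at every index; where `ε i > 1 / 8` it is a dummy value that the
  -- filter does not see.
  have key : ∀ i, ∃ k : ℂ, ε i ≤ 1 / 8 →
      k ≠ 0 ∧ ‖k • u i - (a i + b i + c i)‖ ≤ 24 * ε i ^ 3 := by
    intro i
    by_cases h : ε i ≤ 1 / 8
    · obtain ⟨k, hk, hk'⟩ := exists_smul_topEigenvector_near (by rw [ha]; exact hA) (hε0 i) h
        (hb i) (hC i) (hu i) (heig i) (hray i)
      exact ⟨k, fun _ => ⟨hk, by rw [hc i, ← ha i]; exact hk'⟩⟩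
    · exact ⟨0, fun h' => absurd h' h⟩
  choose k hk using key
  have hsmall : ∀ᶠ i in l, ε i ≤ 1 / 8 :=
    (hε.eventually (gt_mem_nhds (show (0 : ℝ) < 1 / 8 by norm_num))).mono fun _ h => h.le
  set v : ι → H := fun i => k i • u i with hv
  set ρ : ι → H := fun i => v i - (a i + b i + c i) with hρ
  have Oa : a =O[l] fun _ => (1 : ℝ) :=
    IsBigO.of_bound A (Eventually.of_forall fun i => by simp [ha])
  have Ob : b =O[l] ε := isBigO_of_norm_le_of_nonneg hε0 (k := 1) (by simpa using hb)
  have Oc : c =O[l] fun i => ε i ^ 2 := by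
    refine isBigO_of_norm_le_of_nonneg (fun i => sq_nonneg (ε i)) (k := (A ^ 2)⁻¹ * (2 * A))
      fun i => ?_
    rw [hc, norm_smul, norm_inv, Complex.norm_real, Real.norm_eq_abs, abs_of_nonneg (sq_nonneg A),
      mul_assoc]
    gcongr
    refine (hC i (a i)).trans_eq ?_
    rw [ha]; ring
  have Oρ : ρ =O[l] fun i => ε i ^ 3 := by
    refine IsBigO.of_bound 24 (hsmall.mono fun i hi => ?_)
    rw [Real.norm_eq_abs, abs_of_nonneg (pow_nonneg (hε0 i) 3)]
    exact (hk i hi).2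
  have O1 : ε =O[l] fun _ => (1 : ℝ) := hε.isBigO_one ℝ
  have O2 : (fun i => ε i ^ 2) =O[l] fun _ => (1 : ℝ) := by simpa using O1.pow 2
  have O3 : (fun i => ε i ^ 3) =O[l] fun _ => (1 : ℝ) := by simpa using O1.pow 3
  have O4 : (fun i => ε i ^ 4) =O[l] fun i => ε i ^ 3 := by
    refine ((isBigO_refl (fun i => ε i ^ 3) l).mul O1).congr (fun i => ?_) fun i => mul_one _
    ring
  have Os : (fun i => a i + b i + c i) =O[l] fun _ => (1 : ℝ) :=
    (Oa.add (Ob.trans O1)).add (Oc.trans O2)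
  have Ov : v =O[l] fun _ => (1 : ℝ) :=
    ((Oρ.trans O3).add Os).congr_left fun i => by simp [hρ]
  have e1 : (fun i => inner ℂ (v i) (T (ρ i))) =O[l] fun i => ε i ^ 3 := by
    simpa using isBigO_inner_apply T Ov Oρ
  have e2 : (fun i => inner ℂ (ρ i) (T (a i + b i + c i))) =O[l] fun i => ε i ^ 3 := by
    simpa only [mul_one] using isBigO_inner_apply T Oρ Os
  have e3 : (fun i => inner ℂ (b i) (T (c i))) =O[l] fun i => ε i ^ 3 :=
    (isBigO_inner_apply T Ob Oc).congr_right fun i => by ring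
  have e4 : (fun i => inner ℂ (c i) (T (b i))) =O[l] fun i => ε i ^ 3 :=
    (isBigO_inner_apply T Oc Ob).congr_right fun i => by ring
  have e5 : (fun i => inner ℂ (c i) (T (c i))) =O[l] fun i => ε i ^ 3 :=
    ((isBigO_inner_apply T Oc Oc).congr_right fun i => by ring).trans O4
  obtain ⟨h₁, h₂⟩ := isBigO_variations T Oa Ob Oc hw₁ hw₂
  have h : (fun i => inner ℂ (v i) (T (v i)) / ζ₀ - 1 - w₁ i - w₂ i) =O[l]
      fun i => ε i ^ 3 := by
    refine (((((e1.add e2).add e3).add e4).add e5).const_mul_left ζ₀⁻¹).congr_left fun i => ?_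
    have hvi : v i = ρ i + (a i + b i + c i) := by simp [hρ]
    have h1 : inner ℂ (v i) (T (v i)) = inner ℂ (v i) (T (ρ i)) +
        inner ℂ (ρ i) (T (a i + b i + c i)) + inner ℂ (a i + b i + c i) (T (a i + b i + c i)) := by
      conv_lhs => rw [show T (v i) = T (ρ i) + T (a i + b i + c i) by rw [← map_add, ← hvi]]
      rw [inner_add_right, add_assoc (inner ℂ (v i) (T (ρ i))), ← inner_add_left, ← hvi]
    have h2 : inner ℂ (a i + b i + c i) (T (a i + b i + c i)) =
        ζ₀ + (inner ℂ (a i) (T (b i)) + inner ℂ (b i) (T (a i))) +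
        (inner ℂ (a i) (T (c i)) + inner ℂ (c i) (T (a i)) + inner ℂ (b i) (T (b i))) +
        inner ℂ (b i) (T (c i)) + inner ℂ (c i) (T (b i)) + inner ℂ (c i) (T (c i)) := by
      rw [← hζ i]
      simp only [map_add, inner_add_left, inner_add_right]
      ring
    rw [h1, h2, hw₁, hw₂]
    field_simp
    ring
  -- Scaling `u i` by `k i` multiplies the form by the positive number `‖k i‖ ^ 2`, so `u i` and `v
  -- i` give the same argument.
  refine (arg_expansion hε hζ₀ h₁ h₂ h).congr' ?_ EventuallyEq.rfl
  filter_upwards [hsmall] with i hi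
  have : inner ℂ (v i) (T (v i)) = ((‖k i‖ ^ 2 : ℝ) : ℂ) * inner ℂ (u i) (T (u i)) := by
    simp only [hv, map_smul, inner_smul_left, inner_smul_right]
    rw [← mul_assoc, Complex.mul_conj, Complex.normSq_eq_norm_sq]
  rw [this, Complex.arg_real_mul _ (by have := norm_pos_iff.2 (hk i hi).1; positivity)]

end Expansion

/-! ### Rank one data matrices in noise -/

section Matrices

variable {n k : Type*} [Fintype n] [Fintype k]

/-- The sesquilinear form of a matrix. -/
def sesq (T : Matrix n n ℂ) (x y : n → ℂ) : ℂ := star x ⬝ᵥ (T *ᵥ y)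

/-- The energy `‖s‖²` of a vector. -/
noncomputable def energy (s : k → ℂ) : ℝ := ∑ t, ‖s t‖ ^ 2

/-- The noise seen by the matched filter of the symbols. -/
noncomputable def matchedNoise (s : k → ℂ) (E : Matrix n k ℂ) : n → ℂ :=
  ((energy s : ℝ) : ℂ)⁻¹ • (E *ᵥ star s)

/-- The normalized Gram matrix of the noise orthogonal to the symbols. -/
noncomputable def residualGram (s : k → ℂ) (E : Matrix n k ℂ) : Matrix n n ℂ :=
  ((energy s : ℝ) : ℂ)⁻¹ • (E * Eᴴ) -
    Matrix.vecMulVec (matchedNoise s E) (star (matchedNoise s E))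

/-- The second-order perturbation of the dominant singular vector. -/
noncomputable def residualShift (s : k → ℂ) (a : n → ℂ) (E : Matrix n k ℂ) : n → ℂ :=
  ((energy a : ℝ) : ℂ)⁻¹ • (residualGram s E *ᵥ a)

/-- Relative first variation of the quadratic form of `T` at `a`. -/
noncomputable def relFirst (T : Matrix n n ℂ) (s : k → ℂ) (a : n → ℂ) (E : Matrix n k ℂ) : ℂ :=
  (sesq T a (matchedNoise s E) + sesq T (matchedNoise s E) a) / sesq T a a

/-- Relative second variation of the quadratic form of `T` at `a`. -/
noncomputable def relSecond (T : Matrix n n ℂ) (s : k → ℂ) (a : n → ℂ) (E : Matrix n k ℂ) : ℂ :=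
  (sesq T a (residualShift s a E) + sesq T (residualShift s a E) a +
    sesq T (matchedNoise s E) (matchedNoise s E)) / sesq T a a

/-- The second-order term of the argument of the quadratic form of `T`. -/
noncomputable def argSecond (T : Matrix n n ℂ) (s : k → ℂ) (a : n → ℂ) (E : Matrix n k ℂ) : ℝ :=
  (relSecond T s a E - relFirst T s a E ^ 2 / 2).im

omit [Fintype n] in
theorem matchedNoise_neg (s : k → ℂ) (E : Matrix n k ℂ) :
    matchedNoise s (-E) = -matchedNoise s E := by
  simp [matchedNoise, Matrix.neg_mulVec]

/-- The matched noise is odd and the residual shift even in the noise. This parity is what makes the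
product with the linear term average to zero for circular noise. -/
theorem argSecond_neg (T : Matrix n n ℂ) (s : k → ℂ) (a : n → ℂ) (E : Matrix n k ℂ) :
    argSecond T s a (-E) = argSecond T s a E := by
  have h1 : residualShift s a (-E) = residualShift s a E := by
    simp [residualShift, residualGram, matchedNoise_neg, Matrix.conjTranspose_neg,
      Matrix.vecMulVec_neg, Matrix.neg_vecMulVec]
  have h2 : relFirst T s a (-E) = -relFirst T s a E := by
    simp only [relFirst, sesq, matchedNoise_neg, Matrix.mulVec_neg, dotProduct_neg, star_neg,
      neg_dotProduct]
    ring
  have h3 : relSecond T s a (-E) = relSecond T s a E := by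
    simp only [relSecond, sesq, matchedNoise_neg, Matrix.mulVec_neg, dotProduct_neg, star_neg,
      neg_dotProduct, h1, neg_neg]
  simp [argSecond, h2, h3]

/-- Needed for the measurability of the second-order term at random noise. -/
theorem continuous_argSecond (T : Matrix n n ℂ) (s : k → ℂ) (a : n → ℂ) :
    Continuous fun E : Matrix n k ℂ => argSecond T s a E := by
  have hb : Continuous fun E : Matrix n k ℂ => matchedNoise s E := by
    unfold matchedNoise; fun_prop
  have hc : Continuous fun E : Matrix n k ℂ => residualShift s a E := by
    unfold residualShift residualGram
    have hv := Continuous.matrix_vecMulVec hb hb.star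
    have hg : Continuous fun E : Matrix n k ℂ => ((energy s : ℝ) : ℂ)⁻¹ • (E * Eᴴ) := by
      fun_prop
    exact ((hg.sub hv).matrix_mulVec (continuous_const (y := a))).const_smul
      ((energy a : ℝ) : ℂ)⁻¹
  unfold argSecond relSecond relFirst sesq
  refine Complex.continuous_im.comp (Continuous.sub (Continuous.div_const ?_ _)
    (Continuous.div_const (Continuous.pow (Continuous.div_const ?_ _) 2) _)) <;> fun_prop

theorem star_dotProduct_self (x : n → ℂ) : star x ⬝ᵥ x = ((energy x : ℝ) : ℂ) := by
  simp [dotProduct, energy, ← Complex.normSq_eq_conj_mul_self, Complex.normSq_eq_norm_sq]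

theorem inner_toLp (x y : n → ℂ) :
    inner ℂ (WithLp.toLp 2 x : EuclideanSpace ℂ n) (WithLp.toLp 2 y) = star x ⬝ᵥ y := by
  rw [EuclideanSpace.inner_toLp_toLp, dotProduct_comm]

theorem norm_toLp_sq (x : n → ℂ) : ‖(WithLp.toLp 2 x : EuclideanSpace ℂ n)‖ ^ 2 = energy x := by
  rw [EuclideanSpace.norm_sq_eq]; rfl

theorem energy_nonneg (x : n → ℂ) : 0 ≤ energy x := by unfold energy; positivity

theorem energy_mulVec_le (E : Matrix n k ℂ) (x : k → ℂ) :
    energy (E *ᵥ x) ≤ (∑ i, ∑ t, ‖E i t‖ ^ 2) * energy x := by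
  unfold energy
  rw [Finset.sum_mul]
  refine Finset.sum_le_sum fun i _ => ?_
  have h1 : ‖(E *ᵥ x) i‖ ≤ ∑ t, ‖E i t‖ * ‖x t‖ := by
    refine (norm_sum_le _ _).trans_eq (Finset.sum_congr rfl fun t _ => norm_mul _ _)
  calc ‖(E *ᵥ x) i‖ ^ 2 ≤ (∑ t, ‖E i t‖ * ‖x t‖) ^ 2 := by gcongr
    _ ≤ _ := Finset.sum_mul_sq_le_sq_mul_sq _ _ _

theorem energy_star (x : n → ℂ) : energy (star x) = energy x := by simp [energy]

-- Completing the square: with `b` the matched noise, the cross terms are `‖s‖²` times `b aᴴ` and `a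
-- bᴴ`, so `(a + b)(a + b)ᴴ` absorbs everything linear in the noise.
omit [Fintype n] in
theorem gram_vecMulVec_add (a : n → ℂ) {s : k → ℂ} (hs : energy s ≠ 0) (E : Matrix n k ℂ) :
    ((energy s : ℝ) : ℂ)⁻¹ • ((Matrix.vecMulVec a s + E) * (Matrix.vecMulVec a s + E)ᴴ) =
      Matrix.vecMulVec (a + matchedNoise s E) (star (a + matchedNoise s E)) +
        residualGram s E := by
  have hs' : ((energy s : ℝ) : ℂ) ≠ 0 := by exact_mod_cast hs
  have h1 : Matrix.vecMulVec a s * (Matrix.vecMulVec a s)ᴴ =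
      ((energy s : ℝ) : ℂ) • Matrix.vecMulVec a (star a) := by
    rw [Matrix.conjTranspose_vecMulVec, Matrix.vecMulVec_mul_vecMulVec, dotProduct_comm,
      star_dotProduct_self]
    ext; simp [Matrix.vecMulVec, mul_left_comm]
  have h2 : E * (Matrix.vecMulVec a s)ᴴ =
      ((energy s : ℝ) : ℂ) • Matrix.vecMulVec (matchedNoise s E) (star a) := by
    rw [Matrix.conjTranspose_vecMulVec, Matrix.mul_vecMulVec, matchedNoise,
      Matrix.smul_vecMulVec, smul_smul, mul_inv_cancel₀ hs', one_smul]
  have h3 : Matrix.vecMulVec a s * Eᴴ =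
      ((energy s : ℝ) : ℂ) • Matrix.vecMulVec a (star (matchedNoise s E)) := by
    have := congrArg Matrix.conjTranspose h2
    simpa [Matrix.conjTranspose_vecMulVec, Matrix.conjTranspose_mul] using this
  rw [Matrix.conjTranspose_add, Matrix.add_mul, Matrix.mul_add, Matrix.mul_add, h1, h2, h3,
    residualGram, star_add, Matrix.add_vecMulVec, Matrix.vecMulVec_add, Matrix.vecMulVec_add]
  simp only [smul_add, smul_smul, inv_mul_cancel₀ hs', one_smul]
  abel

theorem norm_matchedNoise_le {s : k → ℂ} (hs : 0 < energy s) {E : Matrix n k ℂ} {ε : ℝ}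
    (hε : 0 ≤ ε) (hE : ∑ i, ∑ t, ‖E i t‖ ^ 2 ≤ ε ^ 2 * energy s) :
    ‖(WithLp.toLp 2 (matchedNoise s E) : EuclideanSpace ℂ n)‖ ≤ ε := by
  rw [← sq_le_sq₀ (norm_nonneg _) hε, matchedNoise, WithLp.toLp_smul, norm_smul, mul_pow,
    norm_toLp_sq, norm_inv, Complex.norm_real, Real.norm_eq_abs, abs_of_pos hs]
  have h1 := energy_mulVec_le E (star s)
  rw [energy_star] at h1
  calc (energy s)⁻¹ ^ 2 * energy (E *ᵥ star s) ≤
      (energy s)⁻¹ ^ 2 * (ε ^ 2 * energy s * energy s) := by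
        gcongr; exact h1.trans (by gcongr)
    _ = ε ^ 2 := by field_simp

/-- Each of the two summands of the residual contributes `ε ^ 2`; the cancellation between them is
not exploited. -/
theorem norm_residualGram_mulVec_le {s : k → ℂ} (hs : 0 < energy s) {E : Matrix n k ℂ} {ε : ℝ}
    (hε : 0 ≤ ε) (hE : ∑ i, ∑ t, ‖E i t‖ ^ 2 ≤ ε ^ 2 * energy s) (x : n → ℂ) :
    ‖(WithLp.toLp 2 (residualGram s E *ᵥ x) : EuclideanSpace ℂ n)‖ ≤
      2 * ε ^ 2 * ‖(WithLp.toLp 2 x : EuclideanSpace ℂ n)‖ := by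
  have hb := norm_matchedNoise_le hs hε hE
  set b := matchedNoise s E with hbdef
  have h1 : residualGram s E *ᵥ x =
      ((energy s : ℝ) : ℂ)⁻¹ • (E *ᵥ (Eᴴ *ᵥ x)) - (star b ⬝ᵥ x) • b := by
    rw [residualGram, Matrix.sub_mulVec, Matrix.smul_mulVec, Matrix.mulVec_mulVec,
      Matrix.vecMulVec_mulVec]
    simp [hbdef]
  have h2 : ‖(WithLp.toLp 2 (E *ᵥ (Eᴴ *ᵥ x)) : EuclideanSpace ℂ n)‖ ≤
      ε ^ 2 * energy s * ‖(WithLp.toLp 2 x : EuclideanSpace ℂ n)‖ := by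
    rw [← sq_le_sq₀ (norm_nonneg _) (by positivity), mul_pow, norm_toLp_sq, norm_toLp_sq]
    have h3 := energy_mulVec_le Eᴴ x
    have h4 : ∑ i, ∑ t, ‖Eᴴ i t‖ ^ 2 = ∑ i, ∑ t, ‖E i t‖ ^ 2 := by
      rw [Finset.sum_comm]; simp
    rw [h4] at h3
    have h0 := energy_nonneg x
    have hF : 0 ≤ ∑ i, ∑ t, ‖E i t‖ ^ 2 := by positivity
    calc _ ≤ _ := energy_mulVec_le E (Eᴴ *ᵥ x)
      _ ≤ (∑ i, ∑ t, ‖E i t‖ ^ 2) * ((∑ i, ∑ t, ‖E i t‖ ^ 2) * energy x) := by gcongr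
      _ ≤ (ε ^ 2 * energy s) * ((ε ^ 2 * energy s) * energy x) := by gcongr
      _ = _ := by ring
  rw [h1, WithLp.toLp_sub, WithLp.toLp_smul, WithLp.toLp_smul]
  refine (norm_sub_le _ _).trans ?_
  rw [norm_smul, norm_smul, norm_inv, Complex.norm_real, Real.norm_eq_abs, abs_of_pos hs,
    ← inner_toLp]
  have h5 : ‖inner ℂ (WithLp.toLp 2 b : EuclideanSpace ℂ n) (WithLp.toLp 2 x)‖ ≤
      ε * ‖(WithLp.toLp 2 x : EuclideanSpace ℂ n)‖ := (norm_inner_le_norm _ _).trans (by gcongr)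
  calc _ ≤ (energy s)⁻¹ * (ε ^ 2 * energy s * ‖(WithLp.toLp 2 x : EuclideanSpace ℂ n)‖) +
        ε * ‖(WithLp.toLp 2 x : EuclideanSpace ℂ n)‖ * ε := by gcongr
    _ = _ := by field_simp; ring

/-- A unit eigenvector of `G` whose eigenvalue bounds the Rayleigh quotients of `G`. -/
def IsTopEigenvector (G : Matrix n n ℂ) (u : n → ℂ) : Prop :=
  star u ⬝ᵥ u = 1 ∧ ∃ lam : ℝ, G *ᵥ u = (lam : ℂ) • u ∧
    ∀ x, (star x ⬝ᵥ (G *ᵥ x)).re ≤ lam * energy x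

theorem IsTopEigenvector.smul {G : Matrix n n ℂ} {u : n → ℂ} (h : IsTopEigenvector G u) {c : ℝ}
    (hc : 0 ≤ c) : IsTopEigenvector ((c : ℂ) • G) u := by
  obtain ⟨h1, lam, h2, h3⟩ := h
  refine ⟨h1, c * lam, ?_, fun x => ?_⟩
  · rw [Matrix.smul_mulVec, h2, smul_smul, Complex.ofReal_mul]
  · rw [Matrix.smul_mulVec, dotProduct_smul, smul_eq_mul, Complex.re_ofReal_mul, mul_assoc]
    exact mul_le_mul_of_nonneg_left (h3 x) hc

variable [DecidableEq n]

theorem inner_toEuclideanCLM (T : Matrix n n ℂ) (x y : n → ℂ) :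
    inner ℂ (WithLp.toLp 2 x : EuclideanSpace ℂ n)
      (Matrix.toEuclideanCLM (𝕜 := ℂ) T (WithLp.toLp 2 y)) = sesq T x y := by
  rw [Matrix.toEuclideanCLM_toLp, inner_toLp, sesq]

section Family

variable {ι : Type*} {l : Filter ι} {ε : ι → ℝ} {A : ℝ} {a : ι → n → ℂ} {s : ι → k → ℂ}
  {E : ι → Matrix n k ℂ}

/-- Dividing the Gram matrix by the energy of the symbols keeps its top eigenvectors and brings it
into the form `(a + b)(a + b)ᴴ + C` of the abstract expansion. -/
theorem arg_sesq_topEigenvector_isBigO (hε0 : ∀ i, 0 ≤ ε i) (hε : Tendsto ε l (𝓝 0))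
    (hA : 1 ≤ A) (ha : ∀ i, energy (a i) = A ^ 2) (hs : ∀ i, 0 < energy (s i))
    (hE : ∀ i, ∑ j, ∑ t, ‖E i j t‖ ^ 2 ≤ ε i ^ 2 * energy (s i)) {u : ι → n → ℂ}
    (hu : ∀ i, IsTopEigenvector
      ((Matrix.vecMulVec (a i) (s i) + E i) * (Matrix.vecMulVec (a i) (s i) + E i)ᴴ) (u i))
    (T : Matrix n n ℂ) {ζ₀ : ℂ} (hζ₀ : ζ₀ ∈ Complex.slitPlane)
    (hζ : ∀ i, sesq T (a i) (a i) = ζ₀) :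
    (fun i => (sesq T (u i) (u i)).arg - ζ₀.arg -
      ((relFirst T (s i) (a i) (E i)).im + argSecond T (s i) (a i) (E i))) =O[l]
        fun i => ε i ^ 3 := by
  have hu' : ∀ i, IsTopEigenvector (Matrix.vecMulVec (a i + matchedNoise (s i) (E i))
      (star (a i + matchedNoise (s i) (E i))) + residualGram (s i) (E i)) (u i) := by
    intro i
    rw [← gram_vecMulVec_add (a i) (hs i).ne' (E i), ← Complex.ofReal_inv]
    exact (hu i).smul (inv_nonneg.2 (hs i).le)
  have happ : ∀ i x, (Matrix.vecMulVec (a i + matchedNoise (s i) (E i))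
      (star (a i + matchedNoise (s i) (E i))) + residualGram (s i) (E i)) *ᵥ x =
      (star (a i + matchedNoise (s i) (E i)) ⬝ᵥ x) • (a i + matchedNoise (s i) (E i)) +
        residualGram (s i) (E i) *ᵥ x := by
    intro i x
    rw [Matrix.add_mulVec, Matrix.vecMulVec_mulVec, op_smul_eq_smul]
  choose lam hlam using fun i => (hu' i).2
  refine (arg_inner_topEigenvector_isBigO (H := EuclideanSpace ℂ n) hε0 hε hA
    (a := fun i => WithLp.toLp 2 (a i)) (b := fun i => WithLp.toLp 2 (matchedNoise (s i) (E i)))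
    (c := fun i => WithLp.toLp 2 (residualShift (s i) (a i) (E i)))
    (u := fun i => WithLp.toLp 2 (u i))
    (C := fun i => (Matrix.toEuclideanCLM (𝕜 := ℂ) (residualGram (s i) (E i)) :
      EuclideanSpace ℂ n →ₗ[ℂ] EuclideanSpace ℂ n)) (lam := lam)
    ?_ (fun i => norm_matchedNoise_le (hs i) (hε0 i) (hE i)) ?_ ?_ ?_ ?_ ?_
    (Matrix.toEuclideanCLM (𝕜 := ℂ) T) hζ₀ ?_
    (w₁ := fun i => relFirst T (s i) (a i) (E i))
    (w₂ := fun i => relSecond T (s i) (a i) (E i)) ?_ ?_).congr_left fun i => ?_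
  · intro i
    rw [← sq_eq_sq₀ (norm_nonneg _) (by linarith), norm_toLp_sq, ha]
  · intro i x
    exact norm_residualGram_mulVec_le (hs i) (hε0 i) (hE i) (WithLp.ofLp x)
  · intro i
    simp only [ContinuousLinearMap.coe_coe, Matrix.toEuclideanCLM_toLp, residualShift, ha,
      WithLp.toLp_smul]
  · intro i
    rw [← sq_eq_sq₀ (norm_nonneg _) zero_le_one, norm_toLp_sq, one_pow]
    have := (hu i).1
    rw [star_dotProduct_self] at this
    exact_mod_cast this
  · intro i
    have := (hlam i).1
    rw [happ] at this
    simp only [ContinuousLinearMap.coe_coe, Matrix.toEuclideanCLM_toLp, ← WithLp.toLp_add,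
      inner_toLp, ← WithLp.toLp_smul, this]
  · intro i x
    have := (hlam i).2 (WithLp.ofLp x)
    rw [happ, ← norm_toLp_sq] at this
    rw [← WithLp.toLp_ofLp 2 x]
    simpa only [ContinuousLinearMap.coe_coe, Matrix.toEuclideanCLM_toLp, ← WithLp.toLp_add,
      inner_toLp, ← WithLp.toLp_smul] using this
  · intro i
    rw [inner_toEuclideanCLM, hζ]
  · intro i
    simp only [inner_toEuclideanCLM, relFirst, hζ]
  · intro i
    simp only [inner_toEuclideanCLM, relSecond, hζ]
  · simp only [inner_toEuclideanCLM, argSecond]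

/-- The variations are homogeneous of degrees one and two in the noise, so these bounds need no
smallness and hold along any filter, in particular `⊤`. -/
theorem variations_isBigO (hε0 : ∀ i, 0 ≤ ε i)
    (hA : 1 ≤ A) (ha : ∀ i, energy (a i) = A ^ 2) (hs : ∀ i, 0 < energy (s i))
    (hE : ∀ i, ∑ j, ∑ t, ‖E i j t‖ ^ 2 ≤ ε i ^ 2 * energy (s i))
    (T : Matrix n n ℂ) {ζ₀ : ℂ} (hζ : ∀ i, sesq T (a i) (a i) = ζ₀) :
    (fun i => (relFirst T (s i) (a i) (E i)).im) =O[l] ε ∧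
      (fun i => argSecond T (s i) (a i) (E i)) =O[l] fun i => ε i ^ 2 := by
  have hnorm : ∀ i, ‖(WithLp.toLp 2 (a i) : EuclideanSpace ℂ n)‖ = A := fun i => by
    rw [← sq_eq_sq₀ (norm_nonneg _) (by linarith), norm_toLp_sq, ha]
  have hc : ∀ i, ‖(WithLp.toLp 2 (residualShift (s i) (a i) (E i)) : EuclideanSpace ℂ n)‖ ≤
      ((A ^ 2)⁻¹ * (2 * A)) * ε i ^ 2 := fun i => by
    rw [residualShift, ha, WithLp.toLp_smul, norm_smul, norm_inv, Complex.norm_real,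
      Real.norm_eq_abs, abs_of_nonneg (sq_nonneg A), mul_assoc]
    gcongr
    refine (norm_residualGram_mulVec_le (hs i) (hε0 i) (hE i) _).trans_eq ?_
    rw [hnorm]; ring
  obtain ⟨h1, h2⟩ := isBigO_variations (H := EuclideanSpace ℂ n) (l := l)
    (Matrix.toEuclideanCLM (𝕜 := ℂ) T) (ε := ε) (ζ₀ := ζ₀)
    (a := fun i => WithLp.toLp 2 (a i)) (b := fun i => WithLp.toLp 2 (matchedNoise (s i) (E i)))
    (c := fun i => WithLp.toLp 2 (residualShift (s i) (a i) (E i)))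
    (isBigO_of_norm_le_of_nonneg (k := A) (fun _ => zero_le_one) fun i => by simp [hnorm])
    (isBigO_of_norm_le_of_nonneg (k := 1) hε0
      fun i => by rw [one_mul]; exact norm_matchedNoise_le (hs i) (hε0 i) (hE i))
    (isBigO_of_norm_le_of_nonneg (fun i => sq_nonneg (ε i)) hc)
    (w₁ := fun i => relFirst T (s i) (a i) (E i))
    (w₂ := fun i => relSecond T (s i) (a i) (E i))
    (fun i => by simp only [inner_toEuclideanCLM, relFirst, hζ])
    (fun i => by simp only [inner_toEuclideanCLM, relSecond, hζ])
  have him : ∀ {f : ι → ℂ} {g : ι → ℝ}, f =O[l] g → (fun i => (f i).im) =O[l] g := fun h =>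
    (IsBigO.of_bound 1 (Eventually.of_forall fun i => by
      rw [one_mul, Real.norm_eq_abs]; exact Complex.abs_im_le_norm _)).trans h
  exact ⟨him h1, him (h2.sub (((h1.pow 2).const_mul_left (1 / 2)).congr_left
    fun i => by ring))⟩

end Family

end Matrices

/-! ### Dominant singular vectors -/

section Dominant

-- Dominance compares `σ` only with other singular values, and the spectral theorem for `σ² - X Xᴴ`
-- upgrades this to all vectors. A negative eigenvalue `ν` would give `X Xᴴ` the eigenvalue `σ² -
-- ν`, whose root exceeds `σ`.
open scoped ComplexOrder in
theorem IsDominantLeftSingularVector.exists_rayleigh_le {𝕜 : Type*} [RCLike 𝕜]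
    {n k : Type*} [Fintype n] [Fintype k]
    {X : Matrix n k 𝕜} {u : n → 𝕜} (h : IsDominantLeftSingularVector X u) :
    ∃ lam : ℝ, (X * Xᴴ) *ᵥ u = (lam : 𝕜) • u ∧
      ∀ x : n → 𝕜, RCLike.re (star x ⬝ᵥ ((X * Xᴴ) *ᵥ x)) ≤ lam * RCLike.re (star x ⬝ᵥ x) := by
  classical
  obtain ⟨-, σ, hσ, heig, hmax⟩ := h
  refine ⟨σ ^ 2, heig, fun x => ?_⟩
  have hherm : (((σ ^ 2 : ℝ) : 𝕜) • (1 : Matrix n n 𝕜) - X * Xᴴ).IsHermitian := by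
    refine Matrix.IsHermitian.sub ?_ (Matrix.isHermitian_mul_conjTranspose_self X)
    rw [Matrix.IsHermitian, Matrix.conjTranspose_smul, Matrix.conjTranspose_one]
    simp
  have hpsd : (((σ ^ 2 : ℝ) : 𝕜) • (1 : Matrix n n 𝕜) - X * Xᴴ).PosSemidef := by
    rw [hherm.posSemidef_iff_eigenvalues_nonneg]
    intro i
    by_contra hneg
    simp only [Pi.zero_apply, not_le] at hneg
    set ν := hherm.eigenvalues i with hν
    have h1 := hherm.mulVec_eigenvectorBasis i
    set w : n → 𝕜 := WithLp.ofLp (hherm.eigenvectorBasis i) with hw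
    have hw0 : w ≠ 0 := by
      intro h0
      have := hherm.eigenvectorBasis.orthonormal.ne_zero i
      exact this (by ext j; exact congrFun h0 j)
    have h2 : (X * Xᴴ) *ᵥ w = ((√(σ ^ 2 - ν) ^ 2 : ℝ) : 𝕜) • w := by
      rw [Real.sq_sqrt (by nlinarith [sq_nonneg σ])]
      rw [Matrix.sub_mulVec, Matrix.smul_mulVec, Matrix.one_mulVec] at h1
      rw [RCLike.ofReal_sub, sub_smul]
      rw [← hν, RCLike.real_smul_eq_coe_smul (K := 𝕜)] at h1
      rw [← h1]; abel
    have h3 := hmax _ w hw0 h2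
    have h4 : σ < √(σ ^ 2 - ν) := Real.lt_sqrt_of_sq_lt (by linarith)
    linarith
  have := hpsd.re_dotProduct_nonneg x
  rw [Matrix.sub_mulVec, Matrix.smul_mulVec, Matrix.one_mulVec, dotProduct_sub, dotProduct_smul,
    map_sub, smul_eq_mul, RCLike.re_ofReal_mul] at this
  linarith

variable {n k : Type*} [Fintype n] [Fintype k]

theorem IsDominantLeftSingularVector.isTopEigenvector {X : Matrix n k ℂ} {u : n → ℂ}
    (h : IsDominantLeftSingularVector X u) : IsTopEigenvector (X * Xᴴ) u := by
  obtain ⟨lam, h1, h2⟩ := h.exists_rayleigh_le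
  refine ⟨h.1, lam, h1, fun x => ?_⟩
  have := h2 x
  rw [star_dotProduct_self] at this
  simpa using this

/-- A real dominant singular vector yields a complex top eigenvector after a unitary change of
coordinates. -/
theorem IsDominantLeftSingularVector.isTopEigenvector_of_real [DecidableEq n] {X : Matrix n k ℝ}
    {e : n → ℝ} (h : IsDominantLeftSingularVector X e) {Q G : Matrix n n ℂ} (hQ : Qᴴ * Q = 1)
    {c : ℝ} (hc : 0 ≤ c)
    (hG : G = (c : ℂ) • (Q * (X * Xᵀ).map Complex.ofReal * Qᴴ)) :
    IsTopEigenvector G (Q *ᵥ fun i => (e i : ℂ)) := by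
  have hQ' : Q * Qᴴ = 1 := mul_eq_one_comm.1 hQ
  obtain ⟨lam, h1, h2⟩ := h.exists_rayleigh_le
  have hu := h.1
  simp only [Matrix.conjTranspose_eq_transpose_of_trivial, star_trivial, RCLike.re_to_real,
    RCLike.ofReal_real_eq_id, id] at h1 h2 hu
  rw [hG]
  have hmap : ∀ x : n → ℝ, (X * Xᵀ).map Complex.ofReal *ᵥ (fun i => (x i : ℂ)) =
      fun i => (((X * Xᵀ) *ᵥ x) i : ℂ) := fun x => by
    ext i; simp [Matrix.mulVec, dotProduct]
  have hiso : ∀ x y : n → ℂ, star (Q *ᵥ x) ⬝ᵥ (Q *ᵥ y) = star x ⬝ᵥ y := fun x y => by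
    rw [Matrix.star_mulVec, ← Matrix.dotProduct_mulVec, Matrix.mulVec_mulVec, hQ,
      Matrix.one_mulVec]
  refine IsTopEigenvector.smul ⟨?_, lam, ?_, fun x => ?_⟩ hc
  · rw [hiso]
    have : ((e ⬝ᵥ e : ℝ) : ℂ) = 1 := by rw [hu]; simp
    rw [← this]
    simp [dotProduct]
  · rw [Matrix.mulVec_mulVec, Matrix.mul_assoc, hQ, Matrix.mul_one, ← Matrix.mulVec_mulVec,
      hmap, h1, ← Matrix.mulVec_smul]
    congr 1
    ext i
    simp
  · set y := Qᴴ *ᵥ x with hy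
    have hx : x = Q *ᵥ y := by rw [hy, Matrix.mulVec_mulVec, hQ', Matrix.one_mulVec]
    have hen : energy x = energy y := by
      have := hiso y y
      rw [← hx, star_dotProduct_self, star_dotProduct_self] at this
      exact_mod_cast this
    have h3 : (Q * (X * Xᵀ).map Complex.ofReal * Qᴴ) *ᵥ x =
        Q *ᵥ ((X * Xᵀ).map Complex.ofReal *ᵥ y) := by
      rw [hy, Matrix.mulVec_mulVec, Matrix.mulVec_mulVec, Matrix.mul_assoc]
    rw [h3, hen]
    conv_lhs => rw [hx]
    rw [hiso]
    -- For a real symmetric matrix the cross terms drop out of the quadratic form, so the real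
    -- Rayleigh bound applies separately to the real and imaginary parts of `y`.
    have hsplit : y = (fun i => ((y i).re : ℂ)) + Complex.I • fun i => ((y i).im : ℂ) := by
      ext i; simp [mul_comm Complex.I, Complex.re_add_im]
    have hre : (star y ⬝ᵥ ((X * Xᵀ).map Complex.ofReal *ᵥ y)).re =
        ((fun i => (y i).re) ⬝ᵥ ((X * Xᵀ) *ᵥ fun i => (y i).re)) +
        ((fun i => (y i).im) ⬝ᵥ ((X * Xᵀ) *ᵥ fun i => (y i).im)) := by
      have h4 : (X * Xᵀ).map Complex.ofReal *ᵥ y =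
          (fun i => (((X * Xᵀ) *ᵥ fun i => (y i).re) i : ℂ)) +
          Complex.I • fun i => (((X * Xᵀ) *ᵥ fun i => (y i).im) i : ℂ) := by
        conv_lhs => rw [hsplit]
        rw [Matrix.mulVec_add, Matrix.mulVec_smul, hmap, hmap]
      rw [h4]
      simp only [dotProduct, Complex.re_sum, ← Finset.sum_add_distrib]
      refine Finset.sum_congr rfl fun i _ => ?_
      simp
    have hen2 : energy y = ((fun i => (y i).re) ⬝ᵥ fun i => (y i).re) +
        ((fun i => (y i).im) ⬝ᵥ fun i => (y i).im) := by
      simp only [energy, dotProduct, ← Finset.sum_add_distrib]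
      refine Finset.sum_congr rfl fun i _ => ?_
      rw [← Complex.normSq_eq_norm_sq, Complex.normSq_apply]
    rw [hre, hen2, mul_add]
    exact add_le_add (h2 _) (h2 _)

end Dominant

/-! ### Phase estimates as arguments of quadratic forms -/

section Forms

variable {n q : Type*} [Fintype n] [Fintype q]

/-- The form whose argument is the phase estimate of Standard ESPRIT. -/
def shiftForm (J₁ J₂ : Matrix q n ℂ) : Matrix n n ℂ := J₁ᴴ * J₂

/-- The form whose doubled argument is the phase estimate of Unitary ESPRIT. -/
noncomputable def averagedShiftForm (J₁ J₂ : Matrix q n ℂ) : Matrix n n ℂ :=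
  (1 / 2 : ℂ) • (J₁ᴴ * J₁ + J₂ᴴ * J₂) + J₁ᴴ * J₂

theorem sesq_conjTranspose_mul (A B : Matrix q n ℂ) (x y : n → ℂ) :
    sesq (Aᴴ * B) x y = star (A *ᵥ x) ⬝ᵥ (B *ᵥ y) := by
  rw [sesq, ← Matrix.mulVec_mulVec, Matrix.dotProduct_mulVec, Matrix.star_mulVec]

theorem sesq_shiftForm (J₁ J₂ : Matrix q n ℂ) (x y : n → ℂ) :
    sesq (shiftForm J₁ J₂) x y = star (J₁ *ᵥ x) ⬝ᵥ (J₂ *ᵥ y) :=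
  sesq_conjTranspose_mul _ _ _ _

theorem sesq_averagedShiftForm (J₁ J₂ : Matrix q n ℂ) (x y : n → ℂ) :
    sesq (averagedShiftForm J₁ J₂) x y =
      (star (J₁ *ᵥ x) ⬝ᵥ (J₁ *ᵥ y) + star (J₂ *ᵥ x) ⬝ᵥ (J₂ *ᵥ y)) / 2 +
        star (J₁ *ᵥ x) ⬝ᵥ (J₂ *ᵥ y) := by
  simp only [← sesq_conjTranspose_mul, averagedShiftForm]
  simp only [sesq, Matrix.add_mulVec, Matrix.smul_mulVec, dotProduct_add, dotProduct_smul,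
    smul_eq_mul]
  ring

/-- The doubled or single argument of `T` recovers the phase of the shift from `J₁ a` to `J₂ a`,
and its first variation is that of the energy difference of the two subarrays. -/
def IsPhaseForm (J₁ J₂ : Matrix q n ℂ) (κ : ℝ) (T : Matrix n n ℂ) : Prop :=
  ∀ θ ∈ Set.Ioo (-π) π, ∀ p : ℝ, 0 < p → ∃ ζ₀ ∈ Complex.slitPlane, κ * ζ₀.arg = θ ∧
    ∀ a : n → ℂ, J₂ *ᵥ a = Complex.exp (Complex.I * θ) • (J₁ *ᵥ a) → energy (J₁ *ᵥ a) = p →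
      sesq T a a = ζ₀ ∧ ∀ b : n → ℂ, κ * ((sesq T a b + sesq T b a) / ζ₀).im =
        (star (J₂ *ᵥ a) ⬝ᵥ (J₂ *ᵥ b) - star (J₁ *ᵥ a) ⬝ᵥ (J₁ *ᵥ b)).im / p

/-- Turns an equality of imaginary parts into an algebraic identity between numbers and their
conjugates. -/
theorem im_eq_of_sub_star_eq {x y : ℂ} (h : x - star x = y - star y) : x.im = y.im := by
  have := congrArg Complex.im h
  simp at this
  linarith

theorem arg_ofReal_mul_exp {r θ : ℝ} (hr : 0 < r) (hθ : θ ∈ Set.Ioo (-π) π) :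
    ((r : ℂ) * Complex.exp (Complex.I * θ)).arg = θ := by
  rw [mul_comm Complex.I, Complex.exp_mul_I]
  exact Complex.arg_mul_cos_add_sin_mul_I hr (Set.Ioo_subset_Ioc_self hθ)

theorem ofReal_mul_exp_mem_slitPlane {r θ : ℝ} (hr : 0 < r) (hθ : θ ∈ Set.Ioo (-π) π) :
    (r : ℂ) * Complex.exp (Complex.I * θ) ∈ Complex.slitPlane := by
  rw [Complex.mem_slitPlane_iff_arg, arg_ofReal_mul_exp hr hθ]
  exact ⟨hθ.2.ne, mul_ne_zero (by exact_mod_cast hr.ne') (Complex.exp_ne_zero _)⟩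

theorem star_exp_mul_exp (θ : ℝ) :
    star (Complex.exp (Complex.I * θ)) * Complex.exp (Complex.I * θ) = 1 := by
  rw [Complex.star_def, ← Complex.exp_conj, ← Complex.exp_add]
  simp

section Shifted

variable {J₁ J₂ : Matrix q n ℂ} {θ p : ℝ} {a : n → ℂ}
  (ha : J₂ *ᵥ a = Complex.exp (Complex.I * θ) • (J₁ *ᵥ a))

include ha

theorem energy_shifted : star (J₂ *ᵥ a) ⬝ᵥ (J₂ *ᵥ a) = star (J₁ *ᵥ a) ⬝ᵥ (J₁ *ᵥ a) := by
  rw [ha, star_smul, smul_dotProduct, dotProduct_smul, smul_smul, star_exp_mul_exp, one_smul]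

theorem star_shifted_dotProduct (y : q → ℂ) :
    star (J₁ *ᵥ a) ⬝ᵥ y = Complex.exp (Complex.I * θ) * (star (J₂ *ᵥ a) ⬝ᵥ y) := by
  rw [ha, star_smul, smul_dotProduct, smul_eq_mul, ← mul_assoc,
    mul_comm (Complex.exp (Complex.I * θ)), star_exp_mul_exp, one_mul]

theorem dotProduct_shifted (y : n → ℂ) :
    star (J₁ *ᵥ y) ⬝ᵥ (J₂ *ᵥ a) =
      Complex.exp (Complex.I * θ) * star (star (J₁ *ᵥ a) ⬝ᵥ (J₁ *ᵥ y)) := by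
  rw [ha, dotProduct_smul, smul_eq_mul, ← Matrix.star_dotProduct]

end Shifted

/-- With `J₂ a = γ J₁ a` the form at `a` is `p γ`, and both halves of the first variation carry the
factor `γ`. Dividing leaves `(y + x̄) / p`, where `x` and `y` are the inner products of `a` with `b`
over the first and second subarray; its imaginary part is that of `(y - x) / p`. -/
theorem isPhaseForm_shiftForm (J₁ J₂ : Matrix q n ℂ) :
    IsPhaseForm J₁ J₂ 1 (shiftForm J₁ J₂) := by
  intro θ hθ p hp
  refine ⟨_, ofReal_mul_exp_mem_slitPlane hp hθ, by rw [arg_ofReal_mul_exp hp hθ, one_mul],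
    fun a ha hpa => ⟨?_, fun b => ?_⟩⟩
  · rw [sesq_shiftForm, ha, dotProduct_smul, star_dotProduct_self, hpa, smul_eq_mul, mul_comm]
  · have hp' : (p : ℂ) ≠ 0 := by exact_mod_cast hp.ne'
    have hγ : Complex.exp (Complex.I * θ) ≠ 0 := Complex.exp_ne_zero _
    rw [sesq_shiftForm, sesq_shiftForm, star_shifted_dotProduct ha, dotProduct_shifted ha,
      one_mul, ← mul_add, mul_comm (p : ℂ), mul_div_mul_left _ _ hγ, Complex.div_ofReal_im]
    congr 1

/-- Here `ζ₀ = p (1 + γ) = 2 p cos(θ/2) exp(jθ/2)`, in the open right half plane because `|θ| < π`;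
`κ = 2` undoes the half angle. -/
theorem isPhaseForm_averagedShiftForm (J₁ J₂ : Matrix q n ℂ) :
    IsPhaseForm J₁ J₂ 2 (averagedShiftForm J₁ J₂) := by
  intro θ hθ p hp
  have hθ2 : θ / 2 ∈ Set.Ioo (-π) π := ⟨by linarith [hθ.1, hθ.2], by linarith [hθ.1, hθ.2]⟩
  have hcos : 0 < 2 * p * Real.cos (θ / 2) :=
    mul_pos (by linarith) (Real.cos_pos_of_mem_Ioo ⟨by linarith [hθ.1], by linarith [hθ.2]⟩)
  have hp' : (p : ℂ) ≠ 0 := by exact_mod_cast hp.ne'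
  set γ := Complex.exp (Complex.I * θ) with hγ
  have hsγ : star γ * γ = 1 := star_exp_mul_exp θ
  have hζ : ((2 * p * Real.cos (θ / 2) : ℝ) : ℂ) * Complex.exp (Complex.I * (θ / 2 : ℝ)) =
      p * (1 + γ) := by
    have h1 : γ = Complex.exp (Complex.I * (θ / 2 : ℝ)) * Complex.exp (Complex.I * (θ / 2 : ℝ)) := by
      rw [hγ, ← Complex.exp_add]; congr 1; push_cast; ring
    have h2 : Complex.exp (-((θ / 2 : ℝ) : ℂ) * Complex.I) *
        Complex.exp (Complex.I * (θ / 2 : ℝ)) = 1 := by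
      rw [← Complex.exp_add, ← Complex.exp_zero]; congr 1; ring
    have h3 : Complex.exp (((θ / 2 : ℝ) : ℂ) * Complex.I) =
        Complex.exp (Complex.I * (θ / 2 : ℝ)) := by rw [mul_comm]
    rw [Complex.ofReal_mul, Complex.ofReal_mul, Complex.ofReal_cos, Complex.cos, h3, h1,
      Complex.ofReal_ofNat]
    linear_combination (p : ℂ) * h2
  have hγ1 : 1 + γ ≠ 0 := by
    intro h0
    rw [h0, mul_zero] at hζ
    exact Complex.slitPlane_ne_zero (ofReal_mul_exp_mem_slitPlane hcos hθ2) hζ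
  refine ⟨_, ofReal_mul_exp_mem_slitPlane hcos hθ2,
    by rw [arg_ofReal_mul_exp hcos hθ2]; ring, fun a ha hpa => ⟨?_, fun b => ?_⟩⟩
  · rw [hζ, sesq_averagedShiftForm, energy_shifted ha]
    rw [ha, dotProduct_smul, star_dotProduct_self, hpa, smul_eq_mul]
    ring
  · rw [hζ, sesq_averagedShiftForm, sesq_averagedShiftForm, star_shifted_dotProduct ha (J₂ *ᵥ b),
      dotProduct_shifted ha b, Matrix.star_dotProduct (J₁ *ᵥ b) (J₁ *ᵥ a),
      Matrix.star_dotProduct (J₂ *ᵥ b) (J₂ *ᵥ a), mul_comm (p : ℂ), ← div_div,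
      Complex.div_ofReal_im, ← mul_div_assoc]
    congr 1
    generalize star (J₁ *ᵥ a) ⬝ᵥ (J₁ *ᵥ b) = x
    generalize star (J₂ *ᵥ a) ⬝ᵥ (J₂ *ᵥ b) = y
    rw [← hγ, ← Complex.im_ofReal_mul]
    apply im_eq_of_sub_star_eq
    have hsγ1 : 1 + star γ ≠ 0 := by
      have := star_ne_zero.2 hγ1
      simpa using this
    simp only [star_add, star_sub, star_star, star_mul', star_div₀, star_one, star_ofNat,
      Complex.ofReal_ofNat]
    field_simp
    -- Once the denominators are cleared, the two sides agree modulo `γ̄ γ = 1`.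
    linear_combination (y - x + star x - star y) * hsγ

/-! ### The estimators are arguments of quadratic forms -/

/-- The denominator is a positive real, which leaves the argument alone; if `x = 0`, both sides are
the argument of `0`. -/
theorem arg_leastSquares (x y : q → ℂ) : (leastSquares x y).arg = (star x ⬝ᵥ y).arg := by
  rw [leastSquares, star_dotProduct_self]
  rcases (energy_nonneg x).eq_or_lt with h | h
  · have hx : x = 0 := by
      have h1 : ∀ i ∈ Finset.univ, ‖x i‖ ^ 2 = 0 :=
        (Finset.sum_eq_zero_iff_of_nonneg fun i _ => by positivity).1 h.symm
      ext i
      simpa using h1 i (Finset.mem_univ _)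
    simp [hx]
  · rw [div_eq_mul_inv, ← Complex.ofReal_inv, Complex.arg_mul_real (inv_pos.2 h)]

theorem arctan_im_div_re {z : ℂ} (h : 0 < z.re ∨ z = 0) : Real.arctan (z.im / z.re) = z.arg := by
  have := Complex.abs_arg_lt_pi_div_two_iff.2 h
  rw [← Complex.tan_arg, Real.arctan_tan (abs_lt.1 this).1 (abs_lt.1 this).2]

variable [DecidableEq q]

/-- As conjugation turns `Q'ᴴ J₂ Q` into `Q'ᴴ J₁ Q`, its doubled real and imaginary parts are `Q'ᴴ
(J₁ + J₂) Q` and `j Q'ᴴ (J₁ - J₂) Q`. The isometry `Q'ᴴ` drops out of the inner products, and the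
quotient becomes `Im ζ / Re ζ` with `ζ` the averaged form at `u`. -/
theorem arctan_leastSquares {J₁ J₂ : Matrix q n ℂ} {Q : Matrix n n ℂ} {Q' : Matrix q q ℂ}
    (hQ' : Q'ᴴ * Q' = 1) (hconj : (Q'ᴴ * J₂ * Q).map star = Q'ᴴ * J₁ * Q) (e : n → ℝ) :
    Real.arctan (leastSquares
      (((2 : ℝ) • (Q'ᴴ * J₂ * Q).map Complex.re) *ᵥ e)
      (((2 : ℝ) • (Q'ᴴ * J₂ * Q).map Complex.im) *ᵥ e)) =
    (sesq (averagedShiftForm J₁ J₂) (Q *ᵥ fun i => (e i : ℂ)) (Q *ᵥ fun i => (e i : ℂ))).arg := by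
  set u := Q *ᵥ fun i => (e i : ℂ) with hu
  set G := Q'ᴴ * J₂ * Q with hG
  have hQQ : Q' * Q'ᴴ = 1 := mul_eq_one_comm.1 hQ'
  have hiso : ∀ x y : q → ℂ, star (Q'ᴴ *ᵥ x) ⬝ᵥ (Q'ᴴ *ᵥ y) = star x ⬝ᵥ y := fun x y => by
    rw [Matrix.star_mulVec, ← Matrix.dotProduct_mulVec, Matrix.mulVec_mulVec,
      Matrix.conjTranspose_conjTranspose, hQQ, Matrix.one_mulVec]
  have hG2 : G *ᵥ (fun i => (e i : ℂ)) = Q'ᴴ *ᵥ (J₂ *ᵥ u) := by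
    simp only [hG, hu, Matrix.mulVec_mulVec, Matrix.mul_assoc]
  have hG1 : G.map star *ᵥ (fun i => (e i : ℂ)) = Q'ᴴ *ᵥ (J₁ *ᵥ u) := by
    simp only [hconj, hu, Matrix.mulVec_mulVec, Matrix.mul_assoc]
  set x := ((2 : ℝ) • G.map Complex.re) *ᵥ e with hx
  set y := ((2 : ℝ) • G.map Complex.im) *ᵥ e with hy
  have hxc : (fun i => (x i : ℂ)) = Q'ᴴ *ᵥ (J₁ *ᵥ u + J₂ *ᵥ u) := by
    rw [Matrix.mulVec_add, ← hG1, ← hG2, ← Matrix.add_mulVec]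
    ext i
    simp only [hx, Matrix.mulVec, dotProduct, Complex.ofReal_sum, Matrix.smul_apply,
      Matrix.map_apply, Matrix.add_apply]
    refine Finset.sum_congr rfl fun j _ => ?_
    rw [smul_eq_mul, Complex.ofReal_mul, Complex.star_def, add_comm (starRingEnd ℂ _),
      Complex.add_conj]
  have hyc : (fun i => (y i : ℂ)) = Q'ᴴ *ᵥ (Complex.I • (J₁ *ᵥ u - J₂ *ᵥ u)) := by
    rw [Matrix.mulVec_smul, Matrix.mulVec_sub, ← hG1, ← hG2, ← Matrix.sub_mulVec]
    ext i
    simp only [hy, Matrix.mulVec, dotProduct, Complex.ofReal_sum, Matrix.smul_apply,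
      Matrix.map_apply, Matrix.sub_apply, Pi.smul_apply, smul_eq_mul, Finset.mul_sum]
    refine Finset.sum_congr rfl fun j _ => ?_
    have h1 := Complex.sub_conj (G i j)
    rw [Complex.star_def, ← neg_sub (G i j), h1]
    push_cast
    linear_combination (2 * ((G i j).im : ℂ) * (e j : ℂ)) * Complex.I_mul_I
  have hcast : ∀ v w : q → ℝ,
      ((v ⬝ᵥ w : ℝ) : ℂ) = star (fun i => (v i : ℂ)) ⬝ᵥ (fun i => (w i : ℂ)) := fun v w => by
    simp [dotProduct]
  set ζ := sesq (averagedShiftForm J₁ J₂) u u with hζdef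
  have hζ : ζ = (star (J₁ *ᵥ u) ⬝ᵥ (J₁ *ᵥ u) + star (J₂ *ᵥ u) ⬝ᵥ (J₂ *ᵥ u)) / 2 +
      star (J₁ *ᵥ u) ⬝ᵥ (J₂ *ᵥ u) := sesq_averagedShiftForm _ _ _ _
  have h21 := Matrix.star_dotProduct (J₂ *ᵥ u) (J₁ *ᵥ u)
  have hxx : x ⬝ᵥ x = 2 * ζ.re := by
    have : ((x ⬝ᵥ x : ℝ) : ℂ) = ζ + star ζ := by
      rw [hcast, hxc, hiso, hζ]
      simp only [star_add, add_dotProduct, dotProduct_add, star_div₀, h21,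
        ← Matrix.star_dotProduct (J₁ *ᵥ u) (J₁ *ᵥ u),
        ← Matrix.star_dotProduct (J₂ *ᵥ u) (J₂ *ᵥ u), star_ofNat]
      ring
    have h := congrArg Complex.re this
    simp at h
    linarith
  have hxy : x ⬝ᵥ y = 2 * ζ.im := by
    have : (x ⬝ᵥ y : ℝ) = (Complex.I * (star ζ - ζ)).re := by
      have h0 : ((x ⬝ᵥ y : ℝ) : ℂ) = Complex.I * (star ζ - ζ) +
          Complex.I * ((energy (J₁ *ᵥ u) - energy (J₂ *ᵥ u) : ℝ) : ℂ) := by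
        rw [hcast, hxc, hyc, hiso, hζ]
        simp only [star_add, add_dotProduct, dotProduct_sub, dotProduct_smul, star_div₀, h21,
          star_dotProduct_self, smul_eq_mul, star_ofNat, Complex.ofReal_sub]
        simp only [Complex.star_def, Complex.conj_ofReal]
        ring
      have := congrArg Complex.re h0
      rw [Complex.add_re, Complex.re_mul_ofReal] at this
      simpa using this
    rw [this]
    simp
    ring
  rw [leastSquares, star_trivial, hxx, hxy, mul_div_mul_left _ _ two_ne_zero]
  -- Since `2 Re ζ = x ⬝ᵥ x`, the number `ζ` lies in the open right half plane unless `x = 0`. Then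
  -- `ζ = 0`, and division by zero agrees with `arg 0 = 0`.
  refine arctan_im_div_re ?_
  have h0 : 0 ≤ x ⬝ᵥ x := Finset.sum_nonneg fun i _ => mul_self_nonneg _
  rcases h0.eq_or_lt with h | h
  · right
    have hx0 : x = 0 := dotProduct_self_eq_zero.1 h.symm
    have h1 : ζ.re = 0 := by linarith
    have h2 : ζ.im = 0 := by rw [hx0, zero_dotProduct] at hxy; linarith
    exact Complex.ext h1 h2
  · left; linarith

end Forms

/-! ### Left `Π`-real matrices -/

section PiReal

variable {n q : Type*} [Fintype n] [Fintype q] [DecidableEq n] [DecidableEq q]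

omit [Fintype n] in
theorem exchange_conjTranspose {rev : n → n} (h : Function.Involutive rev) :
    (exchange rev)ᴴ = exchange rev := by
  ext i j
  have : i = rev j ↔ j = rev i := by rw [← h.eq_iff]; exact eq_comm
  simp only [exchange, Matrix.conjTranspose_apply, Matrix.of_apply, this]
  split_ifs <;> simp

theorem exchange_mul_apply {k : Type*} (rev : n → n) (A : Matrix n k ℂ) (i : n) (j : k) :
    (exchange rev * A) i j = A (rev i) j := by
  simp [exchange, Matrix.mul_apply]

theorem exchange_mul_self {rev : n → n} (h : Function.Involutive rev) :
    exchange rev * exchange rev = 1 := by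
  ext i j
  rw [exchange_mul_apply]
  simp [exchange, Matrix.one_apply, h i, eq_comm]

theorem mul_exchange_apply {k : Type*} {rev : n → n} (h : Function.Involutive rev)
    (A : Matrix k n ℂ) (i : k) (j : n) : (A * exchange rev) i j = A i (rev j) := by
  have : ∀ l, j = rev l ↔ l = rev j := fun l => by rw [← h.eq_iff]; exact eq_comm
  simp [exchange, Matrix.mul_apply, this]

theorem exchange_mul_mul_exchange_apply {rev : n → n} {rev' : q → q}
    (h : Function.Involutive rev') (A : Matrix n q ℂ) (i : n) (j : q) :
    (exchange rev * A * exchange rev') i j = A (rev i) (rev' j) := by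
  rw [mul_exchange_apply h, exchange_mul_apply]

theorem map_star_mul {l m k : Type*} [Fintype m] (A : Matrix l m ℂ) (B : Matrix m k ℂ) :
    (A * B).map star = A.map star * B.map star := by
  ext i j
  simp [Matrix.mul_apply]

theorem IsUnitaryLeftPiReal.map_star {rev : n → n} (h : Function.Involutive rev)
    {Q : Matrix n n ℂ} (hQ : IsUnitaryLeftPiReal rev Q) : Q.map star = exchange rev * Q := by
  conv_rhs => rw [← hQ.2]
  rw [← Matrix.mul_assoc, exchange_mul_self h, Matrix.one_mul]

/-- Sandwiching between left `Π`-real matrices turns flipped conjugation into conjugation. -/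
theorem IsUnitaryLeftPiReal.map_star_sandwich {rev : n → n} (h : Function.Involutive rev)
    {rev' : q → q} (h' : Function.Involutive rev') {Q : Matrix n n ℂ} {Q' : Matrix q q ℂ}
    (hQ : IsUnitaryLeftPiReal rev Q) (hQ' : IsUnitaryLeftPiReal rev' Q') {A B : Matrix q n ℂ}
    (hAB : exchange rev' * A.map star * exchange rev = B) :
    (Q'ᴴ * A * Q).map star = Q'ᴴ * B * Q := by
  have h1 : (Q'ᴴ).map star = Q'ᴴ * exchange rev' := by
    have : (Q'ᴴ).map star = (Q'.map star)ᴴ := by ext i j; simp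
    rw [this, hQ'.map_star h', Matrix.conjTranspose_mul, exchange_conjTranspose h']
  rw [map_star_mul, map_star_mul, h1, hQ.map_star h, ← hAB]
  simp only [Matrix.mul_assoc]

/-- Order reversal of two stacked copies of an index set. -/
def revSum (rev : n → n) : n ⊕ n → n ⊕ n := Sum.swap ∘ Sum.map rev rev

omit [Fintype n] [DecidableEq n] in
theorem involutive_revSum {rev : n → n} (h : Function.Involutive rev) :
    Function.Involutive (revSum rev) := by
  rintro (i | i) <;> simp [revSum, h i]

omit [Fintype n] in
theorem exchange_revSum (rev : n → n) :
    exchange (revSum rev) = Matrix.fromBlocks 0 (exchange rev) (exchange rev) 0 := by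
  ext (i | i) (j | j) <;> simp [exchange, revSum]

theorem isUnitaryLeftPiReal_evenLeftPiReal {rev : n → n} (h : Function.Involutive rev) :
    IsUnitaryLeftPiReal (revSum rev) (evenLeftPiReal rev) := by
  have h2 : ((1 / √2 : ℝ) : ℂ) * ((1 / √2 : ℝ) : ℂ) = 1 / 2 := by
    rw [← Complex.ofReal_mul, div_mul_div_comm, Real.mul_self_sqrt (by norm_num)]
    norm_num
  constructor
  · rw [evenLeftPiReal, Matrix.conjTranspose_smul, Matrix.smul_mul, Matrix.mul_smul, smul_smul,
      Complex.star_def, Complex.conj_ofReal, h2, Matrix.fromBlocks_conjTranspose,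
      Matrix.fromBlocks_multiply]
    simp only [Matrix.conjTranspose_one, Matrix.conjTranspose_smul, Matrix.conjTranspose_neg,
      exchange_conjTranspose h, Matrix.smul_mul, Matrix.mul_smul, Matrix.mul_neg,
      exchange_mul_self h, Matrix.mul_one, smul_smul, neg_neg, Complex.star_def, Complex.conj_I,
      neg_mul, Complex.I_mul_I, add_neg_cancel, one_smul, neg_smul]
    rw [Matrix.fromBlocks_smul, ← Matrix.fromBlocks_one]
    congr 1
    · module
    · simp
    · simp
    · module
  · have h3 : (evenLeftPiReal rev).map star = ((1 / √2 : ℝ) : ℂ) • Matrix.fromBlocks 1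
        (-(Complex.I • (1 : Matrix n n ℂ))) (exchange rev) (Complex.I • exchange rev) := by
      ext (i | i) (j | j) <;>
        simp only [evenLeftPiReal, Matrix.one_apply, exchange, Matrix.map_apply,
          Matrix.smul_apply, Matrix.fromBlocks_apply₁₁, Matrix.fromBlocks_apply₁₂,
          Matrix.fromBlocks_apply₂₁, Matrix.fromBlocks_apply₂₂, Matrix.neg_apply,
          Matrix.of_apply] <;> split_ifs <;> simp
    rw [h3, exchange_revSum, Matrix.mul_smul, Matrix.fromBlocks_multiply, evenLeftPiReal]
    simp [exchange_mul_self h]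

end PiReal

/-! ### Subarrays of the grid -/

section Grid

variable {R : ℕ} {M : Fin R → ℕ} {r : Fin R}

/-- The sensor with given position in mode `r` and given positions in the other modes. -/
def place (r : Fin R) (k : Fin (M r)) (y : (l : {l : Fin R // l ≠ r}) → Fin (M l)) : Sensor M :=
  (Equiv.piSplitAt r fun l => Fin (M l)).symm (k, y)

@[simp]
theorem place_self (k : Fin (M r)) (y : (l : {l : Fin R // l ≠ r}) → Fin (M l)) :
    place r k y r = k := by
  simp [place]

@[simp]
theorem place_of_ne (k : Fin (M r)) (y : (l : {l : Fin R // l ≠ r}) → Fin (M l))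
    (l : {l : Fin R // l ≠ r}) : place r k y l = y l := by
  simp [place, l.2]

theorem sensor_ext {m m' : Sensor M} (h : m r = m' r)
    (h' : ∀ l : {l : Fin R // l ≠ r}, m l = m' l) : m = m' := by
  funext l
  by_cases hl : l = r
  · rw [hl]; exact h
  · exact h' ⟨l, hl⟩

theorem sum_sensor_eq {β : Type*} [AddCommMonoid β] (r : Fin R) (f : Sensor M → β) :
    ∑ m, f m = ∑ y, ∑ k, f (place r k y) := by
  rw [← (Equiv.piSplitAt r fun l => Fin (M l)).symm.sum_comp, Fintype.sum_prod_type_right]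
  rfl

/-- Position of a sensor of the first subarray in the grid. -/
def lower (p : SubSensor M r) : Sensor M :=
  place r ⟨p.2, by have := p.2.isLt; omega⟩ p.1

/-- Position of a sensor of the second subarray in the grid. -/
def upper (p : SubSensor M r) : Sensor M :=
  place r ⟨p.2 + 1, by have := p.2.isLt; omega⟩ p.1

theorem rdSel_mulVec (J : Matrix (Fin (M r - 1)) (Fin (M r)) ℂ) (u : Sensor M → ℂ)
    (p : SubSensor M r) : (rdSel r J *ᵥ u) p = ∑ k, J p.2 k * u (place r k p.1) := by
  have h : ∀ (y : (l : {l : Fin R // l ≠ r}) → Fin (M l)) (k : Fin (M r)),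
      rdSel r J p (place r k y) = if y = p.1 then J p.2 k else 0 := by
    intro y k
    simp only [rdSel, Matrix.of_apply, place_self, place_of_ne, funext_iff]
  rw [Matrix.mulVec, dotProduct, sum_sensor_eq r]
  simp only [h, ite_mul, zero_mul]
  rw [Finset.sum_comm]
  simp

theorem sel₁_mulVec (u : Sensor M → ℂ) : sel₁ M r *ᵥ u = u ∘ lower := by
  ext p
  have h : ∀ k : Fin (M r), (k : ℕ) = p.2 ↔ k = ⟨p.2, by have := p.2.isLt; omega⟩ := fun k => by
    rw [Fin.ext_iff]
  simp [sel₁, rdSel_mulVec, ulaSel₁, h, lower]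

theorem sel₂_mulVec (u : Sensor M → ℂ) : sel₂ M r *ᵥ u = u ∘ upper := by
  ext p
  have h : ∀ k : Fin (M r), (k : ℕ) = p.2 + 1 ↔ k = ⟨p.2 + 1, by have := p.2.isLt; omega⟩ :=
    fun k => by rw [Fin.ext_iff]
  simp [sel₂, rdSel_mulVec, ulaSel₂, h, upper]

theorem involutive_revSensor : Function.Involutive (revSensor M) := fun m => by
  funext l; simp [revSensor]

theorem involutive_revSubSensor : Function.Involutive (revSubSensor M r) := fun p => by
  simp [revSubSensor]

theorem revSensor_upper (p : SubSensor M r) :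
    revSensor M (upper p) = lower (revSubSensor M r p) := by
  have := p.2.isLt
  refine sensor_ext (r := r) ?_ fun l => ?_
  · simp only [revSensor, upper, lower, revSubSensor, place_self, Fin.ext_iff, Fin.val_rev]
    omega
  · simp only [revSensor, upper, lower, revSubSensor, place_of_ne]

theorem revSensor_lower (p : SubSensor M r) :
    revSensor M (lower p) = upper (revSubSensor M r p) := by
  rw [← involutive_revSensor (upper _), revSensor_upper, involutive_revSubSensor p]

theorem sum_revSubSensor {β : Type*} [AddCommMonoid β] (f : SubSensor M r → β) :
    ∑ p, f (revSubSensor M r p) = ∑ p, f p :=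
  Equiv.sum_comp (involutive_revSubSensor.toPerm (revSubSensor M r)) f

theorem sum_revSensor {β : Type*} [AddCommMonoid β] (f : Sensor M → β) :
    ∑ m, f (revSensor M m) = ∑ m, f m :=
  Equiv.sum_comp (involutive_revSensor.toPerm (revSensor M)) f

/-- Reversing the array exchanges the two subarrays, so the lower blocks of the augmented selection
matrices are again `J₁` and `J₂`. -/
theorem flip_sel (M : Fin R → ℕ) (r : Fin R) :
    exchange (revSubSensor M r) * sel₂ M r * exchange (revSensor M) = sel₁ M r := by
  refine Matrix.ext_of_mulVec_single fun m => ?_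
  have hmul : ∀ {κ : Type} [Fintype κ] [DecidableEq κ] (rev : κ → κ) (x : κ → ℂ),
      exchange rev *ᵥ x = x ∘ rev := fun rev x => by
    ext i; simp [exchange, Matrix.mulVec, dotProduct]
  rw [← Matrix.mulVec_mulVec, ← Matrix.mulVec_mulVec, hmul, hmul, sel₂_mulVec, sel₁_mulVec]
  ext p
  simp only [Function.comp_apply]
  rw [revSensor_upper, involutive_revSubSensor p]

theorem flip_sel' (M : Fin R → ℕ) (r : Fin R) :
    exchange (revSubSensor M r) * sel₁ M r * exchange (revSensor M) = sel₂ M r := by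
  rw [← flip_sel]
  simp only [Matrix.mul_assoc, exchange_mul_self involutive_revSensor, Matrix.mul_one]
  rw [← Matrix.mul_assoc, exchange_mul_self involutive_revSubSensor, Matrix.one_mul]

theorem ncSel₁_eq (M : Fin R → ℕ) (r : Fin R) :
    ncSel₁ M r = Matrix.fromBlocks (sel₁ M r) 0 0 (sel₁ M r) := by
  rw [ncSel₁, flip_sel]

theorem ncSel₂_eq (M : Fin R → ℕ) (r : Fin R) :
    ncSel₂ M r = Matrix.fromBlocks (sel₂ M r) 0 0 (sel₂ M r) := by
  rw [ncSel₂, flip_sel']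

theorem sel₂_map_star (M : Fin R → ℕ) (r : Fin R) : (sel₂ M r).map star = sel₂ M r := by
  ext p m
  simp only [sel₂, rdSel, ulaSel₂, Matrix.map_apply, Matrix.of_apply]
  split_ifs <;> simp

/-! ### Steering vectors -/

theorem norm_steering (μ : Fin R → ℝ) (m : Sensor M) : ‖steering M μ m‖ = 1 := by
  rw [steering, norm_prod]
  refine Finset.prod_eq_one fun l _ => ?_
  rw [Complex.norm_exp]
  simp

theorem steering_place (μ : Fin R → ℝ) (k : Fin (M r))
    (y : (l : {l : Fin R // l ≠ r}) → Fin (M l)) :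
    steering M μ (place r k y) = Complex.exp (Complex.I * ((k : ℕ) : ℂ) * (μ r : ℂ)) *
      ∏ l : {l : Fin R // l ≠ r}, Complex.exp (Complex.I * ((y l : ℕ) : ℂ) * (μ l : ℂ)) := by
  rw [steering, Fintype.prod_eq_mul_prod_subtype_ne _ r, place_self]
  simp only [place_of_ne]

theorem steering_upper (μ : Fin R → ℝ) (p : SubSensor M r) :
    steering M μ (upper p) = Complex.exp (Complex.I * (μ r : ℂ)) * steering M μ (lower p) := by
  rw [upper, lower, steering_place, steering_place, ← mul_assoc, ← Complex.exp_add]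
  congr 2
  push_cast
  ring

/-- The phase of the centro-symmetry of the array. -/
noncomputable def centroPhase (M : Fin R → ℕ) (μ : Fin R → ℝ) : ℝ := ∑ l, ((M l : ℝ) - 1) * μ l

/-- Position `k` becomes `M_l - 1 - k`, which conjugates the phases up to a common factor. This
centro-symmetry keeps the signal part of rank one under forward-backward averaging. -/
theorem steering_revSensor (μ : Fin R → ℝ) (m : Sensor M) :
    steering M μ (revSensor M m) =
      Complex.exp (Complex.I * (centroPhase M μ : ℂ)) * star (steering M μ m) := by
  rw [steering, steering, centroPhase, Complex.ofReal_sum, Finset.mul_sum, Complex.exp_sum,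
    Complex.star_def, map_prod, ← Finset.prod_mul_distrib]
  refine Finset.prod_congr rfl fun l _ => ?_
  rw [← Complex.exp_conj, ← Complex.exp_add]
  congr 1
  have h : ((revSensor M m l : ℕ) : ℂ) = (M l : ℂ) - 1 - ((m l : ℕ) : ℂ) := by
    have := (m l).isLt
    rw [revSensor, Fin.val_rev, Nat.cast_sub (by omega)]
    push_cast; ring
  rw [h]
  simp
  ring

theorem energy_steering (μ : Fin R → ℝ) : energy (steering M μ) = ∏ l, (M l : ℝ) := by
  simp [energy, norm_steering]

theorem energy_sel₁_steering (μ : Fin R → ℝ) :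
    energy (sel₁ M r *ᵥ steering M μ) = Fintype.card (SubSensor M r) := by
  rw [sel₁_mulVec]
  simp [energy, norm_steering]

theorem sel₂_mulVec_steering (μ : Fin R → ℝ) :
    sel₂ M r *ᵥ steering M μ =
      Complex.exp (Complex.I * (μ r : ℂ)) • (sel₁ M r *ᵥ steering M μ) := by
  rw [sel₁_mulVec, sel₂_mulVec]
  ext p
  simp [steering_upper]

/-! ### The edges of the array -/

/-- The difference of the multiplicities of a sensor in the second and in the first subarray. -/
noncomputable def edgeWeight (M : Fin R → ℕ) (r : Fin R) (m : Sensor M) : ℝ :=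
  (if (m r : ℕ) + 1 = M r then 1 else 0) - if (m r : ℕ) = 0 then 1 else 0

/-- Interior positions occur in both sums; only the two ends survive. -/
theorem sum_succ_sub_sum {m : ℕ} (hm : 2 ≤ m) (g : Fin m → ℂ) :
    (∑ p : Fin (m - 1), g ⟨p + 1, by have := p.isLt; omega⟩) -
      ∑ p : Fin (m - 1), g ⟨p, by have := p.isLt; omega⟩ =
    ∑ k : Fin m, (((if (k : ℕ) + 1 = m then 1 else 0) - if (k : ℕ) = 0 then 1 else 0 : ℝ) : ℂ) * g k := by
  obtain ⟨n, rfl⟩ : ∃ n, m = n + 1 := ⟨m - 1, by omega⟩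
  have h1 : ∀ k : Fin (n + 1), (k : ℕ) + 1 = n + 1 ↔ k = Fin.last n := fun k => by
    rw [Fin.ext_iff, Fin.val_last]; omega
  have h2 : ∀ k : Fin (n + 1), (k : ℕ) = 0 ↔ k = 0 := fun k => by
    rw [Fin.ext_iff]; rfl
  have h3 : ∑ k : Fin (n + 1), (((if (k : ℕ) + 1 = n + 1 then 1 else 0) -
      if (k : ℕ) = 0 then 1 else 0 : ℝ) : ℂ) * g k = g (Fin.last n) - g 0 := by
    simp only [h1, h2]
    simp [sub_mul, Finset.sum_sub_distrib, apply_ite Complex.ofReal]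
  have h4 := Fin.sum_univ_succ g
  rw [Fin.sum_univ_castSucc] at h4
  rw [h3]
  change (∑ p : Fin n, g p.succ) - ∑ p : Fin n, g p.castSucc = _
  linear_combination -h4

theorem sum_upper_sub_sum_lower (hr : 2 ≤ M r) (f : Sensor M → ℂ) :
    (∑ p : SubSensor M r, f (upper p)) - ∑ p : SubSensor M r, f (lower p) =
      ∑ m, (edgeWeight M r m : ℂ) * f m := by
  rw [sum_sensor_eq r, Fintype.sum_prod_type, Fintype.sum_prod_type, ← Finset.sum_sub_distrib]
  refine Finset.sum_congr rfl fun y _ => ?_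
  simp only [edgeWeight, place_self]
  exact sum_succ_sub_sum hr fun k => f (place r k y)

theorem card_subSensor (M : Fin R → ℕ) (r : Fin R) :
    Fintype.card (SubSensor M r) = (∏ l : {l : Fin R // l ≠ r}, M l) * (M r - 1) := by
  simp

/-- The ends of mode `r` are distinct because `M r ≥ 2`, so each contributes `1` per choice of the
other coordinates. -/
theorem sum_edgeWeight_sq (hr : 2 ≤ M r) :
    ∑ m, edgeWeight M r m ^ 2 = 2 * ∏ l : {l : Fin R // l ≠ r}, (M l : ℝ) := by
  rw [sum_sensor_eq r]
  simp only [edgeWeight, place_self]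
  have h : ∀ k : Fin (M r), ((if (k : ℕ) + 1 = M r then 1 else 0) -
      if (k : ℕ) = 0 then 1 else 0 : ℝ) ^ 2 =
      (if k = ⟨M r - 1, by omega⟩ then 1 else 0) + if k = ⟨0, by omega⟩ then 1 else 0 := by
    intro k
    have h1 : (k : ℕ) + 1 = M r ↔ k = ⟨M r - 1, by omega⟩ := by rw [Fin.ext_iff]; simp; omega
    have h2 : (k : ℕ) = 0 ↔ k = ⟨0, by omega⟩ := by rw [Fin.ext_iff]
    by_cases e1 : (k : ℕ) + 1 = M r
    · have e2 : ¬ (k : ℕ) = 0 := by omega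
      simp [← h1, ← h2, e1, e2]
    · simp [← h1, ← h2, e1]
  simp only [h, Finset.sum_add_distrib]
  simp [two_mul]

end Grid

/-! ### Error expansion of a data model -/

/-- Along `comap ε (𝓝 0)` only the size of `ε i` matters, so the constants are uniform over the
index type. -/
theorem exists_bound_of_isBigO_comap {ι : Type*} {ε : ι → ℝ} (hε : ∀ i, 0 ≤ ε i) {f : ι → ℝ}
    {k : ℕ} (h : f =O[comap ε (𝓝 0)] fun i => ε i ^ k) :
    ∃ C δ : ℝ, 0 < C ∧ 0 < δ ∧ ∀ i, ε i ≤ δ → |f i| ≤ C * ε i ^ k := by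
  obtain ⟨C, hC, hb⟩ := h.exists_pos
  obtain ⟨δ, hδ, hsub⟩ := (Metric.nhds_basis_ball.comap ε).eventually_iff.1 hb.bound
  refine ⟨C, δ / 2, hC, half_pos hδ, fun i hi => ?_⟩
  have hmem : i ∈ ε ⁻¹' Metric.ball 0 δ := by
    rw [Set.mem_preimage, mem_ball_zero_iff, Real.norm_eq_abs, abs_of_nonneg (hε i)]
    linarith
  have := hsub hmem
  rwa [Real.norm_eq_abs, Real.norm_eq_abs, abs_of_nonneg (pow_nonneg (hε i) k)] at this

/-! ### Constants uniform in symbols, noise and singular vectors. -/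

section Uniform

variable {α β γ : Type*} {n k : Type*} [Fintype n] [Fintype k] [DecidableEq n] {a : α → n → ℂ}
  {sym : α → β → k → ℂ} {D : γ → Matrix n k ℂ} {ε : α → β → γ → ℝ} {P : β → Prop} {A : ℝ}

/-- All phases, symbols and noise matrices together index one family, so the constants depend on
none of them; the filter `⊤` makes the bounds hold everywhere. -/
theorem exists_bound_variations (hA : 1 ≤ A) (ha : ∀ φ, energy (a φ) = A ^ 2)
    (hs : ∀ φ s₀, P s₀ → 0 < energy (sym φ s₀))
    (hE : ∀ φ s₀, P s₀ → ∀ E, ∑ i, ∑ t, ‖D E i t‖ ^ 2 ≤ ε φ s₀ E ^ 2 * energy (sym φ s₀))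
    (T : Matrix n n ℂ) {ζ₀ : ℂ} (hζ : ∀ φ, sesq T (a φ) (a φ) = ζ₀)
    (hε : ∀ φ s₀ E, 0 ≤ ε φ s₀ E) :
    ∃ c₁ c₂ : ℝ, 0 < c₁ ∧ 0 < c₂ ∧ ∀ φ s₀ E, P s₀ →
      |(relFirst T (sym φ s₀) (a φ) (D E)).im| ≤ c₁ * ε φ s₀ E ∧
      |argSecond T (sym φ s₀) (a φ) (D E)| ≤ c₂ * ε φ s₀ E ^ 2 := by
  have h := variations_isBigO (ι := {x : α × β × γ // P x.2.1}) (l := ⊤)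
    (ε := fun x => ε x.1.1 x.1.2.1 x.1.2.2) (fun x => hε _ _ _) hA
    (a := fun x => a x.1.1) (s := fun x => sym x.1.1 x.1.2.1) (E := fun x => D x.1.2.2)
    (fun x => ha _) (fun x => hs _ _ x.2) (fun x => hE _ _ x.2 _) T (fun x => hζ _)
  obtain ⟨c₁, hc₁, b₁⟩ := h.1.exists_pos
  obtain ⟨c₂, hc₂, b₂⟩ := h.2.exists_pos
  refine ⟨c₁, c₂, hc₁, hc₂, fun φ s₀ E h0 => ⟨?_, ?_⟩⟩
  · have := eventually_top.1 b₁.bound ⟨(φ, s₀, E), h0⟩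
    rwa [Real.norm_eq_abs, Real.norm_eq_abs, abs_of_nonneg (hε _ _ _)] at this
  · have := eventually_top.1 b₂.bound ⟨(φ, s₀, E), h0⟩
    rwa [Real.norm_eq_abs, Real.norm_eq_abs, abs_of_nonneg (pow_nonneg (hε φ s₀ E) 2)] at this

/-- The index also carries the eigenvector, so the constants do not depend on which dominant vector
was computed. -/
theorem exists_bound_arg (hA : 1 ≤ A) (ha : ∀ φ, energy (a φ) = A ^ 2)
    (hs : ∀ φ s₀, P s₀ → 0 < energy (sym φ s₀))
    (hE : ∀ φ s₀, P s₀ → ∀ E, ∑ i, ∑ t, ‖D E i t‖ ^ 2 ≤ ε φ s₀ E ^ 2 * energy (sym φ s₀))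
    (T : Matrix n n ℂ) {ζ₀ : ℂ} (hζ₀ : ζ₀ ∈ Complex.slitPlane)
    (hζ : ∀ φ, sesq T (a φ) (a φ) = ζ₀) (hε : ∀ φ s₀ E, 0 ≤ ε φ s₀ E) :
    ∃ c δ : ℝ, 0 < c ∧ 0 < δ ∧ ∀ φ s₀ E u, P s₀ →
      IsTopEigenvector ((Matrix.vecMulVec (a φ) (sym φ s₀) + D E) *
        (Matrix.vecMulVec (a φ) (sym φ s₀) + D E)ᴴ) u → ε φ s₀ E ≤ δ →
      |(sesq T u u).arg - ζ₀.arg - ((relFirst T (sym φ s₀) (a φ) (D E)).im +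
        argSecond T (sym φ s₀) (a φ) (D E))| ≤ c * ε φ s₀ E ^ 3 := by
  have h := arg_sesq_topEigenvector_isBigO
    (ι := {x : (α × β × γ) × (n → ℂ) // P x.1.2.1 ∧
      IsTopEigenvector ((Matrix.vecMulVec (a x.1.1) (sym x.1.1 x.1.2.1) + D x.1.2.2) *
      (Matrix.vecMulVec (a x.1.1) (sym x.1.1 x.1.2.1) + D x.1.2.2)ᴴ) x.2})
    (ε := fun x => ε x.1.1.1 x.1.1.2.1 x.1.1.2.2)
    (l := comap (fun x => ε x.1.1.1 x.1.1.2.1 x.1.1.2.2) (𝓝 0))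
    (fun x => hε _ _ _) tendsto_comap hA
    (a := fun x => a x.1.1.1) (s := fun x => sym x.1.1.1 x.1.1.2.1)
    (E := fun x => D x.1.1.2.2) (fun x => ha _) (fun x => hs _ _ x.2.1)
    (fun x => hE _ _ x.2.1 _) (u := fun x => x.1.2) (fun x => x.2.2) T hζ₀ (fun x => hζ _)
  obtain ⟨c, δ, hc, hδ, b⟩ := exists_bound_of_isBigO_comap (fun x => hε _ _ _) h
  exact ⟨c, δ, hc, hδ, fun φ s₀ E u h0 hu he => b ⟨((φ, s₀, E), u), h0, hu⟩ he⟩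

end Uniform

/-! ### Reduction of an estimator to a rank one model and a phase form. -/

section Model

variable {R N : ℕ} {M : Fin R → ℕ} {r : Fin R}

/-- The noise amplitude relative to the signal amplitude. -/
noncomputable def relNoise (s : Fin N → ℂ) (E : Matrix (Sensor M) (Fin N) ℂ) : ℝ :=
  noiseNorm E / √(energy s)

theorem noiseNorm_sq (E : Matrix (Sensor M) (Fin N) ℂ) :
    noiseNorm E ^ 2 = ∑ m, ∑ t, ‖E m t‖ ^ 2 := by
  rw [noiseNorm, Real.sq_sqrt (by positivity)]

theorem relNoise_nonneg (s : Fin N → ℂ) (E : Matrix (Sensor M) (Fin N) ℂ) : 0 ≤ relNoise s E := by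
  unfold relNoise noiseNorm; positivity

theorem relNoise_sq (s : Fin N → ℂ) (E : Matrix (Sensor M) (Fin N) ℂ) :
    relNoise s E ^ 2 = noiseNorm E ^ 2 / energy s := by
  rw [relNoise, div_pow, Real.sq_sqrt (energy_nonneg s)]

theorem energy_symbols (φ : ℝ) (s₀ : Fin N → ℝ) : energy (symbols φ s₀) = ∑ t, s₀ t ^ 2 := by
  refine Finset.sum_congr rfl fun t _ => ?_
  rw [symbols, norm_mul, Complex.norm_exp]
  simp

theorem energy_symbols_pos (φ : ℝ) {s₀ : Fin N → ℝ} (h : s₀ ≠ 0) : 0 < energy (symbols φ s₀) := by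
  rw [energy_symbols]
  obtain ⟨t, ht⟩ := Function.ne_iff.1 h
  exact Finset.sum_pos' (fun _ _ => sq_nonneg _) ⟨t, Finset.mem_univ _, by
    have : s₀ t ≠ 0 := ht
    positivity⟩

/-- The coefficients of the first-order error. -/
noncomputable def errorCoeff (r : Fin R) (μ : Fin R → ℝ) (s : Fin N → ℂ) (m : Sensor M)
    (t : Fin N) : ℂ :=
  ((edgeWeight M r m / (energy s * Fintype.card (SubSensor M r)) : ℝ) : ℂ) *
    (star (steering M μ m) * star (s t))

/-- The first-order error in mode `r`. -/
noncomputable def linearError (r : Fin R) (μ : Fin R → ℝ) (s : Fin N → ℂ) :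
    Matrix (Sensor M) (Fin N) ℂ →ₗ[ℝ] ℝ where
  toFun E := (∑ m, ∑ t, errorCoeff r μ s m t * E m t).im
  map_add' E F := by
    simp only [Matrix.add_apply, mul_add, Finset.sum_add_distrib, Complex.add_im]
  map_smul' c E := by
    simp only [Matrix.smul_apply, mul_smul_comm, ← Finset.smul_sum, Complex.smul_im,
      RingHom.id_apply]

theorem linearError_eq (hr : 2 ≤ M r) (μ : Fin R → ℝ) (s : Fin N → ℂ)
    (E : Matrix (Sensor M) (Fin N) ℂ) :
    linearError r μ s E =
      (star (sel₂ M r *ᵥ steering M μ) ⬝ᵥ (sel₂ M r *ᵥ matchedNoise s E) -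
        star (sel₁ M r *ᵥ steering M μ) ⬝ᵥ (sel₁ M r *ᵥ matchedNoise s E)).im /
        Fintype.card (SubSensor M r) := by
  have h : star (sel₂ M r *ᵥ steering M μ) ⬝ᵥ (sel₂ M r *ᵥ matchedNoise s E) -
        star (sel₁ M r *ᵥ steering M μ) ⬝ᵥ (sel₁ M r *ᵥ matchedNoise s E) =
      ∑ m, (edgeWeight M r m : ℂ) * (star (steering M μ m) * matchedNoise s E m) := by
    rw [← sum_upper_sub_sum_lower hr, sel₁_mulVec, sel₁_mulVec, sel₂_mulVec, sel₂_mulVec]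
    rfl
  rw [h, ← Complex.div_ofReal_im, Finset.sum_div]
  change (∑ m, ∑ t, errorCoeff r μ s m t * E m t).im = _
  congr 1
  refine Finset.sum_congr rfl fun m _ => ?_
  simp only [matchedNoise, Pi.smul_apply, Matrix.mulVec, dotProduct, smul_eq_mul,
    Finset.mul_sum, Finset.sum_div, errorCoeff, Pi.star_apply]
  refine Finset.sum_congr rfl fun t _ => ?_
  push_cast
  rw [mul_comm (energy s : ℂ), ← div_div]
  simp only [div_eq_mul_inv]
  ring

/-- The error expansion that all four methods satisfy: uniform in the symbols, with the common
linear term and an even second-order term. -/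
def HasErrorExpansion (r : Fin R) (μ : Fin R → ℝ)
    (est : ℝ → (Fin N → ℝ) → Matrix (Sensor M) (Fin N) ℂ → ℝ → Prop) : Prop :=
  ∃ C δ : ℝ, 0 < C ∧ 0 < δ ∧ ∀ (φ : ℝ) (s₀ : Fin N → ℝ), s₀ ≠ 0 →
    ∃ q : Matrix (Sensor M) (Fin N) ℂ → ℝ, Continuous q ∧ (∀ E, q (-E) = q E) ∧
      (∀ E, |q E| ≤ C * relNoise (symbols φ s₀) E ^ 2) ∧
      (∀ E : Matrix (Sensor M) (Fin N) ℂ, |linearError r μ (symbols φ s₀) E| ≤ C * relNoise (symbols φ s₀) E) ∧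
      ∀ E μhat, relNoise (symbols φ s₀) E ≤ δ → est φ s₀ E μhat →
        |μhat - μ r - linearError r μ (symbols φ s₀) E - q E| ≤
          C * relNoise (symbols φ s₀) E ^ 3

theorem HasErrorExpansion.mono {μ : Fin R → ℝ}
    {est est' : ℝ → (Fin N → ℝ) → Matrix (Sensor M) (Fin N) ℂ → ℝ → Prop}
    (h : HasErrorExpansion r μ est) (hest : ∀ φ s₀ E μhat, est' φ s₀ E μhat → est φ s₀ E μhat) :
    HasErrorExpansion r μ est' := by
  obtain ⟨C, δ, hC, hδ, h⟩ := h
  refine ⟨C, δ, hC, hδ, fun φ s₀ hs => ?_⟩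
  obtain ⟨q, h1, h2, h3, h4, h5⟩ := h φ s₀ hs
  exact ⟨q, h1, h2, h3, h4, fun E μhat hE he => h5 E μhat hE (hest _ _ _ _ he)⟩

/-- The model and the form stay abstract so that one argument serves all four methods. The linear
term specific to each method enters only through `hL`. -/
theorem hasErrorExpansion_of_model {n k q : Type} [Fintype n] [Fintype k] [Fintype q]
    [DecidableEq n] {μ : Fin R → ℝ} (hμ : μ r ∈ Set.Ioo (-π) π)
    {a : ℝ → n → ℂ} {sym : ℝ → (Fin N → ℝ) → k → ℂ}
    {D : Matrix (Sensor M) (Fin N) ℂ → Matrix n k ℂ} (hD : Continuous D)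
    (hDneg : ∀ E, D (-E) = -D E) {J₁ J₂ : Matrix q n ℂ} {κ : ℝ} {T : Matrix n n ℂ}
    (hT : IsPhaseForm J₁ J₂ κ T) {p : ℝ} (hp : 0 < p) {A : ℝ} (hA : 1 ≤ A)
    (ha : ∀ φ, energy (a φ) = A)
    (hshift : ∀ φ, J₂ *ᵥ a φ = Complex.exp (Complex.I * (μ r : ℂ)) • (J₁ *ᵥ a φ))
    (hpa : ∀ φ, energy (J₁ *ᵥ a φ) = p)
    (hs : ∀ φ s₀, energy (symbols φ s₀) ≤ energy (sym φ s₀))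
    (hDE : ∀ E, ∑ i, ∑ t, ‖D E i t‖ ^ 2 ≤ 2 * noiseNorm E ^ 2)
    (hL : ∀ φ s₀, s₀ ≠ 0 → ∀ E,
      (star (J₂ *ᵥ a φ) ⬝ᵥ (J₂ *ᵥ matchedNoise (sym φ s₀) (D E)) -
        star (J₁ *ᵥ a φ) ⬝ᵥ (J₁ *ᵥ matchedNoise (sym φ s₀) (D E))).im / p =
      linearError r μ (symbols φ s₀) E) :
    HasErrorExpansion (M := M) (N := N) r μ fun φ s₀ E μhat =>
      ∃ u, IsTopEigenvector ((Matrix.vecMulVec (a φ) (sym φ s₀) + D E) *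
        (Matrix.vecMulVec (a φ) (sym φ s₀) + D E)ᴴ) u ∧ μhat = κ * (sesq T u u).arg := by
  obtain ⟨ζ₀, hζ₀, hκ, hform⟩ := hT (μ r) hμ p hp
  have hζ : ∀ φ, sesq T (a φ) (a φ) = ζ₀ := fun φ => (hform _ (hshift φ) (hpa φ)).1
  have hrel : ∀ φ s₀, s₀ ≠ 0 → ∀ E, κ * (relFirst T (sym φ s₀) (a φ) (D E)).im =
      linearError r μ (symbols φ s₀) E := fun φ s₀ h E => by
    rw [relFirst, hζ, (hform _ (hshift φ) (hpa φ)).2, hL φ s₀ h]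
  have hA' : 1 ≤ √A := Real.one_le_sqrt.2 hA
  have ha' : ∀ φ, energy (a φ) = √A ^ 2 := fun φ => by rw [ha, Real.sq_sqrt (by linarith)]
  have hsym : ∀ φ s₀, s₀ ≠ 0 → 0 < energy (sym φ s₀) := fun φ s₀ h =>
    (energy_symbols_pos φ h).trans_le (hs φ s₀)
  have hE : ∀ φ s₀, s₀ ≠ 0 → ∀ E, ∑ i, ∑ t, ‖D E i t‖ ^ 2 ≤
      (2 * relNoise (symbols φ s₀) E) ^ 2 * energy (sym φ s₀) := fun φ s₀ h E => by
    refine (hDE E).trans ?_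
    have h0 := energy_symbols_pos φ h
    rw [mul_pow, relNoise_sq]
    calc 2 * noiseNorm E ^ 2 ≤ 4 * noiseNorm E ^ 2 := by nlinarith [sq_nonneg (noiseNorm E)]
      _ = 2 ^ 2 * (noiseNorm E ^ 2 / energy (symbols φ s₀)) * energy (symbols φ s₀) := by
        field_simp; ring
      _ ≤ _ := by gcongr; exact hs φ s₀
  obtain ⟨c1, c2, hc1, hc2, b12⟩ := exists_bound_variations hA' ha' hsym hE T hζ
    (fun φ s₀ E => mul_nonneg zero_le_two (relNoise_nonneg (symbols φ s₀) E))
  obtain ⟨c3, δ, hc3, hδ, b3⟩ := exists_bound_arg hA' ha' hsym hE T hζ₀ hζ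
    (fun φ s₀ E => mul_nonneg zero_le_two (relNoise_nonneg (symbols φ s₀) E))
  -- The noise level fed to the expansion is `2 * relNoise`, because the transformed noise has at
  -- most twice the energy and `2 ≤ 2 ^ 2`. Its powers give the factors `2`, `4`, `8` and the radius
  -- `δ / 2`; the summand `1` keeps the constant positive when `κ = 0`.
  refine ⟨(|κ| + 1) * (2 * c1 + 4 * c2 + 8 * c3), δ / 2, by positivity, half_pos hδ,
    fun φ s₀ h0 => ?_⟩
  refine ⟨fun E => κ * argSecond T (sym φ s₀) (a φ) (D E),
    ((continuous_argSecond T _ _).comp hD).const_mul κ, fun E => ?_, fun E => ?_, fun E => ?_, ?_⟩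
  · simp only [hDneg, argSecond_neg]
  · have h1 := (b12 φ s₀ E h0).2
    rw [abs_mul]
    calc _ ≤ (|κ| + 1) * (c2 * (2 * relNoise (symbols φ s₀) E) ^ 2) := by gcongr; linarith
      _ = (|κ| + 1) * (4 * c2) * relNoise (symbols φ s₀) E ^ 2 := by ring
      _ ≤ _ := by gcongr; linarith
  · have h1 := (b12 φ s₀ E h0).1
    have hn := relNoise_nonneg (symbols φ s₀) E
    rw [← hrel φ s₀ h0, abs_mul]
    calc _ ≤ (|κ| + 1) * (c1 * (2 * relNoise (symbols φ s₀) E)) := by gcongr; linarith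
      _ = (|κ| + 1) * (2 * c1) * relNoise (symbols φ s₀) E := by ring
      _ ≤ _ := by gcongr; linarith
  · rintro E μhat hE' ⟨u, hu, rfl⟩
    have h1 := b3 φ s₀ E u h0 hu (by linarith)
    have hn := relNoise_nonneg (symbols φ s₀) E
    rw [← hrel φ s₀ h0]
    nth_rw 1 [← hκ]
    rw [show κ * (sesq T u u).arg - κ * ζ₀.arg - κ * (relFirst T (sym φ s₀) (a φ) (D E)).im -
        κ * argSecond T (sym φ s₀) (a φ) (D E) = κ * ((sesq T u u).arg - ζ₀.arg -
        ((relFirst T (sym φ s₀) (a φ) (D E)).im + argSecond T (sym φ s₀) (a φ) (D E))) by ring,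
      abs_mul]
    calc _ ≤ (|κ| + 1) * (c3 * (2 * relNoise (symbols φ s₀) E) ^ 3) := by gcongr; linarith
      _ = (|κ| + 1) * (8 * c3) * relNoise (symbols φ s₀) E ^ 3 := by ring
      _ ≤ _ := by gcongr; linarith

end Model

/-! ### The four methods as instances of the rank one model. -/

section Methods

variable {R N : ℕ} {M : Fin R → ℕ} {r : Fin R}

theorem measurement_eq (μ : Fin R → ℝ) (s : Fin N → ℂ) (E : Matrix (Sensor M) (Fin N) ℂ) :
    measurement μ s E = Matrix.vecMulVec (steering M μ) s + E := rfl

theorem card_subSensor_pos (hM : ∀ l, 1 ≤ M l) (hr : 2 ≤ M r) :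
    0 < Fintype.card (SubSensor M r) := by
  rw [card_subSensor]
  exact Nat.mul_pos (Finset.prod_pos fun l _ => hM l) (by omega)

theorem one_le_prod_sensors (hM : ∀ l, 1 ≤ M l) : (1 : ℝ) ≤ ∏ l, (M l : ℝ) := by
  have h : 1 ≤ ∏ l, M l := Nat.one_le_iff_ne_zero.2
    (Finset.prod_ne_zero_iff.2 fun l _ => by have := hM l; omega)
  exact_mod_cast h

/-! ### Without forward-backward averaging -/

theorem standard_model (hM : ∀ l, 1 ≤ M l) (hr : 2 ≤ M r) {μ : Fin R → ℝ}
    (hμ : μ r ∈ Set.Ioo (-π) π) :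
    HasErrorExpansion (M := M) (N := N) r μ fun φ s₀ E μhat =>
      IsStandard r (measurement μ (symbols φ s₀) E) μhat := by
  have hp : (0 : ℝ) < Fintype.card (SubSensor M r) := by
    exact_mod_cast card_subSensor_pos hM hr
  refine (hasErrorExpansion_of_model hμ (a := fun _ => steering M μ)
    (sym := fun φ s₀ => symbols φ s₀) (D := fun E => E) continuous_id (fun E => rfl)
    (isPhaseForm_shiftForm (sel₁ M r) (sel₂ M r)) hp (one_le_prod_sensors hM)
    (fun _ => energy_steering μ) (fun _ => sel₂_mulVec_steering μ)
    (fun _ => energy_sel₁_steering μ) (fun _ _ => le_rfl) (fun E => ?_)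
    (fun φ s₀ _ E => (linearError_eq hr μ _ E).symm)).mono ?_
  · rw [noiseNorm_sq]
    have : 0 ≤ ∑ m, ∑ t, ‖E m t‖ ^ 2 := by positivity
    linarith
  · rintro φ s₀ E μhat ⟨u, hu, rfl⟩
    refine ⟨u, ?_, ?_⟩
    · have := hu.isTopEigenvector
      rwa [measurement_eq] at this
    · rw [arg_leastSquares, sesq_shiftForm, one_mul]

/-! ### Forward-backward averaging -/

/-- The symbols of the forward-backward averaged data. -/
noncomputable def fbaSymbols (M : Fin R → ℕ) (μ : Fin R → ℝ) (s : Fin N → ℂ) : Fin N ⊕ Fin N → ℂ :=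
  Sum.elim s fun t => star (Complex.exp (Complex.I * (centroPhase M μ : ℂ))) * star (s t.rev)

theorem energy_fbaSymbols (μ : Fin R → ℝ) (s : Fin N → ℂ) :
    energy (fbaSymbols M μ s) = 2 * energy s := by
  have h : ‖Complex.exp (Complex.I * (centroPhase M μ : ℂ))‖ = 1 := by
    rw [Complex.norm_exp]; simp
  have h2 : ∑ t : Fin N, ‖s t.rev‖ ^ 2 = ∑ t, ‖s t‖ ^ 2 :=
    Equiv.sum_comp Fin.revPerm fun t => ‖s t‖ ^ 2
  simp [energy, fbaSymbols, h, h2, two_mul]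

theorem fbaData_inl (E : Matrix (Sensor M) (Fin N) ℂ) (m : Sensor M) (t : Fin N) :
    fbaData E m (Sum.inl t) = E m t := by
  rw [fbaData, Matrix.fromCols_apply_inl]

theorem fbaData_inr (E : Matrix (Sensor M) (Fin N) ℂ) (m : Sensor M) (t : Fin N) :
    fbaData E m (Sum.inr t) = star (E (revSensor M m) t.rev) := by
  rw [fbaData, Matrix.fromCols_apply_inr]
  exact exchange_mul_mul_exchange_apply Fin.rev_involutive (E.map star) m t

theorem fbaData_measurement (μ : Fin R → ℝ) (s : Fin N → ℂ) (E : Matrix (Sensor M) (Fin N) ℂ) :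
    fbaData (measurement μ s E) =
      Matrix.vecMulVec (steering M μ) (fbaSymbols M μ s) + fbaData E := by
  ext m (t | t)
  · simp [fbaData_inl, measurement, fbaSymbols, Matrix.vecMulVec_apply]
  · simp only [fbaData_inr, measurement, fbaSymbols, Matrix.vecMulVec_apply, Matrix.of_apply,
      Matrix.add_apply, Sum.elim_inr, steering_revSensor, star_add, star_mul', star_star]
    ring

/-- The backward half contributes the reversed and conjugated matched noise; the doubled symbol
energy makes the sum an average. -/
theorem matchedNoise_fbaData (μ : Fin R → ℝ) {s : Fin N → ℂ} (hs : energy s ≠ 0)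
    (E : Matrix (Sensor M) (Fin N) ℂ) (m : Sensor M) :
    matchedNoise (fbaSymbols M μ s) (fbaData E) m =
      (matchedNoise s E m + Complex.exp (Complex.I * (centroPhase M μ : ℂ)) *
        star (matchedNoise s E (revSensor M m))) / 2 := by
  have hs' : ((energy s : ℝ) : ℂ) ≠ 0 := by exact_mod_cast hs
  have h2 : ∑ t : Fin N, star (E (revSensor M m) t.rev) * s t.rev =
      ∑ t, star (E (revSensor M m) t) * s t :=
    Equiv.sum_comp Fin.revPerm fun t => star (E (revSensor M m) t) * s t
  unfold matchedNoise
  rw [energy_fbaSymbols]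
  simp only [Pi.smul_apply, Matrix.mulVec, dotProduct,
    Fintype.sum_sum_type, fbaData_inl, fbaData_inr, fbaSymbols, Pi.star_apply, Sum.elim_inl,
    Sum.elim_inr, star_mul', star_star, smul_eq_mul, star_sum, star_inv₀]
  have h3 : ∀ t : Fin N, star (E (revSensor M m) t.rev) *
      (Complex.exp (Complex.I * (centroPhase M μ : ℂ)) * s t.rev) =
      Complex.exp (Complex.I * (centroPhase M μ : ℂ)) *
        (star (E (revSensor M m) t.rev) * s t.rev) := fun t => by ring
  simp only [h3, ← Finset.mul_sum, h2]
  rw [Complex.star_def, Complex.conj_ofReal]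
  push_cast
  field_simp

theorem sum_norm_sq_fbaData (E : Matrix (Sensor M) (Fin N) ℂ) :
    ∑ m, ∑ t, ‖fbaData E m t‖ ^ 2 = 2 * noiseNorm E ^ 2 := by
  have h1 : ∀ m, ∑ t : Fin N, ‖E m t.rev‖ ^ 2 = ∑ t, ‖E m t‖ ^ 2 := fun m =>
    Equiv.sum_comp Fin.revPerm fun t => ‖E m t‖ ^ 2
  simp only [Fintype.sum_sum_type, fbaData_inl, fbaData_inr, norm_star, h1,
    Finset.sum_add_distrib]
  rw [sum_revSensor fun m => ∑ t, ‖E m t‖ ^ 2, noiseNorm_sq]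
  ring

/-- Let `x`, `y` be the inner products over the first and second subarray without averaging.
Reversal with conjugation exchanges and conjugates them, so averaging gives `(x + ȳ) / 2` and `(y +
x̄) / 2`, whose difference `y - x` has the same imaginary part as before. -/
theorem fbaData_im_eq (μ : Fin R → ℝ) {s : Fin N → ℂ} (hs : energy s ≠ 0)
    (E : Matrix (Sensor M) (Fin N) ℂ) :
    (star (sel₂ M r *ᵥ steering M μ) ⬝ᵥ
        (sel₂ M r *ᵥ matchedNoise (fbaSymbols M μ s) (fbaData E)) -
      star (sel₁ M r *ᵥ steering M μ) ⬝ᵥ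
        (sel₁ M r *ᵥ matchedNoise (fbaSymbols M μ s) (fbaData E))).im =
    (star (sel₂ M r *ᵥ steering M μ) ⬝ᵥ (sel₂ M r *ᵥ matchedNoise s E) -
      star (sel₁ M r *ᵥ steering M μ) ⬝ᵥ (sel₁ M r *ᵥ matchedNoise s E)).im := by
  set b := matchedNoise s E with hb
  have hterm : ∀ m, star (steering M μ m) * matchedNoise (fbaSymbols M μ s) (fbaData E) m =
      (star (steering M μ m) * b m + star (star (steering M μ (revSensor M m)) *
        b (revSensor M m))) / 2 := fun m => by
    rw [matchedNoise_fbaData μ hs]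
    have h1 : star (steering M μ m) = star (Complex.exp (Complex.I * (centroPhase M μ : ℂ))) *
        steering M μ (revSensor M m) := by
      conv_lhs => rw [← involutive_revSensor m, steering_revSensor]
      rw [star_mul', star_star]
    have h2 := star_exp_mul_exp (centroPhase M μ)
    rw [star_mul', star_star, h1]
    linear_combination (steering M μ (revSensor M m) * star (b (revSensor M m)) / 2) * h2
  have h1 : star (sel₁ M r *ᵥ steering M μ) ⬝ᵥ
        (sel₁ M r *ᵥ matchedNoise (fbaSymbols M μ s) (fbaData E)) =
      (star (sel₁ M r *ᵥ steering M μ) ⬝ᵥ (sel₁ M r *ᵥ b) +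
        star (star (sel₂ M r *ᵥ steering M μ) ⬝ᵥ (sel₂ M r *ᵥ b))) / 2 := by
    simp only [sel₁_mulVec, sel₂_mulVec, dotProduct, Pi.star_apply, Function.comp_apply, hterm,
      revSensor_lower, ← Finset.sum_div, Finset.sum_add_distrib, star_sum]
    rw [sum_revSubSensor fun p : SubSensor M r =>
      star (star (steering M μ (upper p)) * b (upper p))]
  have h2 : star (sel₂ M r *ᵥ steering M μ) ⬝ᵥ
        (sel₂ M r *ᵥ matchedNoise (fbaSymbols M μ s) (fbaData E)) =
      (star (sel₂ M r *ᵥ steering M μ) ⬝ᵥ (sel₂ M r *ᵥ b) +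
        star (star (sel₁ M r *ᵥ steering M μ) ⬝ᵥ (sel₁ M r *ᵥ b))) / 2 := by
    simp only [sel₁_mulVec, sel₂_mulVec, dotProduct, Pi.star_apply, Function.comp_apply, hterm,
      revSensor_upper, ← Finset.sum_div, Finset.sum_add_distrib, star_sum]
    rw [sum_revSubSensor fun p : SubSensor M r =>
      star (star (steering M μ (lower p)) * b (lower p))]
  rw [h1, h2]
  apply im_eq_of_sub_star_eq
  simp only [star_sub, star_add, star_div₀, star_star, star_ofNat]
  ring

theorem fbaData_conj (X : Matrix (Sensor M) (Fin N) ℂ) :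
    exchange (revSensor M) * (fbaData X).map star * exchange (revSum Fin.rev) = fbaData X := by
  ext m t
  refine (exchange_mul_mul_exchange_apply (involutive_revSum Fin.rev_involutive)
    ((fbaData X).map star) m t).trans ?_
  rcases t with t | t
  · rw [fbaData_inl]
    change star (fbaData X (revSensor M m) (Sum.inr t.rev)) = _
    rw [fbaData_inr, star_star, involutive_revSensor m, Fin.rev_rev]
  · rw [fbaData_inr]
    change star (fbaData X (revSensor M m) (Sum.inl t.rev)) = _
    rw [fbaData_inl]

/-- The averaged data are centro-Hermitian, so their transform is already real and taking real parts
loses nothing. The two Gram matrices are then unitarily similar. -/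
theorem isTopEigenvector_fbaData {X : Matrix (Sensor M) (Fin N) ℂ}
    {Q : Matrix (Sensor M) (Sensor M) ℂ} (hQ : IsUnitaryLeftPiReal (revSensor M) Q)
    {e : Sensor M → ℝ} (he : IsDominantLeftSingularVector
      ((Qᴴ * fbaData X * evenLeftPiReal (Fin.rev : Fin N → Fin N)).map Complex.re) e) :
    IsTopEigenvector (fbaData X * (fbaData X)ᴴ) (Q *ᵥ fun i => (e i : ℂ)) := by
  set V := evenLeftPiReal (Fin.rev : Fin N → Fin N) with hV
  have hVr := isUnitaryLeftPiReal_evenLeftPiReal (Fin.rev_involutive (n := N))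
  have hVV : V * Vᴴ = 1 := mul_eq_one_comm.1 hVr.1
  have hQQ : Q * Qᴴ = 1 := mul_eq_one_comm.1 hQ.1
  set Z := Qᴴ * fbaData X * V with hZ
  have hreal : Z.map star = Z :=
    hVr.map_star_sandwich (involutive_revSum Fin.rev_involutive) involutive_revSensor hQ
      (fbaData_conj X)
  have hZre : (Z.map Complex.re).map Complex.ofReal = Z := by
    ext i j
    have h := congrFun (congrFun hreal i) j
    simp only [Matrix.map_apply] at h ⊢
    exact Complex.conj_eq_iff_re.1 h
  have hgram : (Z.map Complex.re * (Z.map Complex.re)ᵀ).map Complex.ofReal = Z * Zᴴ := by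
    have h1 : (Z.map Complex.re * (Z.map Complex.re)ᵀ).map Complex.ofReal =
        (Z.map Complex.re).map Complex.ofReal * ((Z.map Complex.re).map Complex.ofReal)ᴴ := by
      ext i j; simp [Matrix.mul_apply]
    rw [h1, hZre]
  refine he.isTopEigenvector_of_real hQ.1 zero_le_one ?_
  rw [hgram, hZ, Matrix.conjTranspose_mul, Matrix.conjTranspose_mul,
    Matrix.conjTranspose_conjTranspose]
  calc fbaData X * (fbaData X)ᴴ = (Q * Qᴴ) * fbaData X * (V * Vᴴ) * (fbaData X)ᴴ * (Q * Qᴴ) := by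
        simp [hQQ, hVV]
    _ = _ := by simp only [Matrix.mul_assoc, Complex.ofReal_one, one_smul]

theorem unitary_model (hM : ∀ l, 1 ≤ M l) (hr : 2 ≤ M r) {μ : Fin R → ℝ}
    (hμ : μ r ∈ Set.Ioo (-π) π) :
    HasErrorExpansion (M := M) (N := N) r μ fun φ s₀ E μhat =>
      IsUnitary r (measurement μ (symbols φ s₀) E) μhat := by
  have hp : (0 : ℝ) < Fintype.card (SubSensor M r) := by
    exact_mod_cast card_subSensor_pos hM hr
  have hcont : Continuous fun E : Matrix (Sensor M) (Fin N) ℂ => fbaData E := by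
    refine continuous_matrix fun m t => ?_
    rcases t with t | t
    · simp only [fbaData_inl]; fun_prop
    · simp only [fbaData_inr]; fun_prop
  refine (hasErrorExpansion_of_model hμ (a := fun _ => steering M μ)
    (sym := fun φ s₀ => fbaSymbols M μ (symbols φ s₀)) (D := fun E => fbaData E) hcont
    (fun E => ?_)
    (isPhaseForm_averagedShiftForm (sel₁ M r) (sel₂ M r)) hp (one_le_prod_sensors hM)
    (fun _ => energy_steering μ) (fun _ => sel₂_mulVec_steering μ)
    (fun _ => energy_sel₁_steering μ) (fun _ _ => ?_) (fun E => (sum_norm_sq_fbaData E).le)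
    (fun φ s₀ h0 E => ?_)).mono ?_
  · ext m (t | t)
    · simp [fbaData_inl]
    · simp [fbaData_inr]
  · rw [energy_fbaSymbols]
    linarith [energy_nonneg (symbols ‹ℝ› ‹Fin N → ℝ›)]
  · rw [linearError_eq hr, fbaData_im_eq μ (energy_symbols_pos φ h0).ne']
  · rintro φ s₀ E μhat ⟨Q, Q', e, hQ, hQ', he, rfl⟩
    refine ⟨Q *ᵥ fun i => (e i : ℂ), ?_, ?_⟩
    · have := isTopEigenvector_fbaData hQ he
      rwa [fbaData_measurement] at this
    · congr 1
      refine arctan_leastSquares hQ'.1 (hQ.map_star_sandwich involutive_revSensor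
        involutive_revSubSensor hQ' ?_) e
      rw [sel₂_map_star, flip_sel]

/-! ### Augmentation for non-circular sources -/

/-- The augmented vector `[exp(jφ) x; Π (exp(jφ) x)^*]`. -/
noncomputable def augment (φ : ℝ) (x : Sensor M → ℂ) : Sensor M ⊕ Sensor M → ℂ :=
  Sum.elim (fun m => Complex.exp (Complex.I * φ) * x m)
    fun m => star (Complex.exp (Complex.I * φ) * x (revSensor M m))

theorem ncData_inl (E : Matrix (Sensor M) (Fin N) ℂ) (m : Sensor M) (t : Fin N) :
    ncData E (Sum.inl m) t = E m t := by
  rw [ncData, Matrix.fromRows_apply_inl]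

theorem ncData_inr (E : Matrix (Sensor M) (Fin N) ℂ) (m : Sensor M) (t : Fin N) :
    ncData E (Sum.inr m) t = star (E (revSensor M m) t) := by
  rw [ncData, Matrix.fromRows_apply_inr, exchange_mul_apply, Matrix.map_apply]

/-- The phase `φ` moves from the symbols into the augmented steering vector. Strict non-circularity
leaves real symbols, which conjugation fixes, and so the augmented signal part keeps rank one. -/
theorem ncData_measurement (μ : Fin R → ℝ) (φ : ℝ) (s₀ : Fin N → ℝ)
    (E : Matrix (Sensor M) (Fin N) ℂ) :
    ncData (measurement μ (symbols φ s₀) E) =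
      Matrix.vecMulVec (augment φ (steering M μ)) (fun t => (s₀ t : ℂ)) + ncData E := by
  ext (m | m) t
  · simp only [ncData_inl, measurement, symbols, augment, Matrix.vecMulVec_apply, Matrix.of_apply,
      Matrix.add_apply, Sum.elim_inl]
    ring
  · simp only [ncData_inr, measurement, symbols, augment, Matrix.vecMulVec_apply, Matrix.of_apply,
      Matrix.add_apply, Sum.elim_inr, star_add, star_mul']
    rw [Complex.star_def, Complex.conj_ofReal]
    ring

theorem energy_ofReal (φ : ℝ) (s₀ : Fin N → ℝ) :
    energy (fun t => (s₀ t : ℂ)) = energy (symbols φ s₀) := by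
  rw [energy_symbols]
  simp [energy]

theorem matchedNoise_ncData (φ : ℝ) (s₀ : Fin N → ℝ) (E : Matrix (Sensor M) (Fin N) ℂ) :
    matchedNoise (fun t => (s₀ t : ℂ)) (ncData E) =
      augment φ (matchedNoise (symbols φ s₀) E) := by
  have h : ∀ m, Complex.exp (Complex.I * φ) * matchedNoise (symbols φ s₀) E m =
      ((energy (symbols φ s₀) : ℝ) : ℂ)⁻¹ * ∑ t, E m t * (s₀ t : ℂ) := fun m => by
    have hstar : ∀ t, star (symbols φ s₀ t) = star (Complex.exp (Complex.I * φ)) * (s₀ t : ℂ) :=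
      fun t => by rw [symbols, star_mul', Complex.star_def, Complex.conj_ofReal]
    simp only [matchedNoise, Pi.smul_apply, Matrix.mulVec, dotProduct, smul_eq_mul,
      Pi.star_apply, hstar, Finset.mul_sum]
    refine Finset.sum_congr rfl fun t _ => ?_
    linear_combination (((energy (symbols φ s₀) : ℝ) : ℂ)⁻¹ * E m t * (s₀ t : ℂ)) *
      star_exp_mul_exp φ
  funext m
  rcases m with m | m
  · simp only [augment, Sum.elim_inl, h]
    simp [matchedNoise, Matrix.mulVec, dotProduct, ncData_inl, energy_ofReal φ]
  · simp only [augment, Sum.elim_inr, h]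
    simp [matchedNoise, Matrix.mulVec, dotProduct, ncData_inr, energy_ofReal φ]

theorem sum_norm_sq_ncData (E : Matrix (Sensor M) (Fin N) ℂ) :
    ∑ m, ∑ t, ‖ncData E m t‖ ^ 2 = 2 * noiseNorm E ^ 2 := by
  simp only [Fintype.sum_sum_type, ncData_inl, ncData_inr, norm_star]
  rw [sum_revSensor fun m => ∑ t, ‖E m t‖ ^ 2, noiseNorm_sq]
  ring

theorem star_phase_mul_dotProduct {ι : Type*} [Fintype ι] (φ : ℝ) (x y : ι → ℂ) :
    (star fun i => Complex.exp (Complex.I * φ) * x i) ⬝ᵥ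
      (fun i => Complex.exp (Complex.I * φ) * y i) = star x ⬝ᵥ y := by
  refine Finset.sum_congr rfl fun i _ => ?_
  simp only [Pi.star_apply, star_mul']
  linear_combination (star (x i) * y i) * star_exp_mul_exp φ

/-- The lower half is reversed and conjugated, so there the first selection reads off the second
subarray. -/
theorem ncSel₁_augment (φ : ℝ) (x : Sensor M → ℂ) :
    ncSel₁ M r *ᵥ augment φ x = Sum.elim
      (fun p => Complex.exp (Complex.I * φ) * (sel₁ M r *ᵥ x) p)
      fun p => star (Complex.exp (Complex.I * φ) * (sel₂ M r *ᵥ x) (revSubSensor M r p)) := by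
  rw [ncSel₁_eq, Matrix.fromBlocks_mulVec]
  simp only [Matrix.zero_mulVec, add_zero, zero_add, sel₁_mulVec, sel₂_mulVec]
  ext (p | p)
  · simp [augment]
  · simp [augment, revSensor_lower]

theorem ncSel₂_augment (φ : ℝ) (x : Sensor M → ℂ) :
    ncSel₂ M r *ᵥ augment φ x = Sum.elim
      (fun p => Complex.exp (Complex.I * φ) * (sel₂ M r *ᵥ x) p)
      fun p => star (Complex.exp (Complex.I * φ) * (sel₁ M r *ᵥ x) (revSubSensor M r p)) := by
  rw [ncSel₂_eq, Matrix.fromBlocks_mulVec]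
  simp only [Matrix.zero_mulVec, add_zero, zero_add, sel₁_mulVec, sel₂_mulVec]
  ext (p | p)
  · simp [augment]
  · simp [augment, revSensor_upper]

theorem dotProduct_augmented (φ : ℝ) (x₁ x₂ y₁ y₂ : SubSensor M r → ℂ) :
    star (Sum.elim (fun p => Complex.exp (Complex.I * φ) * x₁ p)
      fun p => star (Complex.exp (Complex.I * φ) * x₂ (revSubSensor M r p))) ⬝ᵥ
      (Sum.elim (fun p => Complex.exp (Complex.I * φ) * y₁ p)
        fun p => star (Complex.exp (Complex.I * φ) * y₂ (revSubSensor M r p))) =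
    star x₁ ⬝ᵥ y₁ + star (star x₂ ⬝ᵥ y₂) := by
  rw [dotProduct, Fintype.sum_sum_type]
  have hrev : ∀ p : SubSensor M r, revSubSensor M r (revSubSensor M r p) = p :=
    involutive_revSubSensor
  congr 1
  · exact star_phase_mul_dotProduct φ x₁ y₁
  · rw [← star_phase_mul_dotProduct φ x₂ y₂, dotProduct, star_sum,
      ← sum_revSubSensor (M := M) (r := r)]
    simp [hrev]

theorem ncSel₂_augment_steering (μ : Fin R → ℝ) (φ : ℝ) :
    ncSel₂ M r *ᵥ augment φ (steering M μ) =
      Complex.exp (Complex.I * (μ r : ℂ)) • (ncSel₁ M r *ᵥ augment φ (steering M μ)) := by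
  rw [ncSel₂_augment, ncSel₁_augment, sel₂_mulVec_steering]
  ext (p | p)
  · simp; ring
  · simp only [Sum.elim_inr, Pi.smul_apply, smul_eq_mul, star_mul']
    linear_combination (-(star (Complex.exp (Complex.I * φ)) *
      star ((sel₁ M r *ᵥ steering M μ) (revSubSensor M r p)))) * star_exp_mul_exp (μ r)

theorem energy_sel₂_steering (μ : Fin R → ℝ) :
    energy (sel₂ M r *ᵥ steering M μ) = Fintype.card (SubSensor M r) := by
  rw [sel₂_mulVec]
  simp [energy, norm_steering]

theorem energy_ncSel₁_augment (μ : Fin R → ℝ) (φ : ℝ) :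
    energy (ncSel₁ M r *ᵥ augment φ (steering M μ)) = 2 * Fintype.card (SubSensor M r) := by
  have h := dotProduct_augmented (r := r) φ (sel₁ M r *ᵥ steering M μ) (sel₂ M r *ᵥ steering M μ)
    (sel₁ M r *ᵥ steering M μ) (sel₂ M r *ᵥ steering M μ)
  rw [← ncSel₁_augment, star_dotProduct_self, star_dotProduct_self, star_dotProduct_self,
    energy_sel₁_steering, energy_sel₂_steering, Complex.star_def, Complex.conj_ofReal,
    ← two_mul] at h
  exact_mod_cast h

theorem energy_augment_steering (μ : Fin R → ℝ) (φ : ℝ) :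
    energy (augment φ (steering M μ)) = 2 * ∏ l, (M l : ℝ) := by
  have h : ‖Complex.exp (Complex.I * (φ : ℂ))‖ = 1 := by
    rw [Complex.norm_exp]; simp
  simp [energy, augment, h, norm_steering, two_mul]

/-- The augmented data and selection matrices yield the common error expansion, whichever of the
two phase forms is used. -/
theorem nc_model (hM : ∀ l, 1 ≤ M l) (hr : 2 ≤ M r) {μ : Fin R → ℝ}
    (hμ : μ r ∈ Set.Ioo (-π) π) {κ : ℝ} {T : Matrix (Sensor M ⊕ Sensor M) (Sensor M ⊕ Sensor M) ℂ}
    (hT : IsPhaseForm (ncSel₁ M r) (ncSel₂ M r) κ T) :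
    HasErrorExpansion (M := M) (N := N) r μ fun φ s₀ E μhat =>
      ∃ u, IsTopEigenvector (ncData (measurement μ (symbols φ s₀) E) *
        (ncData (measurement μ (symbols φ s₀) E))ᴴ) u ∧ μhat = κ * (sesq T u u).arg := by
  have hp : (0 : ℝ) < 2 * Fintype.card (SubSensor M r) :=
    mul_pos two_pos (by exact_mod_cast card_subSensor_pos hM hr)
  have hcont : Continuous fun E : Matrix (Sensor M) (Fin N) ℂ => ncData E := by
    refine continuous_matrix fun m t => ?_
    rcases m with m | m
    · simp only [ncData_inl]; fun_prop
    · simp only [ncData_inr]; fun_prop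
  have hA : (1 : ℝ) ≤ 2 * ∏ l, (M l : ℝ) := by linarith [one_le_prod_sensors hM]
  refine (hasErrorExpansion_of_model hμ (a := fun φ => augment φ (steering M μ))
    (sym := fun _ s₀ t => (s₀ t : ℂ)) (D := fun E => ncData E) hcont (fun E => ?_) hT hp hA
    (fun φ => energy_augment_steering μ φ) (fun φ => ncSel₂_augment_steering μ φ)
    (fun φ => energy_ncSel₁_augment μ φ) (fun φ s₀ => (energy_ofReal φ s₀).ge)
    (fun E => (sum_norm_sq_ncData E).le) (fun φ s₀ h0 E => ?_)).mono ?_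
  · ext (m | m) t
    · simp [ncData_inl]
    · simp [ncData_inr]
  -- With `x`, `y` the inner products over the original subarrays, the augmented ones are `x + ȳ`
  -- and `y + x̄`. The imaginary part of their difference doubles, and so does the energy it is
  -- divided by.
  · rw [linearError_eq hr, matchedNoise_ncData φ, ncSel₁_augment, ncSel₁_augment, ncSel₂_augment,
      ncSel₂_augment, dotProduct_augmented, dotProduct_augmented, mul_comm (2 : ℝ), ← div_div,
      div_right_comm]
    congr 1
    simp only [Complex.sub_im, Complex.add_im, Complex.star_def, Complex.conj_im]
    ring
  · rintro φ s₀ E μhat ⟨u, hu, rfl⟩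
    rw [ncData_measurement] at hu
    exact ⟨u, hu, rfl⟩

/-- Up to `√2`, the stacked real and imaginary parts are the augmented data in the coordinates of
`evenLeftPiReal`, so both NC methods use the same dominant eigenspace. -/
theorem evenLeftPiReal_mul_fromRows (X : Matrix (Sensor M) (Fin N) ℂ) :
    ((√2 : ℝ) : ℂ) • (evenLeftPiReal (revSensor M) *
      (Matrix.fromRows (X.map Complex.re) (X.map Complex.im)).map Complex.ofReal) = ncData X := by
  have h2 : ((√2 : ℝ) : ℂ) * ((1 / √2 : ℝ) : ℂ) = 1 := by
    rw [← Complex.ofReal_mul, mul_one_div_cancel (by positivity), Complex.ofReal_one]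
  have h3 : (Matrix.fromRows (X.map Complex.re) (X.map Complex.im)).map Complex.ofReal =
      Matrix.fromRows ((X.map Complex.re).map Complex.ofReal)
        ((X.map Complex.im).map Complex.ofReal) := by
    ext (i | i) j <;> simp
  rw [evenLeftPiReal, Matrix.smul_mul, smul_smul, h2, one_smul, h3, Matrix.fromBlocks_mul_fromRows]
  ext (m | m) t
  · simp [ncData_inl, mul_comm Complex.I, Complex.re_add_im]
  · simp only [Matrix.fromRows_apply_inr, Matrix.add_apply, Matrix.neg_mul, Matrix.neg_apply,
      Matrix.smul_mul, Matrix.smul_apply, exchange_mul_apply, Matrix.map_apply, ncData_inr]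
    apply Complex.ext <;> simp

theorem ncUnitary_isTopEigenvector {X : Matrix (Sensor M) (Fin N) ℂ}
    {e : Sensor M ⊕ Sensor M → ℝ} (he : IsDominantLeftSingularVector
      (Matrix.fromRows (X.map Complex.re) (X.map Complex.im)) e) :
    IsTopEigenvector (ncData X * (ncData X)ᴴ)
      (evenLeftPiReal (revSensor M) *ᵥ fun i => (e i : ℂ)) := by
  have hQ := isUnitaryLeftPiReal_evenLeftPiReal (involutive_revSensor (M := M))
  refine he.isTopEigenvector_of_real hQ.1 zero_le_two ?_
  set F := Matrix.fromRows (X.map Complex.re) (X.map Complex.im) with hF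
  have h1 : (F * Fᵀ).map Complex.ofReal = F.map Complex.ofReal * (F.map Complex.ofReal)ᴴ := by
    ext i j; simp [Matrix.mul_apply]
  have h2 : ((√2 : ℝ) : ℂ) * ((√2 : ℝ) : ℂ) = ((2 : ℝ) : ℂ) := by
    rw [← Complex.ofReal_mul, Real.mul_self_sqrt zero_le_two]
  rw [← evenLeftPiReal_mul_fromRows, h1, Matrix.conjTranspose_smul, Complex.star_def,
    Complex.conj_ofReal, Matrix.smul_mul, Matrix.mul_smul, smul_smul, h2,
    Matrix.conjTranspose_mul]
  simp only [Matrix.mul_assoc]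
  rfl

theorem ncRealSel_map_star (M : Fin R → ℕ) (r : Fin R) :
    (ncRealSel M r).map star =
      (evenLeftPiReal (revSubSensor M r))ᴴ * ncSel₁ M r * evenLeftPiReal (revSensor M) := by
  refine (isUnitaryLeftPiReal_evenLeftPiReal involutive_revSensor).map_star_sandwich
    (involutive_revSum involutive_revSensor) (involutive_revSum involutive_revSubSensor)
    (isUnitaryLeftPiReal_evenLeftPiReal involutive_revSubSensor) ?_
  have h1 : (ncSel₂ M r).map star = Matrix.fromBlocks (sel₂ M r) 0 0 (sel₂ M r) := by
    rw [ncSel₂_eq, Matrix.fromBlocks_map, sel₂_map_star]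
    congr 1 <;> ext <;> simp
  rw [h1, exchange_revSum, exchange_revSum, Matrix.fromBlocks_multiply, Matrix.fromBlocks_multiply,
    ncSel₁_eq]
  simp [flip_sel]

theorem hasErrorExpansion (hM : ∀ l, 1 ≤ M l) (hr : 2 ≤ M r) {μ : Fin R → ℝ}
    (hμ : μ r ∈ Set.Ioo (-π) π) (method : Method) :
    HasErrorExpansion (M := M) (N := N) r μ fun φ s₀ E μhat =>
      IsEstimate method r (measurement μ (symbols φ s₀) E) μhat := by
  cases method with
  | ncStandard =>
    refine (nc_model hM hr hμ (isPhaseForm_shiftForm _ _)).mono ?_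
    rintro φ s₀ E μhat ⟨u, hu, rfl⟩
    exact ⟨u, hu.isTopEigenvector, by rw [arg_leastSquares, sesq_shiftForm, one_mul]⟩
  | ncUnitary =>
    refine (nc_model hM hr hμ (isPhaseForm_averagedShiftForm _ _)).mono ?_
    rintro φ s₀ E μhat ⟨e, he, rfl⟩
    refine ⟨_, ncUnitary_isTopEigenvector he, ?_⟩
    congr 1
    exact arctan_leastSquares
      (isUnitaryLeftPiReal_evenLeftPiReal involutive_revSubSensor).1 (ncRealSel_map_star M r) e
  | standard => exact standard_model hM hr hμ
  | unitary => exact unitary_model hM hr hμ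

/-- This a priori bound controls the error at large noise, where the expansion says nothing. -/
theorem abs_estimate_le {method : Method} {X : Matrix (Sensor M) (Fin N) ℂ} {μhat : ℝ}
    (h : IsEstimate method r X μhat) : |μhat| ≤ π := by
  have harctan : ∀ x, |2 * Real.arctan x| ≤ π := fun x => by
    have h1 := Real.neg_pi_div_two_lt_arctan x
    have h2 := Real.arctan_lt_pi_div_two x
    rw [abs_le]
    constructor <;> linarith
  cases method with
  | ncStandard => obtain ⟨u, -, rfl⟩ := h; exact Complex.abs_arg_le_pi _
  | ncUnitary => obtain ⟨e, -, rfl⟩ := h; exact harctan _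
  | standard => obtain ⟨u, -, rfl⟩ := h; exact Complex.abs_arg_le_pi _
  | unitary => obtain ⟨Q, Q', e, -, -, -, rfl⟩ := h; exact harctan _

end Methods

/-! ### Mean square of the linear error -/

/-- Since `(Im z)² = (|z|² - Re z²) / 2`, the vanishing pseudo-covariance removes the second term
and whiteness the off-diagonal part of the first. -/
theorem integral_im_sum_sq {Ω α : Type*} [MeasurableSpace Ω] [Fintype α] [DecidableEq α]
    {P : Measure Ω} {V : Ω → α → ℂ} {σ : ℝ} (hV : ∀ p, MemLp (fun ω => V ω p) 2 P)
    (hcov : ∀ p q, ∫ ω, V ω p * star (V ω q) ∂P = if p = q then ((σ ^ 2 : ℝ) : ℂ) else 0)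
    (hpseudo : ∀ p q, ∫ ω, V ω p * V ω q ∂P = 0) (c : α → ℂ) :
    Integrable (fun ω => (∑ p, c p * V ω p).im ^ 2) P ∧
      ∫ ω, (∑ p, c p * V ω p).im ^ 2 ∂P = σ ^ 2 / 2 * ∑ p, ‖c p‖ ^ 2 := by
  have hstar : ∀ q, MemLp (fun ω => star (V ω q)) 2 P := fun q => (hV q).star
  have i1 : ∀ p q, Integrable (fun ω => V ω p * star (V ω q)) P := fun p q =>
    (hV p).integrable_mul (hstar q)
  have i2 : ∀ p q, Integrable (fun ω => V ω p * V ω q) P := fun p q =>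
    (hV p).integrable_mul (hV q)
  have e1 : ∀ ω, (∑ p, c p * V ω p) * star (∑ p, c p * V ω p) =
      ∑ p, ∑ q, c p * star (c q) * (V ω p * star (V ω q)) := fun ω => by
    rw [star_sum, Finset.sum_mul_sum]
    refine Finset.sum_congr rfl fun p _ => Finset.sum_congr rfl fun q _ => ?_
    rw [star_mul']; ring
  have e2 : ∀ ω, (∑ p, c p * V ω p) * (∑ p, c p * V ω p) =
      ∑ p, ∑ q, c p * c q * (V ω p * V ω q) := fun ω => by
    rw [Finset.sum_mul_sum]
    refine Finset.sum_congr rfl fun p _ => Finset.sum_congr rfl fun q _ => ?_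
    ring
  have j1 : Integrable (fun ω => (∑ p, c p * V ω p) * star (∑ p, c p * V ω p)) P := by
    simp only [e1]
    exact integrable_finsetSum _ fun p _ => integrable_finsetSum _ fun q _ =>
      (i1 p q).const_mul _
  have j2 : Integrable (fun ω => (∑ p, c p * V ω p) * (∑ p, c p * V ω p)) P := by
    simp only [e2]
    exact integrable_finsetSum _ fun p _ => integrable_finsetSum _ fun q _ =>
      (i2 p q).const_mul _
  have s1 : ∫ ω, (∑ p, c p * V ω p) * star (∑ p, c p * V ω p) ∂P =
      ((σ ^ 2 * ∑ p, ‖c p‖ ^ 2 : ℝ) : ℂ) := by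
    simp only [e1]
    rw [integral_finsetSum _ fun p _ => integrable_finsetSum _ fun q _ => (i1 p q).const_mul _]
    have : ∀ p, ∫ ω, ∑ q, c p * star (c q) * (V ω p * star (V ω q)) ∂P =
        ((σ ^ 2 * ‖c p‖ ^ 2 : ℝ) : ℂ) := fun p => by
      rw [integral_finsetSum _ fun q _ => (i1 p q).const_mul _]
      simp only [integral_const_mul, hcov, mul_ite, mul_zero, Finset.sum_ite_eq,
        Finset.mem_univ, if_true]
      rw [Complex.star_def, Complex.mul_conj, Complex.normSq_eq_norm_sq]
      push_cast; ring
    simp only [this, Finset.mul_sum, Complex.ofReal_sum]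
  have s2 : ∫ ω, (∑ p, c p * V ω p) * (∑ p, c p * V ω p) ∂P = 0 := by
    simp only [e2]
    rw [integral_finsetSum _ fun p _ => integrable_finsetSum _ fun q _ => (i2 p q).const_mul _]
    refine Finset.sum_eq_zero fun p _ => ?_
    rw [integral_finsetSum _ fun q _ => (i2 p q).const_mul _]
    refine Finset.sum_eq_zero fun q _ => ?_
    rw [integral_const_mul, hpseudo, mul_zero]
  have him : ∀ z : ℂ, z.im ^ 2 = ((1 / 2 : ℂ) * (z * star z - z * z)).re := fun z => by
    rw [show (1 / 2 : ℂ) = ((1 / 2 : ℝ) : ℂ) by norm_num, Complex.re_ofReal_mul]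
    simp
    ring
  have hI := (j1.sub j2).const_mul (1 / 2 : ℂ)
  simp only [him]
  refine ⟨hI.re, ?_⟩
  have h := integral_re hI
  simp only [Pi.sub_apply, RCLike.re_to_complex] at h
  rw [h, integral_const_mul, integral_sub j1 j2, s1, s2, sub_zero,
    show (1 / 2 : ℂ) = ((1 / 2 : ℝ) : ℂ) by norm_num, Complex.re_ofReal_mul, Complex.ofReal_re]
  ring

section MeanSquare

variable {R N : ℕ} {M : Fin R → ℕ} {r : Fin R}

/-- There are `2 M / M_r` edge sensors of weight `±1`, against the squared subarray size `((M_r - 1)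
M / M_r)²` in the normalization. -/
theorem sum_norm_sq_errorCoeff (hM : ∀ l, 1 ≤ M l) (hr : 2 ≤ M r) (μ : Fin R → ℝ)
    {s : Fin N → ℂ} (hs : 0 < energy s) :
    ∑ p : Sensor M × Fin N, ‖errorCoeff r μ s p.1 p.2‖ ^ 2 =
      2 / energy s * ((M r : ℝ) / ((∏ l, (M l : ℝ)) * ((M r : ℝ) - 1) ^ 2)) := by
  have h1 : ∀ m t, ‖errorCoeff r μ s m t‖ ^ 2 =
      edgeWeight M r m ^ 2 * (‖s t‖ ^ 2 / (energy s * Fintype.card (SubSensor M r)) ^ 2) := by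
    intro m t
    rw [errorCoeff, norm_mul, norm_mul, norm_star, norm_star, norm_steering, one_mul, mul_pow,
      Complex.norm_real, Real.norm_eq_abs, sq_abs]
    ring
  simp only [Fintype.sum_prod_type, h1, ← Finset.sum_mul_sum]
  rw [sum_edgeWeight_sq hr, ← Finset.sum_div]
  change _ * (energy s / _) = _
  rw [card_subSensor, Fintype.prod_eq_mul_prod_subtype_ne (fun l => (M l : ℝ)) r]
  push_cast [Nat.cast_sub (show 1 ≤ M r by omega)]
  have hQ : (0 : ℝ) < ∏ l : {l : Fin R // l ≠ r}, (M l : ℝ) :=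
    Finset.prod_pos fun l _ => by exact_mod_cast hM l
  have hr0 : (0 : ℝ) < M r := by exact_mod_cast (show 0 < M r by omega)
  have hr1 : (M r : ℝ) - 1 ≠ 0 := by
    have : (2 : ℝ) ≤ M r := by exact_mod_cast hr
    linarith
  field_simp

theorem effectiveSNR_eq (s : Fin N → ℂ) (σ : ℝ) : effectiveSNR s σ = energy s / σ ^ 2 := by
  rw [effectiveSNR, empiricalPower]
  rcases Nat.eq_zero_or_pos N with h | h
  · subst h; simp [energy]
  · have : (N : ℝ) ≠ 0 := by positivity
    rw [mul_div_cancel₀ _ this]; rfl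

theorem linearError_mean_sq (hM : ∀ l, 1 ≤ M l) (hr : 2 ≤ M r) (μ : Fin R → ℝ)
    {s : Fin N → ℂ} (hs : 0 < energy s) {Ω : Type*} [MeasurableSpace Ω] {P : Measure Ω}
    {W : Ω → Matrix (Sensor M) (Fin N) ℂ} {σ : ℝ} (hW : IsCircularWhite P W σ) :
    Integrable (fun ω => linearError r μ s (W ω) ^ 2) P ∧
      ∫ ω, linearError r μ s (W ω) ^ 2 ∂P = asymptoticMSE M r (effectiveSNR s σ) := by
  have h := integral_im_sum_sq (V := fun ω (p : Sensor M × Fin N) => W ω p.1 p.2) (σ := σ)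
    (fun p => hW.memLp p.1 p.2)
    (fun p q => by simpa only [Prod.ext_iff] using hW.cov p.1 p.2 q.1 q.2)
    (fun p q => hW.pseudoCov p.1 p.2 q.1 q.2) fun p => errorCoeff r μ s p.1 p.2
  have hL : ∀ E : Matrix (Sensor M) (Fin N) ℂ, linearError r μ s E =
      (∑ p : Sensor M × Fin N, errorCoeff r μ s p.1 p.2 * E p.1 p.2).im := fun E => by
    rw [Fintype.sum_prod_type]; rfl
  simp only [hL]
  refine ⟨h.1, h.2.trans ?_⟩
  rw [sum_norm_sq_errorCoeff hM hr μ hs, asymptoticMSE, effectiveSNR_eq]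
  field_simp

/-! ### Mean square error of the estimates -/

theorem IsCircularWhite.aemeasurable {Ω : Type*} [MeasurableSpace Ω] {P : Measure Ω}
    {W : Ω → Matrix (Sensor M) (Fin N) ℂ} {σ : ℝ} (hW : IsCircularWhite P W σ) :
    AEMeasurable (fun ω (p : Sensor M × Fin N) => W ω p.1 p.2) P :=
  aemeasurable_pi_iff.2 fun p => (hW.memLp p.1 p.2).aestronglyMeasurable.aemeasurable

theorem IsCircularWhite.aestronglyMeasurable_comp {Ω : Type*} [MeasurableSpace Ω] {P : Measure Ω}
    {W : Ω → Matrix (Sensor M) (Fin N) ℂ} {σ : ℝ} (hW : IsCircularWhite P W σ)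
    {f : Matrix (Sensor M) (Fin N) ℂ → ℝ} (hf : Continuous f) :
    AEStronglyMeasurable (fun ω => f (W ω)) P := by
  have hc : Continuous fun V : Sensor M × Fin N → ℂ => f (Matrix.of fun m t => V (m, t)) :=
    hf.comp (continuous_matrix fun m t => continuous_apply _)
  exact (hc.measurable.comp_aemeasurable hW.aemeasurable).aestronglyMeasurable

theorem continuous_linearError (μ : Fin R → ℝ) (s : Fin N → ℂ) :
    Continuous fun E : Matrix (Sensor M) (Fin N) ℂ => linearError r μ s E := by
  change Continuous fun E : Matrix (Sensor M) (Fin N) ℂ =>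
    (∑ m, ∑ t, errorCoeff r μ s m t * E m t).im
  fun_prop

theorem continuous_noiseNorm : Continuous fun E : Matrix (Sensor M) (Fin N) ℂ => noiseNorm E := by
  unfold noiseNorm; fun_prop

theorem noiseNorm_nonneg (E : Matrix (Sensor M) (Fin N) ℂ) : 0 ≤ noiseNorm E := Real.sqrt_nonneg _

theorem noiseNorm_smul {σ : ℝ} (hσ : 0 ≤ σ) (E : Matrix (Sensor M) (Fin N) ℂ) :
    noiseNorm (σ • E) = σ * noiseNorm E := by
  rw [noiseNorm, noiseNorm, ← Real.sqrt_sq hσ, ← Real.sqrt_mul (sq_nonneg _), Real.sqrt_sq hσ,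
    Finset.mul_sum]
  congr 1
  refine Finset.sum_congr rfl fun m _ => ?_
  rw [Finset.mul_sum]
  refine Finset.sum_congr rfl fun t _ => ?_
  rw [Matrix.smul_apply, norm_smul, Real.norm_eq_abs, mul_pow, sq_abs]

theorem IsCircularWhite.integrable_noiseNorm_sq {Ω : Type*} [MeasurableSpace Ω] {P : Measure Ω}
    {W : Ω → Matrix (Sensor M) (Fin N) ℂ} {σ : ℝ} (hW : IsCircularWhite P W σ) :
    Integrable (fun ω => noiseNorm (W ω) ^ 2) P := by
  simp only [noiseNorm_sq]
  exact integrable_finsetSum _ fun m _ => integrable_finsetSum _ fun t _ =>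
    (hW.memLp m t).integrable_norm_pow two_ne_zero

theorem IsCircularWhite.smul {Ω : Type*} [MeasurableSpace Ω] {P : Measure Ω}
    {W : Ω → Matrix (Sensor M) (Fin N) ℂ} (hW : IsCircularWhite P W 1) (σ : ℝ) :
    IsCircularWhite P (fun ω => σ • W ω) σ where
  memLp i t := (hW.memLp i t).const_smul σ
  mean i t := by
    simp only [Matrix.smul_apply]
    rw [integral_smul, hW.mean, smul_zero]
  cov i t j u := by
    have h : ∀ ω, (σ • W ω) i t * star ((σ • W ω) j u) =
        ((σ ^ 2 : ℝ) : ℂ) * (W ω i t * star (W ω j u)) := fun ω => by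
      simp only [Matrix.smul_apply, Complex.real_smul, star_mul', Complex.star_def,
        Complex.conj_ofReal]
      push_cast; ring
    simp only [h, integral_const_mul, hW.cov]
    split_ifs <;> simp
  pseudoCov i t j u := by
    have h : ∀ ω, (σ • W ω) i t * (σ • W ω) j u =
        ((σ ^ 2 : ℝ) : ℂ) * (W ω i t * W ω j u) := fun ω => by
      simp only [Matrix.smul_apply, Complex.real_smul]
      push_cast; ring
    simp only [h, integral_const_mul, hW.pseudoCov, mul_zero]

/-- For `x ≤ δ` the expansion gives third order; for `x > δ` the bound `B` is absorbed through `B² ≤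
(B² / δ²) x²`. With `min 1 x` in place of `x`, second moments suffice for integrability. -/
theorem abs_sq_sub_sq_le {C δ x X L q B : ℝ} (hC : 0 < C) (hδ : 0 < δ) (hδ1 : δ ≤ 1)
    (hx : 0 ≤ x) (hX : |X| ≤ B) (hL : |L| ≤ C * x) (hq : |q| ≤ C * x ^ 2)
    (hR : x ≤ δ → |X - L - q| ≤ C * x ^ 3) :
    |X ^ 2 - L ^ 2| ≤ (8 * C ^ 2 + (B ^ 2 / δ ^ 2 + C ^ 2) / δ) * (x ^ 2 * min 1 x) := by
  rcases le_or_gt x δ with h | h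
  · have hx1 : x ≤ 1 := h.trans hδ1
    have h3 : x ^ 3 ≤ x ^ 2 := pow_le_pow_of_le_one hx hx1 (by norm_num)
    have h2 : x ^ 2 ≤ x := by nlinarith
    have hXL : |X - L| ≤ 2 * C * x ^ 2 := by
      have := abs_add_le (X - L - q) q
      rw [sub_add_cancel] at this
      have := hR h
      nlinarith
    have hXL' : |X + L| ≤ 4 * C * x := by
      have h4 : X + L = (X - L) + 2 * L := by ring
      have h5 := abs_add_le (X - L) (2 * L)
      rw [← h4, abs_mul, abs_two] at h5
      nlinarith
    rw [min_eq_right hx1]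
    calc |X ^ 2 - L ^ 2| = |X - L| * |X + L| := by rw [← abs_mul]; congr 1; ring
      _ ≤ (2 * C * x ^ 2) * (4 * C * x) := by gcongr
      _ = 8 * C ^ 2 * (x ^ 2 * x) := by ring
      _ ≤ _ := by
        gcongr
        have : 0 ≤ (B ^ 2 / δ ^ 2 + C ^ 2) / δ := by positivity
        linarith
  · have hmin : δ ≤ min 1 x := le_min hδ1 h.le
    have h1 : |X ^ 2 - L ^ 2| ≤ B ^ 2 + (C * x) ^ 2 := by
      refine (abs_sub _ _).trans ?_
      rw [abs_pow, abs_pow]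
      gcongr
    have h2 : B ^ 2 ≤ B ^ 2 / δ ^ 2 * x ^ 2 := by
      rw [div_mul_eq_mul_div, le_div_iff₀ (by positivity)]
      gcongr
    calc |X ^ 2 - L ^ 2| ≤ B ^ 2 / δ ^ 2 * x ^ 2 + (C * x) ^ 2 := by linarith
      _ = (B ^ 2 / δ ^ 2 + C ^ 2) / δ * (x ^ 2 * δ) := by field_simp
      _ ≤ (B ^ 2 / δ ^ 2 + C ^ 2) / δ * (x ^ 2 * min 1 x) := by gcongr
      _ ≤ _ := by
        gcongr
        have : 0 ≤ 8 * C ^ 2 := by positivity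
        linarith

/-- The cross term `2 * (L * q)` is the only contribution of third order. For `x > δ` lower powers
of `x` are raised to the fourth at the cost of powers of `δ⁻¹`. -/
theorem abs_sq_sub_sq_sub_le {C δ x X L q B : ℝ} (hC : 0 < C) (hδ : 0 < δ) (hδ1 : δ ≤ 1)
    (hx : 0 ≤ x) (hX : |X| ≤ B) (hL : |L| ≤ C * x) (hq : |q| ≤ C * x ^ 2)
    (hR : x ≤ δ → |X - L - q| ≤ C * x ^ 3) :
    |X ^ 2 - L ^ 2 - 2 * (L * q)| ≤
      (6 * C ^ 2 + (B ^ 2 / δ ^ 4 + C ^ 2 / δ ^ 2 + 2 * C ^ 2 / δ)) * x ^ 4 := by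
  rcases le_or_gt x δ with h | h
  · have hx1 : x ≤ 1 := h.trans hδ1
    set ρ := X - L - q with hρ
    have h3 := hR h
    have e : X ^ 2 - L ^ 2 - 2 * (L * q) = q ^ 2 + ρ ^ 2 + 2 * (L * ρ) + 2 * (q * ρ) := by
      rw [hρ]; ring
    have b1 : |q ^ 2| ≤ C ^ 2 * x ^ 4 := by
      rw [abs_pow]
      calc |q| ^ 2 ≤ (C * x ^ 2) ^ 2 := by gcongr
        _ = _ := by ring
    have b2 : |ρ ^ 2| ≤ C ^ 2 * x ^ 4 := by
      rw [abs_pow]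
      calc |ρ| ^ 2 ≤ (C * x ^ 3) ^ 2 := by gcongr
        _ = C ^ 2 * x ^ 6 := by ring
        _ ≤ _ := by gcongr C ^ 2 * ?_; exact pow_le_pow_of_le_one hx hx1 (by norm_num)
    have b3 : |2 * (L * ρ)| ≤ 2 * C ^ 2 * x ^ 4 := by
      rw [abs_mul, abs_mul, abs_two]
      calc 2 * (|L| * |ρ|) ≤ 2 * ((C * x) * (C * x ^ 3)) := by gcongr
        _ = _ := by ring
    have b4 : |2 * (q * ρ)| ≤ 2 * C ^ 2 * x ^ 4 := by
      rw [abs_mul, abs_mul, abs_two]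
      calc 2 * (|q| * |ρ|) ≤ 2 * ((C * x ^ 2) * (C * x ^ 3)) := by gcongr
        _ = 2 * C ^ 2 * x ^ 5 := by ring
        _ ≤ _ := by gcongr 2 * C ^ 2 * ?_; exact pow_le_pow_of_le_one hx hx1 (by norm_num)
    rw [e]
    have b5 := (abs_add_le (q ^ 2 + ρ ^ 2 + 2 * (L * ρ)) (2 * (q * ρ)))
    have b6 := (abs_add_le (q ^ 2 + ρ ^ 2) (2 * (L * ρ)))
    have b7 := (abs_add_le (q ^ 2) (ρ ^ 2))
    have b8 : 0 ≤ (B ^ 2 / δ ^ 4 + C ^ 2 / δ ^ 2 + 2 * C ^ 2 / δ) * x ^ 4 := by positivity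
    linarith
  · have hX2 : |X ^ 2| ≤ B ^ 2 / δ ^ 4 * x ^ 4 := by
      rw [abs_pow]
      calc |X| ^ 2 ≤ B ^ 2 := by gcongr
        _ ≤ _ := by
          rw [div_mul_eq_mul_div, le_div_iff₀ (by positivity)]
          gcongr
    have hL2 : |L ^ 2| ≤ C ^ 2 / δ ^ 2 * x ^ 4 := by
      rw [abs_pow]
      calc |L| ^ 2 ≤ (C * x) ^ 2 := by gcongr
        _ = C ^ 2 * x ^ 2 := by ring
        _ ≤ _ := by
          rw [div_mul_eq_mul_div, le_div_iff₀ (by positivity)]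
          calc C ^ 2 * x ^ 2 * δ ^ 2 ≤ C ^ 2 * x ^ 2 * x ^ 2 := by gcongr
            _ = _ := by ring
    have hLq : |2 * (L * q)| ≤ 2 * C ^ 2 / δ * x ^ 4 := by
      rw [abs_mul, abs_mul, abs_two]
      calc 2 * (|L| * |q|) ≤ 2 * ((C * x) * (C * x ^ 2)) := by gcongr
        _ = 2 * C ^ 2 * x ^ 3 := by ring
        _ ≤ _ := by
          rw [div_mul_eq_mul_div, le_div_iff₀ (by positivity)]
          calc 2 * C ^ 2 * x ^ 3 * δ ≤ 2 * C ^ 2 * x ^ 3 * x := by gcongr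
            _ = _ := by ring
    have b1 := abs_sub (X ^ 2 - L ^ 2) (2 * (L * q))
    have b2 := abs_sub (X ^ 2) (L ^ 2)
    have b3 : 0 ≤ 6 * C ^ 2 * x ^ 4 := by positivity
    linarith

theorem abs_integral_sub_le {Ω : Type*} [MeasurableSpace Ω] {P : Measure Ω} {f g h : Ω → ℝ}
    (hf : Integrable f P) (hg : Integrable g P) (hh : Integrable h P)
    (hb : ∀ᵐ ω ∂P, |f ω - g ω| ≤ h ω) :
    |∫ ω, f ω ∂P - ∫ ω, g ω ∂P| ≤ ∫ ω, h ω ∂P := by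
  rw [← integral_sub hf hg, ← Real.norm_eq_abs]
  exact norm_integral_le_of_norm_le hh hb

theorem integrable_estimate_error_sq {Ω : Type*} [MeasurableSpace Ω] {P : Measure Ω}
    [IsProbabilityMeasure P] {μ : Fin R → ℝ} (hμ : μ r ∈ Set.Ioo (-π) π) {method : Method}
    {X : Ω → Matrix (Sensor M) (Fin N) ℂ} {μhat : Ω → ℝ} (hm : AEMeasurable μhat P)
    (hest : ∀ᵐ ω ∂P, IsEstimate method r (X ω) (μhat ω)) :
    (∀ᵐ ω ∂P, |μhat ω - μ r| ≤ 2 * π) ∧ Integrable (fun ω => (μhat ω - μ r) ^ 2) P := by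
  have hb : ∀ᵐ ω ∂P, |μhat ω - μ r| ≤ 2 * π := by
    filter_upwards [hest] with ω hω
    have h1 := abs_estimate_le hω
    have h2 : |μ r| ≤ π := abs_le.2 ⟨hμ.1.le, hμ.2.le⟩
    exact (abs_sub _ _).trans (by linarith)
  refine ⟨hb, Integrable.of_bound ((hm.sub_const _).pow_const 2).aestronglyMeasurable
    ((2 * π) ^ 2) ?_⟩
  filter_upwards [hb] with ω hω
  rw [norm_pow, Real.norm_eq_abs]
  gcongr

/-- Dominated convergence with majorant `f ^ 2`; this yields `o(1/ρ)` without a rate when no higher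
moments exist. -/
theorem tendsto_truncated_second_moment {Ω : Type*} [MeasurableSpace Ω] {P : Measure Ω}
    {f : Ω → ℝ} (hf0 : ∀ ω, 0 ≤ f ω) (hfm : AEStronglyMeasurable f P)
    (hf : Integrable (fun ω => f ω ^ 2) P) :
    Tendsto (fun ρ : ℝ => ∫ ω, f ω ^ 2 * min 1 (f ω / √ρ) ∂P) atTop (𝓝 0) := by
  have h := tendsto_integral_filter_of_dominated_convergence (μ := P) (l := atTop)
    (F := fun (ρ : ℝ) ω => f ω ^ 2 * min 1 (f ω / √ρ)) (f := fun _ => 0)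
    (fun ω => f ω ^ 2) ?_ ?_ hf ?_
  · simpa using h
  · refine Eventually.of_forall fun ρ => ?_
    have := ((aemeasurable_const (b := (1 : ℝ))).min (hfm.aemeasurable.div_const √ρ))
    exact ((hfm.aemeasurable.pow_const 2).mul this).aestronglyMeasurable
  · refine Eventually.of_forall fun ρ => Eventually.of_forall fun ω => ?_
    have h1 : 0 ≤ min 1 (f ω / √ρ) := le_min zero_le_one (div_nonneg (hf0 ω) (Real.sqrt_nonneg _))
    rw [Real.norm_eq_abs, abs_of_nonneg (mul_nonneg (sq_nonneg _) h1)]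
    exact mul_le_of_le_one_right (sq_nonneg _) (min_le_left _ _)
  · refine Eventually.of_forall fun ω => ?_
    have h1 : Tendsto (fun ρ : ℝ => f ω / √ρ) atTop (𝓝 0) :=
      Real.tendsto_sqrt_atTop.const_div_atTop _
    have h2 : Tendsto (fun ρ : ℝ => min 1 (f ω / √ρ)) atTop (𝓝 (min 1 0)) :=
      tendsto_const_nhds.min h1
    have := h2.const_mul (f ω ^ 2)
    simpa using this

theorem energy_pos_of_effectiveSNR_pos {s : Fin N → ℂ} {σ : ℝ} (h : 0 < effectiveSNR s σ) :
    0 < energy s := by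
  rw [effectiveSNR_eq] at h
  by_contra h0
  have : energy s = 0 := le_antisymm (not_lt.1 h0) (energy_nonneg s)
  simp [this] at h

theorem ne_zero_of_energy_symbols_pos {φ : ℝ} {s₀ : Fin N → ℝ} (h : 0 < energy (symbols φ s₀)) :
    s₀ ≠ 0 := by
  rintro rfl
  simp [energy_symbols] at h

/-- Phase, symbols and noise level enter the relative noise only through the SNR, whence the
uniformity in them. -/
theorem relNoise_eq {s : Fin N → ℂ} {σ : ℝ} (hσ : 0 < σ) (E : Matrix (Sensor M) (Fin N) ℂ) :
    relNoise s (σ • E) = noiseNorm E / √(effectiveSNR s σ) := by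
  rw [relNoise, noiseNorm_smul hσ.le, effectiveSNR_eq, Real.sqrt_div (energy_nonneg s),
    Real.sqrt_sq hσ.le]
  field_simp

/-- An odd function of a circular noise matrix has mean zero. -/
theorem integral_eq_zero_of_odd {Ω : Type*} [MeasurableSpace Ω] {P : Measure Ω}
    {W : Ω → Matrix (Sensor M) (Fin N) ℂ} (hW : IsCircularInLaw P W)
    {f : Matrix (Sensor M) (Fin N) ℂ → ℝ} (hf : Continuous f) (hodd : ∀ E, f (-E) = -f E) :
    ∫ ω, f (W ω) ∂P = 0 := by
  have hc : Continuous fun V : Sensor M × Fin N → ℂ => f (Matrix.of fun m t => V (m, t)) :=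
    hf.comp (continuous_matrix fun m t => continuous_apply _)
  -- Rotation by `π` is negation. Integrability is not needed: an integral equal to its own negative
  -- vanishes.
  have h := ((hW π).comp hc.measurable).integral_eq
  have hexp : Complex.exp (Complex.I * (π : ℂ)) = -1 := by
    rw [mul_comm, Complex.exp_pi_mul_I]
  have h1 : ∀ ω, f (Matrix.of fun m t => Complex.exp (Complex.I * (π : ℂ)) * W ω m t) =
      -f (W ω) := fun ω => by
    rw [← hodd, hexp]
    congr 1
    ext m t
    simp
  simp only [Function.comp_def, h1] at h
  rw [integral_neg] at h
  have h2 : ∫ ω, f (W ω) ∂P = ∫ ω, f (Matrix.of fun m t => W ω m t) ∂P := rfl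
  rw [← h2] at h
  linarith

theorem noiseNorm_pow_four_le (E : Matrix (Sensor M) (Fin N) ℂ) :
    noiseNorm E ^ 4 ≤ Fintype.card (Sensor M × Fin N) * ∑ m, ∑ t, ‖E m t‖ ^ 4 := by
  have h1 : noiseNorm E ^ 4 = (∑ p : Sensor M × Fin N, ‖E p.1 p.2‖ ^ 2) ^ 2 := by
    rw [Fintype.sum_prod_type]
    calc noiseNorm E ^ 4 = (noiseNorm E ^ 2) ^ 2 := by ring
      _ = _ := by rw [noiseNorm_sq]
  rw [h1]
  refine sq_sum_le_card_mul_sum_sq.trans_eq ?_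
  rw [Fintype.sum_prod_type, Finset.card_univ]
  simp only [← pow_mul]

end MeanSquare

/-! ### From the error expansion to mean square errors. -/

section Main

variable {R N : ℕ} {M : Fin R → ℕ} {r : Fin R} {μ : Fin R → ℝ} {method : Method}

theorem HasErrorExpansion.first_order
    (h : HasErrorExpansion (M := M) (N := N) r μ fun φ s₀ E μhat =>
      IsEstimate method r (measurement μ (symbols φ s₀) E) μhat)
    (φ : ℝ) {s₀ : Fin N → ℝ} (hs : s₀ ≠ 0) :
    ∃ C δ : ℝ, 0 < δ ∧ ∀ (E : Matrix (Sensor M) (Fin N) ℂ) (μhat : ℝ), noiseNorm E ≤ δ →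
      IsEstimate method r (measurement μ (symbols φ s₀) E) μhat →
      |μhat - μ r - linearError r μ (symbols φ s₀) E| ≤ C * noiseNorm E ^ 2 := by
  obtain ⟨C, δ, hC, hδ, h⟩ := h
  obtain ⟨q, -, -, hq, -, hR⟩ := h φ s₀ hs
  have hS := energy_symbols_pos φ hs
  have hS' : 0 < √(energy (symbols φ s₀)) := Real.sqrt_pos.2 hS
  -- The radius also forces `x ≤ 1`, so the cubic remainder is bounded by the quadratic term; hence
  -- the factor `2`.
  refine ⟨2 * C / energy (symbols φ s₀), min δ 1 * √(energy (symbols φ s₀)),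
    mul_pos (lt_min hδ one_pos) hS', fun E μhat hE hest => ?_⟩
  have hx : relNoise (symbols φ s₀) E ≤ min δ 1 := (div_le_iff₀ hS').2 hE
  have hx0 := relNoise_nonneg (symbols φ s₀) E
  have hx2 := relNoise_sq (symbols φ s₀) E
  set x := relNoise (symbols φ s₀) E with hxdef
  have h1 := hR E μhat (hx.trans (min_le_left _ _)) hest
  have h2 := hq E
  have h3 : x ^ 3 ≤ x ^ 2 :=
    pow_le_pow_of_le_one hx0 (hx.trans (min_le_right _ _)) (by norm_num)
  have h4 := abs_add_le (μhat - μ r - linearError r μ (symbols φ s₀) E - q E) (q E)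
  rw [sub_add_cancel] at h4
  calc _ ≤ 2 * C * x ^ 2 := by nlinarith
    _ = _ := by rw [hx2]; ring

theorem HasErrorExpansion.mean_sq_of_fixed_law (hM : ∀ l, 1 ≤ M l) (hr : 2 ≤ M r)
    (hμ : μ r ∈ Set.Ioo (-π) π)
    (h : HasErrorExpansion (M := M) (N := N) r μ fun φ s₀ E μhat =>
      IsEstimate method r (measurement μ (symbols φ s₀) E) μhat)
    {Ω : Type*} [MeasurableSpace Ω] {P : Measure Ω} [IsProbabilityMeasure P]
    {W : Ω → Matrix (Sensor M) (Fin N) ℂ} (hW : IsCircularWhite P W 1) {ε : ℝ} (hε : 0 < ε) :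
    ∃ ρ₀ : ℝ, 0 < ρ₀ ∧ ∀ (φ : ℝ) (s₀ : Fin N → ℝ) (σ : ℝ), 0 < σ →
      ρ₀ ≤ effectiveSNR (symbols φ s₀) σ → ∀ μhat : Ω → ℝ, AEMeasurable μhat P →
      (∀ᵐ ω ∂P, IsEstimate method r (measurement μ (symbols φ s₀) (σ • W ω)) (μhat ω)) →
      Integrable (fun ω => (μhat ω - μ r) ^ 2) P ∧
      |∫ ω, (μhat ω - μ r) ^ 2 ∂P - asymptoticMSE M r (effectiveSNR (symbols φ s₀) σ)|
        ≤ ε / effectiveSNR (symbols φ s₀) σ := by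
  obtain ⟨C, δ, hC, hδ, h⟩ := h
  -- The constant of `abs_sq_sub_sq_le` with the a priori bound `2 * π` on the error.
  set K := 8 * C ^ 2 + ((2 * π) ^ 2 / (min δ 1) ^ 2 + C ^ 2) / min δ 1 with hK
  have hδ' : 0 < min δ 1 := lt_min hδ one_pos
  have hK0 : 0 < K := by positivity
  have hnm := hW.aestronglyMeasurable_comp continuous_noiseNorm
  have hlim := tendsto_truncated_second_moment (fun ω => noiseNorm_nonneg (W ω)) hnm
    hW.integrable_noiseNorm_sq
  obtain ⟨ρ₁, hρ₁⟩ := eventually_atTop.1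
    (hlim.eventually (gt_mem_nhds (div_pos hε hK0)))
  refine ⟨max ρ₁ 1, by positivity, fun φ s₀ σ hσ hρ μhat hm hest => ?_⟩
  set ρ := effectiveSNR (symbols φ s₀) σ with hρdef
  have hρ1 : 1 ≤ ρ := (le_max_right _ _).trans hρ
  have hρ0 : 0 < ρ := by linarith
  have hS := energy_pos_of_effectiveSNR_pos hρ0
  have hs := ne_zero_of_energy_symbols_pos hS
  obtain ⟨q, -, -, hq, hL, hR⟩ := h φ s₀ hs
  obtain ⟨hb, hint⟩ := integrable_estimate_error_sq hμ hm hest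
  have hlin := linearError_mean_sq hM hr μ hS (hW.smul σ)
  refine ⟨hint, ?_⟩
  have hhi : Integrable (fun ω => K / ρ * (noiseNorm (W ω) ^ 2 *
      min 1 (noiseNorm (W ω) / √ρ))) P := by
    refine (hW.integrable_noiseNorm_sq.mono ?_ (Eventually.of_forall fun ω => ?_)).const_mul _
    · exact ((hnm.aemeasurable.pow_const 2).mul ((aemeasurable_const (b := (1 : ℝ))).min
        (hnm.aemeasurable.div_const √ρ))).aestronglyMeasurable
    · have h1 : 0 ≤ min 1 (noiseNorm (W ω) / √ρ) :=
        le_min zero_le_one (div_nonneg (noiseNorm_nonneg _) (Real.sqrt_nonneg _))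
      rw [Real.norm_eq_abs, Real.norm_eq_abs, abs_of_nonneg (mul_nonneg (sq_nonneg _) h1),
        abs_of_nonneg (sq_nonneg _)]
      exact mul_le_of_le_one_right (sq_nonneg _) (min_le_left _ _)
  rw [← hlin.2]
  refine (abs_integral_sub_le hint hlin.1 hhi ?_).trans ?_
  · filter_upwards [hb, hest] with ω hω hω'
    have hx := relNoise_eq (s := symbols φ s₀) hσ (W ω)
    have h1 := abs_sq_sub_sq_le hC hδ' (min_le_right _ _)
      (relNoise_nonneg (symbols φ s₀) (σ • W ω)) hω (hL _) (hq _)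
      fun hle => hR _ _ (hle.trans (min_le_left _ _)) hω'
    refine h1.trans_eq ?_
    rw [hx, ← hρdef, div_pow, Real.sq_sqrt hρ0.le, ← hK]
    ring
  · rw [integral_const_mul, div_mul_eq_mul_div]
    gcongr
    have := hρ₁ ρ ((le_max_left _ _).trans hρ)
    rw [lt_div_iff₀ hK0] at this
    linarith

theorem HasErrorExpansion.mean_sq_of_circular (hM : ∀ l, 1 ≤ M l) (hr : 2 ≤ M r)
    (hμ : μ r ∈ Set.Ioo (-π) π)
    (h : HasErrorExpansion (M := M) (N := N) r μ fun φ s₀ E μhat =>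
      IsEstimate method r (measurement μ (symbols φ s₀) E) μhat) (K : ℝ) :
    ∃ C : ℝ, ∀ (Ω : Type*) [MeasurableSpace Ω] (P : Measure Ω) [IsProbabilityMeasure P]
      (W : Ω → Matrix (Sensor M) (Fin N) ℂ) (φ : ℝ) (s₀ : Fin N → ℝ) (σ : ℝ), 0 < σ →
      IsCircularWhite P W σ → IsCircularInLaw P W →
      (∀ m t, Integrable (fun ω => ‖W ω m t‖ ^ 4) P ∧ ∫ ω, ‖W ω m t‖ ^ 4 ∂P ≤ K * σ ^ 4) →
      0 < effectiveSNR (symbols φ s₀) σ → ∀ μhat : Ω → ℝ, AEMeasurable μhat P →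
      (∀ᵐ ω ∂P, IsEstimate method r (measurement μ (symbols φ s₀) (W ω)) (μhat ω)) →
      Integrable (fun ω => (μhat ω - μ r) ^ 2) P ∧
      |∫ ω, (μhat ω - μ r) ^ 2 ∂P - asymptoticMSE M r (effectiveSNR (symbols φ s₀) σ)|
        ≤ C / effectiveSNR (symbols φ s₀) σ ^ 2 := by
  obtain ⟨C, δ, hC, hδ, h⟩ := h
  have hδ' : 0 < min δ 1 := lt_min hδ one_pos
  set B := 6 * C ^ 2 + ((2 * π) ^ 2 / (min δ 1) ^ 4 + C ^ 2 / (min δ 1) ^ 2 +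
    2 * C ^ 2 / min δ 1) with hB
  have hB0 : 0 ≤ B := by positivity
  set n : ℝ := (Fintype.card (Sensor M × Fin N) : ℝ) with hn
  -- `B` is the pointwise remainder constant; one factor `n` comes from Cauchy-Schwarz in
  -- `noiseNorm_pow_four_le`, the other from summing the fourth moments of the entries.
  refine ⟨B * (n * (n * K)), fun Ω _ P _ W φ s₀ σ hσ hW hcirc h4 hρ0 μhat hm hest => ?_⟩
  have hS := energy_pos_of_effectiveSNR_pos hρ0
  have hs := ne_zero_of_energy_symbols_pos hS
  obtain ⟨q, hqc, hqe, hq, hL, hR⟩ := h φ s₀ hs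
  obtain ⟨hb, hint⟩ := integrable_estimate_error_sq hμ hm hest
  have hlin := linearError_mean_sq hM hr μ hS hW
  refine ⟨hint, ?_⟩
  set S := energy (symbols φ s₀) with hSdef
  have hLc := continuous_linearError (r := r) μ (symbols φ s₀) (M := M)
  have hi4 : Integrable (fun ω => ∑ m, ∑ t, ‖W ω m t‖ ^ 4) P :=
    integrable_finsetSum _ fun m _ => integrable_finsetSum _ fun t _ => (h4 m t).1
  have hrel : ∀ E : Matrix (Sensor M) (Fin N) ℂ, relNoise (symbols φ s₀) E ^ 4 ≤
      n / S ^ 2 * ∑ m, ∑ t, ‖E m t‖ ^ 4 := fun E => by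
    have h1 : relNoise (symbols φ s₀) E ^ 4 = noiseNorm E ^ 4 / S ^ 2 := by
      calc _ = (relNoise (symbols φ s₀) E ^ 2) ^ 2 := by ring
        _ = _ := by rw [relNoise_sq, div_pow, ← pow_mul]
    rw [h1, div_mul_eq_mul_div]
    gcongr
    exact noiseNorm_pow_four_le E
  -- The product is of order `x ^ 3 ≤ 1 + x ^ 4`, which fourth moments make integrable.
  have hprod : Integrable (fun ω => 2 * (linearError r μ (symbols φ s₀) (W ω) * q (W ω))) P := by
    refine Integrable.const_mul (Integrable.mono' (((integrable_const (1 : ℝ)).add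
      (hi4.const_mul (n / S ^ 2))).const_mul (C ^ 2)) (hW.aestronglyMeasurable_comp (hLc.mul hqc))
      (Eventually.of_forall fun ω => ?_)) 2
    have hx0 := relNoise_nonneg (symbols φ s₀) (W ω)
    have h4' := hrel (W ω)
    have hl := hL (W ω)
    have hq' := hq (W ω)
    set x := relNoise (symbols φ s₀) (W ω) with hx
    change ‖linearError r μ (symbols φ s₀) (W ω) * q (W ω)‖ ≤
      C ^ 2 * (1 + n / S ^ 2 * ∑ m, ∑ t, ‖W ω m t‖ ^ 4)
    rw [Real.norm_eq_abs, abs_mul]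
    calc _ ≤ (C * x) * (C * x ^ 2) := by gcongr
      _ = C ^ 2 * x ^ 3 := by ring
      _ ≤ C ^ 2 * (1 + x ^ 4) := by
        gcongr
        nlinarith [sq_nonneg (x ^ 2 - x), sq_nonneg (x - 1), sq_nonneg (x ^ 2 - 1)]
      _ ≤ _ := by gcongr
  -- Odd times even is odd: the cross term, which could be of order `ρ ^ (-3 / 2)`, averages to
  -- zero.
  have hzero : ∫ ω, 2 * (linearError r μ (symbols φ s₀) (W ω) * q (W ω)) ∂P = 0 := by
    rw [integral_const_mul, integral_eq_zero_of_odd hcirc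
      (f := fun E => linearError r μ (symbols φ s₀) E * q E) (hLc.mul hqc)
      (fun E => by rw [map_neg, hqe, neg_mul]), mul_zero]
  have hsum : ∫ ω, (linearError r μ (symbols φ s₀) (W ω) ^ 2 +
      2 * (linearError r μ (symbols φ s₀) (W ω) * q (W ω))) ∂P =
      asymptoticMSE M r (effectiveSNR (symbols φ s₀) σ) := by
    rw [integral_add hlin.1 hprod, hzero, add_zero, hlin.2]
  rw [← hsum]
  refine (abs_integral_sub_le hint (hlin.1.add hprod)
    ((hi4.const_mul (n / S ^ 2)).const_mul B) ?_).trans ?_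
  · filter_upwards [hb, hest] with ω hω hω'
    have h1 := abs_sq_sub_sq_sub_le hC hδ' (min_le_right _ _)
      (relNoise_nonneg (symbols φ s₀) (W ω)) hω (hL _) (hq _)
      fun hle => hR _ _ (hle.trans (min_le_left _ _)) hω'
    rw [Pi.add_apply, ← sub_sub]
    exact h1.trans (mul_le_mul_of_nonneg_left (hrel (W ω)) hB0)
  · have hmom : ∫ ω, ∑ m, ∑ t, ‖W ω m t‖ ^ 4 ∂P ≤ n * (K * σ ^ 4) := by
      rw [integral_finsetSum _ fun m _ => integrable_finsetSum _ fun t _ => (h4 m t).1]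
      calc _ ≤ ∑ _m : Sensor M, ∑ _t : Fin N, K * σ ^ 4 := by
            refine Finset.sum_le_sum fun m _ => ?_
            rw [integral_finsetSum _ fun t _ => (h4 m t).1]
            exact Finset.sum_le_sum fun t _ => (h4 m t).2
        _ = _ := by
          simp only [Finset.sum_const, Finset.card_univ, nsmul_eq_mul, hn, Fintype.card_prod,
            Nat.cast_mul]
          ring
    rw [integral_const_mul, integral_const_mul, effectiveSNR_eq, ← hSdef]
    calc B * (n / S ^ 2 * ∫ ω, ∑ m, ∑ t, ‖W ω m t‖ ^ 4 ∂P) ≤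
          B * (n / S ^ 2 * (n * (K * σ ^ 4))) := by gcongr
      _ = _ := by field_simp

end Main

end Esprit

theorem theorem5 {R : ℕ} (M : Fin R → ℕ) (N : ℕ) (hM : ∀ l, 1 ≤ M l)
    (r : Fin R) (hr : 2 ≤ M r) (μ : Fin R → ℝ) (hμ : μ r ∈ Set.Ioo (-Real.pi) Real.pi)
    (method : Esprit.Method) :
    -- first-order error expansion, and the mean square of its linear term
    (∀ (φ : ℝ) (s₀ : Fin N → ℝ), s₀ ≠ 0 →
      ∃ L : Matrix (Esprit.Sensor M) (Fin N) ℂ →ₗ[ℝ] ℝ,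
        (∃ C δ : ℝ, 0 < δ ∧ ∀ (E : Matrix (Esprit.Sensor M) (Fin N) ℂ) (μhat : ℝ),
          Esprit.noiseNorm E ≤ δ →
          Esprit.IsEstimate method r (Esprit.measurement μ (Esprit.symbols φ s₀) E) μhat →
          |μhat - μ r - L E| ≤ C * Esprit.noiseNorm E ^ 2) ∧
        ∀ (Ω : Type*) [MeasurableSpace Ω] (P : Measure Ω) [IsProbabilityMeasure P]
          (W : Ω → Matrix (Esprit.Sensor M) (Fin N) ℂ) (σ : ℝ), 0 < σ →
          Esprit.IsCircularWhite P W σ →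
          Integrable (fun ω => L (W ω) ^ 2) P ∧
          ∫ ω, L (W ω) ^ 2 ∂P =
            Esprit.asymptoticMSE M r (Esprit.effectiveSNR (Esprit.symbols φ s₀) σ)) ∧
    -- mean square error of the estimate, noise with finite second-order moments only
    (∀ (Ω : Type*) [MeasurableSpace Ω] (P : Measure Ω) [IsProbabilityMeasure P]
      (W : Ω → Matrix (Esprit.Sensor M) (Fin N) ℂ), Esprit.IsCircularWhite P W 1 →
      ∀ ε : ℝ, 0 < ε → ∃ ρ₀ : ℝ, 0 < ρ₀ ∧
        ∀ (φ : ℝ) (s₀ : Fin N → ℝ) (σ : ℝ), 0 < σ →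
          ρ₀ ≤ Esprit.effectiveSNR (Esprit.symbols φ s₀) σ →
          ∀ μhat : Ω → ℝ, AEMeasurable μhat P →
          (∀ᵐ ω ∂P, Esprit.IsEstimate method r
            (Esprit.measurement μ (Esprit.symbols φ s₀) (σ • W ω)) (μhat ω)) →
          Integrable (fun ω => (μhat ω - μ r) ^ 2) P ∧
          |∫ ω, (μhat ω - μ r) ^ 2 ∂P -
              Esprit.asymptoticMSE M r (Esprit.effectiveSNR (Esprit.symbols φ s₀) σ)|
            ≤ ε / Esprit.effectiveSNR (Esprit.symbols φ s₀) σ) ∧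
    -- mean square error of the estimate with the second-order remainder
    (∀ K : ℝ, ∃ C ρ₀ : ℝ, 0 < ρ₀ ∧
      ∀ (Ω : Type*) [MeasurableSpace Ω] (P : Measure Ω) [IsProbabilityMeasure P]
        (W : Ω → Matrix (Esprit.Sensor M) (Fin N) ℂ) (φ : ℝ) (s₀ : Fin N → ℝ) (σ : ℝ), 0 < σ →
        Esprit.IsCircularWhite P W σ → Esprit.IsCircularInLaw P W →
        (∀ m t, Integrable (fun ω => ‖W ω m t‖ ^ 4) P ∧ ∫ ω, ‖W ω m t‖ ^ 4 ∂P ≤ K * σ ^ 4) →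
        ρ₀ ≤ Esprit.effectiveSNR (Esprit.symbols φ s₀) σ →
        ∀ μhat : Ω → ℝ, AEMeasurable μhat P →
        (∀ᵐ ω ∂P, Esprit.IsEstimate method r
          (Esprit.measurement μ (Esprit.symbols φ s₀) (W ω)) (μhat ω)) →
        Integrable (fun ω => (μhat ω - μ r) ^ 2) P ∧
        |∫ ω, (μhat ω - μ r) ^ 2 ∂P -
            Esprit.asymptoticMSE M r (Esprit.effectiveSNR (Esprit.symbols φ s₀) σ)|
          ≤ C / Esprit.effectiveSNR (Esprit.symbols φ s₀) σ ^ 2) := by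
  have h := Esprit.hasErrorExpansion (N := N) hM hr hμ method
  refine ⟨fun φ s₀ hs => ⟨Esprit.linearError r μ (Esprit.symbols φ s₀), h.first_order φ hs,
    fun Ω _ P _ W σ _ hW =>
      Esprit.linearError_mean_sq hM hr μ (Esprit.energy_symbols_pos φ hs) hW⟩,
    fun Ω _ P _ W hW ε hε => h.mean_sq_of_fixed_law hM hr hμ hW hε, fun K => ?_⟩
  obtain ⟨C, hC⟩ := h.mean_sq_of_circular hM hr hμ K
  -- The bound holds at every positive SNR, so any positive threshold serves.
  exact ⟨C, 1, one_pos, fun Ω _ P _ W φ s₀ σ hσ hW hc h4 hρ =>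
    hC Ω P W φ s₀ σ hσ hW hc h4 (by linarith)⟩
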